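/- Let $n\ge 3$. On $\mathbb{R}^{2,n}$, with coordinates $y^{-1},y^0,y^1,\dots,y^n$ and metric $\eta=\mathrm{diag}(1,1,-1,\dots,-1)$, put $y^2=\eta_{ab}y^ay^b$, $y_a=\eta_{ab}y^b$, $\partial_a=\partial/\partial y^a$, and let $\mathcal G_n=\mathfrak{so}(2,n)$, with basis $(M_{ab})_{a<b}$, act on functions by $U(M_{ab})=L_{ab}=y_a\partial_b-y_b\partial_a$; let $U(\mathbf C_2)=-\tfrac12L_{ab}L^{ab}$ be the Casimir operator. Let $X$ be the universal covering of $\{y\in\mathbb{R}^{2,n}: y^2\ge 0,\ y\ne 0\}$ and let $C^\infty(X)$ be the space of complex functions on $X$ that are smooth up to the boundary $y^2=0$, with the topology of uniform convergence of all derivatives on compact subsets of $X$. Put $x_{\pm1}=\frac{i}{\sqrt2}(y^{-1}\pm iy^0)$, fix a branch of $\log x_1$ on $X$, and let $$\varphi_1=x_{-1}x_1^{-n/2},\qquad \varphi_2=x_1^{-(n-2)/2},\qquad \varphi_3=y^2\,x_1^{-(n+2)/2}$$ in $C^\infty(X)$. Let $\mathcal H_i$ be the closure in $C^\infty(X)$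 of $\mathcal U(\mathcal G_n^{\mathbb C})\varphi_i$, $i=1,2,3$. For $E\in\mathbb{R}$ let $D(E,0,\dots,0)$ be the irreducible highest weight representation of $\mathcal G_n$ with highest weight $(-E,0,\dots,0)$, i.e. the irreducible one generated by a vector $v\neq0$ with $-iM_{-1,0}v=-Ev$, $M_{jk}v=0$ and $(M_{-1,k}+iM_{0,k})v=0$ for $1\le j,k\le n$. A topological $\mathcal G_n$-module carries $D(E,0,\dots,0)$ if its $\mathfrak{so}(2)\oplus\mathfrak{so}(n)$-finite vectors are dense and form a $\mathcal G_n$-module isomorphic to $D(E,0,\dots,0)$. Then: 1. $\mathcal H_1\supsetneq\mathcal H_2\supsetneq\mathcal H_3$, and each $\mathcal H_i$ is a closed $\mathcal G_n$-invariant subspace. 2. $\mathcal H_1/\mathcal H_2$ and $\mathcal H_3$ carry $D(\frac{n+2}2,0,\dots,0)$, while $\mathcal H_2/\mathcal H_3$ carries $D(\frac{n-2}2,0,\dots,0)$ (the $C_n$-massless representation of spin $0$). 3. $\bigl[U(\mathbf C_2)+\frac{(n-2)(n+2)}4\bigr]\varphi_i=0$ for $i=2,3$; $\bigl[U(\mathbf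 C_2)+\frac{(n-2)(n+2)}4\bigr]\varphi_1=-n\varphi_3\ne0$; and $\bigl[U(\mathbf C_2)+\frac{(n-2)(n+2)}4\bigr]^2\varphi_1=0$. 4. For every $\varphi\in\mathcal H_3$ and every point $p$ of $X$ over the cone $Q^{2,n}=\{y^2=0\}$, $\varphi(q)\to0$ as $q\to p$ with $y^2(q)>0$. Moreover a function of $\mathcal H_2$ vanishes on the cone if and only if it belongs to $\mathcal H_3$, and the space of restrictions to the cone of the functions of $\mathcal H_2$, a $\mathcal G_n$-module of smooth functions on the covering of $Q^{2,n}\setminus\{0\}$, carries $D(\frac{n-2}2,0,\dots,0)$. -/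

import Mathlib

open scoped ContDiff Topology

noncomputable section

namespace GuptaBleuler

/-- Indices of the coordinates of `ℝ^{2,n}`: `inl 0, inl 1` are the indices `-1, 0` of the
positive directions and `inr j` (`j = 0, …, n-1`) is the index `j + 1`. -/
abbrev Idx (n : ℕ) : Type := Fin 2 ⊕ Fin n

/-- The diagonal entries of the metric `η` of signature `(2, n)`. -/
def eta {n : ℕ} : Idx n → ℝ := Sum.elim (fun _ => 1) (fun _ => -1)

/-- Ambient space for the coordinates `(z, 𝐲)` of the covering space below. -/
abbrev Amb (n : ℕ) : Type := ℂ × EuclideanSpace ℝ (Fin n)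

/-- The universal covering of `{y ∈ ℝ^{2,n} | y² ≥ 0, y ≠ 0}`.  The point `(z, 𝐲)` lies over the
point `y` with `y^{-1} + i y^0 = exp z` and with spatial part `𝐲`, so that `y² ≥ 0` means
`‖𝐲‖ ≤ |exp z|`. -/
def cov (n : ℕ) : Set (Amb n) := {p | ‖p.2‖ ≤ Real.exp p.1.re}

/-- The coordinate functions `y^a`, as functions on the covering. -/
def coord {n : ℕ} : Idx n → Amb n → ℝ
  | Sum.inl 0, p => (Complex.exp p.1).re
  | Sum.inl 1, p => (Complex.exp p.1).im
  | Sum.inr j, p => p.2 j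

/-- `y² = y^a y_a`. -/
def ysq {n : ℕ} (p : Amb n) : ℝ := ∑ a, eta a * coord a p ^ 2

/-- The vector field `∂/∂y^a`, lifted to the covering. -/
def frame {n : ℕ} : Idx n → Amb n → Amb n
  | Sum.inl 0, p => (Complex.exp (-p.1), 0)
  | Sum.inl 1, p => (Complex.I * Complex.exp (-p.1), 0)
  | Sum.inr j, _ => (0, EuclideanSpace.single j 1)

theorem ysq_eq {n : ℕ} (p : Amb n) : ysq p = Real.exp p.1.re ^ 2 - ‖p.2‖ ^ 2 := by
  have h : ‖Complex.exp p.1‖ ^ 2 = (Complex.exp p.1).re ^ 2 + (Complex.exp p.1).im ^ 2 := by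
    rw [← Complex.normSq_eq_norm_sq, Complex.normSq_apply]; ring
  rw [Complex.norm_exp] at h
  rw [EuclideanSpace.norm_sq_eq, h]
  simp [ysq, eta, coord, Fintype.sum_sum_type, sub_eq_add_neg]

theorem mem_cov_iff {n : ℕ} (p : Amb n) : p ∈ cov n ↔ 0 ≤ ysq p := by
  rw [ysq_eq, sub_nonneg, sq_le_sq₀ (norm_nonneg _) (Real.exp_pos _).le]; rfl

theorem coord_contDiff {n : ℕ} (a : Idx n) : ContDiff ℝ ∞ (coord a) := by
  have h : ContDiff ℝ ∞ (fun p : Amb n => Complex.exp p.1) :=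
    (Complex.contDiff_exp (𝕜 := ℝ)).comp contDiff_fst
  match a with
  | Sum.inl 0 => exact Complex.reCLM.contDiff.comp h
  | Sum.inl 1 => exact Complex.imCLM.contDiff.comp h
  | Sum.inr j => exact (EuclideanSpace.proj (𝕜 := ℝ) j).contDiff.comp contDiff_snd

theorem frame_contDiff {n : ℕ} (a : Idx n) : ContDiff ℝ ∞ (frame a) := by
  have h : ContDiff ℝ ∞ (fun p : Amb n => Complex.exp (-p.1)) :=
    (Complex.contDiff_exp (𝕜 := ℝ)).comp contDiff_fst.neg
  match a with
  | Sum.inl 0 => exact h.prodMk contDiff_const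
  | Sum.inl 1 => exact (contDiff_const.mul h).prodMk contDiff_const
  | Sum.inr j => exact contDiff_const

theorem cov_uniqueDiffOn (n : ℕ) : UniqueDiffOn ℝ (cov n) := by
  let S : Set (Amb n) := Set.univ ×ˢ Metric.closedBall 0 1
  let Φ : Amb n → Amb n := fun q => (q.1, Real.exp q.1.re • q.2)
  have hS : UniqueDiffOn ℝ S :=
    uniqueDiffOn_univ.prod (uniqueDiffOn_convex (convex_closedBall _ _)
      ⟨0, Metric.ball_subset_interior_closedBall (Metric.mem_ball_self one_pos)⟩)
  have him : Φ '' S = cov n := by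
    ext ⟨z, y⟩
    constructor
    · rintro ⟨⟨w, u⟩, ⟨-, hu⟩, h⟩
      have hu' : ‖u‖ ≤ 1 := by simpa using hu
      obtain ⟨rfl, rfl⟩ := Prod.mk.inj h
      change ‖Real.exp w.re • u‖ ≤ Real.exp w.re
      rw [norm_smul, Real.norm_of_nonneg (Real.exp_pos _).le]
      nlinarith [Real.exp_pos w.re]
    · intro h
      have h' : ‖y‖ ≤ Real.exp z.re := h
      refine ⟨(z, (Real.exp z.re)⁻¹ • y), ⟨trivial, ?_⟩, ?_⟩
      · simp only [mem_closedBall_zero_iff, norm_smul, norm_inv,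
          Real.norm_of_nonneg (Real.exp_pos z.re).le]
        rw [inv_mul_le_iff₀ (Real.exp_pos _)]
        simpa using h'
      · simp [Φ, smul_smul, (Real.exp_pos z.re).ne']
  have hΦ : ∀ q : Amb n, HasFDerivAt Φ ((ContinuousLinearMap.fst ℝ _ _).prod
      (Real.exp q.1.re • ContinuousLinearMap.snd ℝ ℂ (EuclideanSpace ℝ (Fin n)) +
        (Real.exp q.1.re • (Complex.reCLM.comp (ContinuousLinearMap.fst ℝ _ _))).smulRight q.2)) q := by
    intro q
    have h1 : HasFDerivAt (fun q : Amb n => q.1.re)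
        (Complex.reCLM.comp (ContinuousLinearMap.fst ℝ _ _)) q :=
      Complex.reCLM.hasFDerivAt.comp q hasFDerivAt_fst
    exact hasFDerivAt_fst.prodMk (h1.exp.smul hasFDerivAt_snd)
  rw [← him]
  refine hS.image (fun q _ => (hΦ q).hasFDerivWithinAt) fun q _ => ?_
  refine Function.Surjective.denseRange ?_
  rintro ⟨ζ, w⟩
  refine ⟨(ζ, (Real.exp q.1.re)⁻¹ • w - ζ.re • q.2), ?_⟩
  simp [smul_sub, smul_smul, (Real.exp_pos q.1.re).ne']

instance (n : ℕ) : LocallyCompactSpace (cov n) :=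
  (isClosed_le (by fun_prop) (Real.continuous_exp.comp
    (Complex.continuous_re.comp continuous_fst)) : IsClosed (cov n)).locallyCompactSpace

theorem cov_subset_closure (n : ℕ) : cov n ⊆ closure (interior (cov n)) := by
  intro p hp
  have hc : Continuous fun s : ℝ => ((p.1 + s, p.2) : Amb n) := by fun_prop
  have ht : Filter.Tendsto (fun s : ℝ => ((p.1 + s, p.2) : Amb n)) (𝓝[>] 0) (𝓝 p) := by
    have := (hc.tendsto 0).mono_left (nhdsWithin_le_nhds (s := Set.Ioi 0))
    simpa using this
  refine mem_closure_of_tendsto ht (Filter.eventually_of_mem self_mem_nhdsWithin fun s hs => ?_)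
  have ho : IsOpen {q : Amb n | ‖q.2‖ < Real.exp q.1.re} :=
    isOpen_lt (by fun_prop) (Real.continuous_exp.comp (Complex.continuous_re.comp continuous_fst))
  refine interior_maximal (s := cov n) (t := {q : Amb n | ‖q.2‖ < Real.exp q.1.re})
    (fun q hq => (show ‖q.2‖ < Real.exp q.1.re from hq).le) ho ?_
  have hp' : ‖p.2‖ ≤ Real.exp p.1.re := hp
  refine lt_of_le_of_lt hp' ?_
  simpa using hs

/-- The derivative of `y^b` along `∂/∂y^a`. -/
theorem fderiv_coord {n : ℕ} (a b : Idx n) (p : Amb n) :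
    fderiv ℝ (coord b) p (frame a p) = if a = b then 1 else 0 := by
  have h : HasFDerivAt (fun p : Amb n => Complex.exp p.1)
      ((Complex.exp p.1 • (1 : ℂ →L[ℝ] ℂ)).comp (ContinuousLinearMap.fst ℝ _ _)) p :=
    (Complex.hasStrictFDerivAt_exp_real p.1).hasFDerivAt.comp p hasFDerivAt_fst
  have e : Complex.exp p.1 * Complex.exp (-p.1) = 1 := by rw [← Complex.exp_add]; simp
  have e' : Complex.exp p.1 * (Complex.I * Complex.exp (-p.1)) = Complex.I := by
    rw [mul_left_comm, e, mul_one]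
  match b with
  | Sum.inl 0 =>
    have h2 : HasFDerivAt (coord (Sum.inl 0)) _ p := Complex.reCLM.hasFDerivAt.comp p h
    rw [h2.fderiv]
    match a with
    | Sum.inl 0 => simp [frame, e, -Complex.mul_re]
    | Sum.inl 1 => simp [frame, e', -Complex.mul_re]
    | Sum.inr k => simp [frame]
  | Sum.inl 1 =>
    have h2 : HasFDerivAt (coord (Sum.inl 1)) _ p := Complex.imCLM.hasFDerivAt.comp p h
    rw [h2.fderiv]
    match a with
    | Sum.inl 0 => simp [frame, e, -Complex.mul_im]
    | Sum.inl 1 => simp [frame, e', -Complex.mul_im]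
    | Sum.inr k => simp [frame]
  | Sum.inr j =>
    have h2 : HasFDerivAt (coord (Sum.inr j)) ((EuclideanSpace.proj (𝕜 := ℝ) j).comp
        (ContinuousLinearMap.snd ℝ ℂ (EuclideanSpace ℝ (Fin n)))) p :=
      (EuclideanSpace.proj (𝕜 := ℝ) j).hasFDerivAt.comp p hasFDerivAt_snd
    rw [h2.fderiv]
    match a with
    | Sum.inl 0 => simp [frame]
    | Sum.inl 1 => simp [frame]
    | Sum.inr k => simp [frame, PiLp.single_apply, eq_comm]

/-- The fields `∂/∂y^a` commute. -/
theorem fderiv_frame {n : ℕ} (a b : Idx n) (p : Amb n) :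
    fderiv ℝ (frame b) p (frame a p) = fderiv ℝ (frame a) p (frame b p) := by
  have h : HasFDerivAt (fun p : Amb n => Complex.exp (-p.1))
      ((Complex.exp (-p.1) • (1 : ℂ →L[ℝ] ℂ)).comp (-ContinuousLinearMap.fst ℝ _ _)) p :=
    (Complex.hasStrictFDerivAt_exp_real (-p.1)).hasFDerivAt.comp p hasFDerivAt_fst.neg
  have key : ∀ (c : Idx n) (v : Amb n), fderiv ℝ (frame c) p v = (-(v.1 * (frame c p).1), 0) := by
    intro c v
    match c with
    | Sum.inl 0 =>
      have h2 : HasFDerivAt (frame (n := n) (Sum.inl 0)) _ p :=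
        h.prodMk (hasFDerivAt_const (0 : EuclideanSpace ℝ (Fin n)) p)
      rw [h2.fderiv]
      simp [frame, mul_comm]
    | Sum.inl 1 =>
      have h2 : HasFDerivAt (frame (n := n) (Sum.inl 1)) _ p :=
        (h.const_mul Complex.I).prodMk (hasFDerivAt_const (0 : EuclideanSpace ℝ (Fin n)) p)
      rw [h2.fderiv]
      simp [frame, mul_comm, mul_left_comm]
    | Sum.inr j =>
      have h2 : HasFDerivAt (frame (n := n) (Sum.inr j)) (0 : Amb n →L[ℝ] Amb n) p :=
        hasFDerivAt_const _ _
      rw [h2.fderiv]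
      simp [frame, Prod.ext_iff]
  rw [key, key, mul_comm]

/-- Smooth functions on the covering, up to and including its boundary `y² = 0`. -/
def smoothSubmodule (n : ℕ) : Submodule ℂ (cov n → ℂ) where
  carrier := {f | ∃ F : Amb n → ℂ, ContDiffOn ℝ ∞ F (cov n) ∧ ∀ p : cov n, F p = f p}
  add_mem' := by
    rintro f g ⟨F, hF, hf⟩ ⟨G, hG, hg⟩
    exact ⟨F + G, hF.add hG, fun p => by simp [hf, hg]⟩
  zero_mem' := ⟨0, contDiffOn_const, fun _ => rfl⟩
  smul_mem' := by
    rintro c f ⟨F, hF, hf⟩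
    exact ⟨fun p => c * F p, contDiffOn_const.mul hF, fun p => by simp [hf]⟩

/-- The space `C^∞` of smooth functions on the covering.  It is kept apart from the subtype so that
it does not inherit the topology of pointwise convergence. -/
def Smooth (n : ℕ) : Type := smoothSubmodule n

instance (n : ℕ) : AddCommGroup (Smooth n) := inferInstanceAs (AddCommGroup (smoothSubmodule n))
instance (n : ℕ) : Module ℂ (Smooth n) := inferInstanceAs (Module ℂ (smoothSubmodule n))
instance (n : ℕ) : CoeFun (Smooth n) (fun _ => cov n → ℂ) := ⟨fun f => f.1⟩

/-- Extension of a function on the covering by zero to the ambient space. -/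
def ext {n : ℕ} (f : cov n → ℂ) : Amb n → ℂ := Function.extend Subtype.val f 0

theorem ext_apply {n : ℕ} (f : cov n → ℂ) (p : cov n) : ext f p = f p :=
  Subtype.val_injective.extend_apply f 0 p

theorem Smooth.ext_contDiffOn {n : ℕ} (f : Smooth n) : ContDiffOn ℝ ∞ (ext f) (cov n) := by
  obtain ⟨F, hF, h⟩ := f.2
  exact hF.congr fun p hp => by rw [h ⟨p, hp⟩]; exact ext_apply f.1 ⟨p, hp⟩

theorem Smooth.hext {n : ℕ} {f g : Smooth n} (h : ∀ p, f p = g p) : f = g :=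
  Subtype.ext (funext h)

@[simp] theorem Smooth.add_apply {n : ℕ} (f g : Smooth n) (p : cov n) : (f + g) p = f p + g p := rfl
@[simp] theorem Smooth.smul_apply {n : ℕ} (c : ℂ) (f : Smooth n) (p : cov n) :
    (c • f) p = c * f p := rfl
@[simp] theorem Smooth.zero_apply {n : ℕ} (p : cov n) : (0 : Smooth n) p = 0 := rfl
@[simp] theorem Smooth.neg_apply {n : ℕ} (f : Smooth n) (p : cov n) : (-f) p = - f p := rfl

/-- A smooth function on the ambient space, restricted to the covering. -/
def Smooth.of {n : ℕ} (F : Amb n → ℂ) (hF : ContDiffOn ℝ ∞ F (cov n)) : Smooth n :=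
  ⟨fun p => F p, F, hF, fun _ => rfl⟩

theorem Smooth.of_ext {n : ℕ} (f : Smooth n) : Smooth.of (ext f) f.ext_contDiffOn = f :=
  Smooth.hext fun p => ext_apply f.1 p

theorem Smooth.differentiableWithinAt {n : ℕ} (f : Smooth n) (p : cov n) :
    DifferentiableWithinAt ℝ (ext f) (cov n) p :=
  f.ext_contDiffOn.differentiableOn (by simp) p p.2

theorem ext_of {n : ℕ} {F : Amb n → ℂ} (hF : ContDiffOn ℝ ∞ F (cov n)) :
    Set.EqOn (ext (Smooth.of F hF)) F (cov n) := fun p hp => ext_apply (fun q : cov n => F q) ⟨p, hp⟩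

theorem fderivWithin_frame_contDiffOn {n : ℕ} (a : Idx n) {F : Amb n → ℂ}
    (hF : ContDiffOn ℝ ∞ F (cov n)) :
    ContDiffOn ℝ ∞ (fun p => fderivWithin ℝ F (cov n) p (frame a p)) (cov n) :=
  (hF.fderivWithin (cov_uniqueDiffOn n) (by simp)).clm_apply (frame_contDiff a).contDiffOn

/-- The operator `∂_a = ∂/∂y^a` on smooth functions. -/
def pd {n : ℕ} (a : Idx n) : Smooth n →ₗ[ℂ] Smooth n where
  toFun f := Smooth.of (fun p => fderivWithin ℝ (ext f) (cov n) p (frame a p))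
    (fderivWithin_frame_contDiffOn a f.ext_contDiffOn)
  map_add' f g := Smooth.hext fun p => by
    have h : Set.EqOn (ext (f + g)) (ext f + ext g) (cov n) := fun q hq => by
      have := ext_apply (f + g).1 ⟨q, hq⟩
      have h1 := ext_apply f.1 ⟨q, hq⟩
      have h2 := ext_apply g.1 ⟨q, hq⟩
      simp only [Pi.add_apply] at *
      rw [this, h1, h2]; rfl
    change fderivWithin ℝ (ext (f + g)) (cov n) p (frame a p) =
      fderivWithin ℝ (ext f) (cov n) p (frame a p) + fderivWithin ℝ (ext g) (cov n) p (frame a p)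
    rw [fderivWithin_congr h (h p.2), fderivWithin_add (cov_uniqueDiffOn n p p.2)
      (f.differentiableWithinAt p) (g.differentiableWithinAt p)]
    rfl
  map_smul' c f := Smooth.hext fun p => by
    have h : Set.EqOn (ext (c • f)) (c • ext f) (cov n) := fun q hq => by
      have := ext_apply (c • f).1 ⟨q, hq⟩
      have h1 := ext_apply f.1 ⟨q, hq⟩
      simp only [Pi.smul_apply] at *
      rw [this, h1]; rfl
    change fderivWithin ℝ (ext (c • f)) (cov n) p (frame a p) =
      c * fderivWithin ℝ (ext f) (cov n) p (frame a p)
    rw [fderivWithin_congr h (h p.2), fderivWithin_const_smul (cov_uniqueDiffOn n p p.2)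
      (f.differentiableWithinAt p)]
    rfl

/-- Multiplication by the coordinate `y^b`. -/
def mulCoord {n : ℕ} (b : Idx n) : Smooth n →ₗ[ℂ] Smooth n where
  toFun f := Smooth.of (fun p => (coord b p : ℂ) * ext f p)
    ((Complex.ofRealCLM.contDiff.comp (coord_contDiff b)).contDiffOn.mul f.ext_contDiffOn)
  map_add' f g := Smooth.hext fun p => by
    change (coord b p : ℂ) * ext (f + g) p = (coord b p : ℂ) * ext f p + (coord b p : ℂ) * ext g p
    rw [ext_apply, ext_apply, ext_apply, ← mul_add]; rfl
  map_smul' c f := Smooth.hext fun p => by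
    change (coord b p : ℂ) * ext (c • f) p = c * ((coord b p : ℂ) * ext f p)
    rw [ext_apply, ext_apply, mul_left_comm]; rfl

theorem mulCoord_apply {n : ℕ} (b : Idx n) (f : Smooth n) (p : cov n) :
    mulCoord b f p = (coord b p : ℂ) * f p := by
  change (coord b p : ℂ) * ext f p = _
  rw [ext_apply]

theorem pd_apply {n : ℕ} (a : Idx n) (f : Smooth n) (p : cov n) :
    pd a f p = fderivWithin ℝ (ext f) (cov n) p (frame a p) := rfl

theorem pd_of {n : ℕ} (a : Idx n) {F : Amb n → ℂ} (hF : ContDiffOn ℝ ∞ F (cov n)) (p : cov n) :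
    pd a (Smooth.of F hF) p = fderivWithin ℝ F (cov n) p (frame a p) := by
  rw [pd_apply, fderivWithin_congr (ext_of hF) (ext_of hF p.2)]

theorem mulCoord_comm {n : ℕ} (a b : Idx n) (f : Smooth n) :
    mulCoord a (mulCoord b f) = mulCoord b (mulCoord a f) :=
  Smooth.hext fun p => by simp only [mulCoord_apply]; ring

theorem pd_mulCoord {n : ℕ} (a b : Idx n) (f : Smooth n) :
    pd a (mulCoord b f) = (if a = b then f else 0) + mulCoord b (pd a f) :=
  Smooth.hext fun p => by
    have hu := cov_uniqueDiffOn n p p.2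
    have hc : HasFDerivWithinAt (fun q : Amb n => (coord b q : ℂ))
        (Complex.ofRealCLM.comp (fderiv ℝ (coord b) p)) (cov n) p :=
      (Complex.ofRealCLM.hasFDerivAt.comp (p : Amb n)
        ((coord_contDiff b).differentiable (by simp) p).hasFDerivAt).hasFDerivWithinAt
    have h := (hc.mul (f.differentiableWithinAt p).hasFDerivWithinAt).fderivWithin hu
    have h2 : pd a (mulCoord b f) p = fderivWithin ℝ
        ((fun q : Amb n => (coord b q : ℂ)) * ext f) (cov n) p (frame a p) := pd_of a _ p
    rw [h2, h, Smooth.add_apply, mulCoord_apply, pd_apply]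
    simp [fderiv_coord, ext_apply]
    split_ifs <;> simp [add_comm]

theorem pd_comm {n : ℕ} (a b : Idx n) (f : Smooth n) : pd a (pd b f) = pd b (pd a f) :=
  Smooth.hext fun p => by
    have hu := cov_uniqueDiffOn n p p.2
    have key : ∀ a b : Idx n, pd a (pd b f) p =
        fderivWithin ℝ (fderivWithin ℝ (ext f) (cov n)) (cov n) p (frame a p) (frame b p) +
        fderivWithin ℝ (ext f) (cov n) p (fderiv ℝ (frame b) p (frame a p)) := by
      intro a b
      have h1 : DifferentiableWithinAt ℝ (fderivWithin ℝ (ext f) (cov n)) (cov n) p :=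
        (f.ext_contDiffOn.fderivWithin (m := ∞) (cov_uniqueDiffOn n) (by simp)).differentiableOn
          (by simp) p p.2
      have h2 : HasFDerivWithinAt (frame b) (fderiv ℝ (frame b) p) (cov n) p :=
        ((frame_contDiff b).differentiable (by simp) p).hasFDerivAt.hasFDerivWithinAt
      have h := (h1.hasFDerivWithinAt.clm_apply h2).fderivWithin hu
      have h3 : pd a (pd b f) p = fderivWithin ℝ (fun q =>
        fderivWithin ℝ (ext f) (cov n) q (frame b q)) (cov n) p (frame a p) := pd_of a _ p
      rw [h3, h]
      simp [add_comm]
    have hs : IsSymmSndFDerivWithinAt ℝ (ext f) (cov n) p :=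
      (f.ext_contDiffOn p p.2).isSymmSndFDerivWithinAt (by simp; exact WithTop.coe_le_coe.2 le_top) (cov_uniqueDiffOn n)
        (cov_subset_closure n p.2) p.2
    rw [key a b, key b a, fderiv_frame a b, hs]

/-- The complexification of the Lie algebra `so(2,n)`. -/
abbrev 𝔤 (n : ℕ) : Type := LieAlgebra.Orthogonal.so' (Fin 2) (Fin n) ℂ

theorem bracket_aux {ι R : Type*} [Fintype ι] [DecidableEq ι] [Ring R] [Algebra ℂ R]
    (E : ι → ι → R) (hE : ∀ a b c d, E a b * E c d - E c d * E a b =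
      (if a = d then E c b else 0) - (if c = b then E a d else 0)) (A B : Matrix ι ι ℂ) :
    (∑ a, ∑ b, A a b • E a b) * (∑ a, ∑ b, B a b • E a b) -
      (∑ a, ∑ b, B a b • E a b) * (∑ a, ∑ b, A a b • E a b) =
    -∑ a, ∑ b, (A * B - B * A) a b • E a b := by
  have h1 : ∀ A B : Matrix ι ι ℂ, (∑ a, ∑ b, A a b • E a b) * (∑ a, ∑ b, B a b • E a b) =
      ∑ x : (ι × ι) × (ι × ι), (A x.1.1 x.1.2 * B x.2.1 x.2.2) • (E x.1.1 x.1.2 * E x.2.1 x.2.2) := by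
    intro A B
    simp only [← Fintype.sum_prod_type', Finset.sum_mul_sum, smul_mul_smul_comm]
  have h2 : (∑ a, ∑ b, B a b • E a b) * (∑ a, ∑ b, A a b • E a b) =
      ∑ x : (ι × ι) × (ι × ι), (A x.1.1 x.1.2 * B x.2.1 x.2.2) • (E x.2.1 x.2.2 * E x.1.1 x.1.2) := by
    rw [h1, ← (Equiv.prodComm (ι × ι) (ι × ι)).sum_comp]
    simp [mul_comm]
  rw [h1, h2, ← Finset.sum_sub_distrib]
  simp only [← smul_sub, hE]
  simp only [smul_sub, Finset.sum_sub_distrib, Matrix.sub_apply, sub_smul, neg_sub]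
  congr 1
  · simp only [Fintype.sum_prod_type, smul_ite, smul_zero, Finset.sum_ite_eq, Finset.mem_univ,
      if_true, Matrix.mul_apply, Finset.sum_smul]
    rw [Finset.sum_comm]
    calc _ = ∑ y, ∑ c, ∑ a, (A a y * B c a) • E c y :=
          Finset.sum_congr rfl fun y _ => Finset.sum_comm
      _ = _ := by
          rw [Finset.sum_comm]
          exact Finset.sum_congr rfl fun _ _ => Finset.sum_congr rfl fun _ _ =>
            Finset.sum_congr rfl fun _ _ => by rw [mul_comm]
  · simp only [Fintype.sum_prod_type, smul_ite, smul_zero, Matrix.mul_apply, Finset.sum_smul]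
    refine Finset.sum_congr rfl fun a _ => ?_
    calc _ = ∑ b, ∑ d, (A a b * B b d) • E a d := by
          refine Finset.sum_congr rfl fun b _ => ?_
          rw [Finset.sum_comm]
          exact Finset.sum_congr rfl fun d _ => by simp
      _ = _ := Finset.sum_comm

theorem field_comm {n : ℕ} (a b c d : Idx n) :
    (mulCoord b * pd a) * (mulCoord d * pd c) - (mulCoord d * pd c) * (mulCoord b * pd a) =
      (if a = d then mulCoord b * pd c else 0) -
        (if c = b then mulCoord d * pd a else (0 : Module.End ℂ (Smooth n))) := by
  refine LinearMap.ext fun f => ?_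
  simp only [Module.End.mul_apply, pd_mulCoord, map_add, LinearMap.sub_apply]
  rw [pd_comm a c, mulCoord_comm b d]
  split_ifs <;> simp

section Action

attribute [local instance 100] LieRing.ofAssociativeRing

/-- The linear vector field `-∑ A_{ab} y^b ∂_a` attached to a matrix `A`. -/
def vectorField (n : ℕ) : Matrix (Idx n) (Idx n) ℂ →ₗ⁅ℂ⁆ Module.End ℂ (Smooth n) where
  toFun A := -∑ a, ∑ b, A a b • (mulCoord b * pd a)
  map_add' A B := by
    simp only [Matrix.add_apply, add_smul, Finset.sum_add_distrib, neg_add]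
  map_smul' c A := by
    simp only [Matrix.smul_apply, smul_eq_mul, mul_smul, Finset.smul_sum, smul_neg, RingHom.id_apply]
  map_lie' {A B} := by
    rw [LieRing.of_associative_ring_bracket, LieRing.of_associative_ring_bracket, neg_mul_neg,
      neg_mul_neg]
    exact (bracket_aux (fun a b => mulCoord b * pd a) (fun a b c d => field_comm a b c d) A B).symm

instance (n : ℕ) : LieRingModule (𝔤 n) (Smooth n) :=
  LieRingModule.compLieHom (Smooth n)
    ((vectorField n).comp (LieAlgebra.Orthogonal.so' (Fin 2) (Fin n) ℂ).incl)

instance (n : ℕ) : LieModule ℂ (𝔤 n) (Smooth n) :=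
  LieModule.compLieHom (Smooth n)
    ((vectorField n).comp (LieAlgebra.Orthogonal.so' (Fin 2) (Fin n) ℂ).incl)

end Action

theorem lie_def {n : ℕ} (A : 𝔤 n) (f : Smooth n) :
    ⁅A, f⁆ = -∑ a, ∑ b, A.1 a b • mulCoord b (pd a f) := by
  change (-∑ a, ∑ b, A.1 a b • (mulCoord b * pd a) : Module.End ℂ (Smooth n)) f = _
  simp [LinearMap.sum_apply]

theorem mem_so' {n : ℕ} (A : Matrix (Idx n) (Idx n) ℂ) :
    A ∈ LieAlgebra.Orthogonal.so' (Fin 2) (Fin n) ℂ ↔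
      ∀ a b, (eta b : ℂ) * A b a = -(eta a * A a b) := by
  have hd : LieAlgebra.Orthogonal.indefiniteDiagonal (Fin 2) (Fin n) ℂ =
      Matrix.diagonal fun a => (eta a : ℂ) := by
    unfold LieAlgebra.Orthogonal.indefiniteDiagonal
    congr 1
    funext a
    rcases a with i | j <;> simp [eta]
  rw [LieAlgebra.Orthogonal.so', mem_skewAdjointMatricesLieSubalgebra,
    mem_skewAdjointMatricesSubmodule, hd, Matrix.IsSkewAdjoint, Matrix.IsAdjointPair,
    ← Matrix.ext_iff]
  refine forall_congr' fun a => forall_congr' fun b => ?_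
  rw [Matrix.mul_diagonal, Matrix.diagonal_mul, Matrix.transpose_apply, Matrix.neg_apply, mul_neg,
    mul_comm]

/-- The basis element `M_{ab}` of `so(2,n)`: it acts on functions as `y_a ∂_b - y_b ∂_a`. -/
def M {n : ℕ} (a b : Idx n) : 𝔤 n :=
  ⟨Matrix.single a b (eta b : ℂ) - Matrix.single b a (eta a : ℂ), by
    rw [mem_so']
    intro c d
    simp only [Matrix.sub_apply, Matrix.single_apply]
    by_cases h1 : a = c <;> by_cases h2 : b = d <;> by_cases h3 : a = d <;> by_cases h4 : b = c <;>
      simp_all [mul_comm]⟩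

theorem lie_M {n : ℕ} (a b : Idx n) (f : Smooth n) :
    ⁅M a b, f⁆ = (eta a : ℂ) • mulCoord a (pd b f) - (eta b : ℂ) • mulCoord b (pd a f) := by
  have h : ∀ (c d : Idx n) (t : ℂ),
      ∑ x, ∑ y, Matrix.single c d t x y • mulCoord y (pd x f) = t • mulCoord d (pd c f) := by
    intro c d t
    rw [Finset.sum_eq_single c, Finset.sum_eq_single d]
    · simp
    · intro y _ hy
      simp [hy.symm]
    · simp
    · intro x _ hx
      exact Finset.sum_eq_zero fun y _ => by simp [hx.symm]
    · simp
  rw [lie_def]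
  simp only [M, Matrix.sub_apply, sub_smul, Finset.sum_sub_distrib, h, neg_sub]

/-- Iterated derivatives. -/
def derivs {n : ℕ} : List (Idx n) → Smooth n →ₗ[ℂ] Smooth n
  | [] => LinearMap.id
  | a :: l => derivs l ∘ₗ pd a

/-- A smooth function, as a continuous function. -/
def toC (n : ℕ) : Smooth n →ₗ[ℂ] C(cov n, ℂ) where
  toFun f := ⟨f, by
    have h := f.ext_contDiffOn.continuousOn.domRestrict
    exact h.congr fun p => ext_apply f.1 p⟩
  map_add' _ _ := rfl
  map_smul' _ _ := rfl

/-- All derivatives of a smooth function. -/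
def jets (n : ℕ) : Smooth n →ₗ[ℂ] (List (Idx n) → C(cov n, ℂ)) :=
  LinearMap.pi fun l => toC n ∘ₗ derivs l

/-- The `C^∞` topology: uniform convergence of all derivatives on the compact subsets of the
covering. -/
instance (n : ℕ) : TopologicalSpace (Smooth n) := .induced (jets n) inferInstance

instance (n : ℕ) : IsTopologicalAddGroup (Smooth n) := topologicalAddGroup_induced (jets n)

instance (n : ℕ) : ContinuousSMul ℂ (Smooth n) := continuousSMul_induced (jets n)

theorem continuous_pd {n : ℕ} (a : Idx n) : Continuous (pd (n := n) a) :=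
  continuous_induced_rng.2 <| continuous_pi fun l =>
    (continuous_apply (a :: l)).comp (continuous_induced_dom (f := jets n))

theorem continuous_mulCoord {n : ℕ} (b : Idx n) : Continuous (mulCoord (n := n) b) := by
  refine continuous_induced_rng.2 (continuous_pi fun l => ?_)
  change Continuous fun f => toC n (derivs l (mulCoord b f))
  have hj : ∀ l : List (Idx n), Continuous fun f => toC n (derivs l f) := fun l =>
    (continuous_apply l).comp (continuous_induced_dom (f := jets n))
  induction l with
  | nil =>
    let c : C(cov n, ℂ) := ⟨fun p => (coord b p : ℂ),
      Complex.continuous_ofReal.comp ((coord_contDiff b).continuous.comp continuous_subtype_val)⟩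
    have h : ∀ f, toC n (derivs [] (mulCoord b f)) = c * toC n (derivs [] f) := fun f =>
      ContinuousMap.ext fun p => mulCoord_apply b f p
    simp only [h]
    exact continuous_const.mul (hj [])
  | cons a l ih =>
    have h : ∀ f, toC n (derivs (a :: l) (mulCoord b f)) =
        toC n (derivs l (if a = b then f else 0)) + toC n (derivs l (mulCoord b (pd a f))) := by
      intro f
      change toC n (derivs l (pd a (mulCoord b f))) = _
      rw [pd_mulCoord, map_add, map_add]
    simp only [h]
    refine Continuous.add ?_ (ih.comp (continuous_pd a))
    split_ifs
    · exact hj l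
    · exact continuous_const

theorem continuous_lie {n : ℕ} (A : 𝔤 n) : Continuous fun f : Smooth n => ⁅A, f⁆ := by
  simp only [lie_def]
  exact (continuous_finsetSum _ fun a _ => continuous_finsetSum _ fun b _ =>
    ((continuous_mulCoord b).comp (continuous_pd a)).const_smul (A.1 a b)).neg

/-- The closure of a submodule, which is again a submodule. -/
def lieClosure {n : ℕ} (N : LieSubmodule ℂ (𝔤 n) (Smooth n)) : LieSubmodule ℂ (𝔤 n) (Smooth n) where
  __ := N.toSubmodule.topologicalClosure
  lie_mem {A _} hf := map_mem_closure (continuous_lie A) hf fun _ hg => N.lie_mem hg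

/-- `cl(U(𝔤) φ)`: the closure of the module generated by `φ`. -/
def closedSpan {n : ℕ} (φ : Smooth n) : LieSubmodule ℂ (𝔤 n) (Smooth n) :=
  lieClosure (LieSubmodule.lieSpan ℂ (𝔤 n) {φ})

/-- The derivative of a function that vanishes on the cone `y² = 0`, in a direction tangent to the
cone, is zero. -/
theorem tangent_deriv_eq_zero {n : ℕ} {f : Smooth n} (hf : ∀ p : cov n, ysq p.1 = 0 → f p = 0)
    (p : cov n) (hp : ysq p.1 = 0) (W : Amb n)
    (hW : Real.exp p.1.1.re ^ 2 * W.1.re = inner ℝ p.1.2 W.2) :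
    fderivWithin ℝ (ext f) (cov n) p W = 0 := by
  obtain ⟨⟨z, y⟩, hpc⟩ := p
  obtain ⟨ζ, w⟩ := W
  simp only at hW hp ⊢
  have hexp := Real.exp_pos z.re
  have hy2 : ‖y‖ ^ 2 = Real.exp z.re ^ 2 := by
    have := ysq_eq (n := n) (z, y)
    simp only at this
    linarith
  have hy : ‖y‖ = Real.exp z.re := by
    rwa [sq_eq_sq₀ (norm_nonneg _) hexp.le] at hy2
  let S : Set ℝ := {s | y + s • w ≠ 0}
  have hSo : IsOpen S := isOpen_ne_fun (by fun_prop) continuous_const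
  have hS0 : (0 : ℝ) ∈ S := by
    have : y ≠ 0 := norm_ne_zero_iff.1 (by rw [hy]; exact hexp.ne')
    simpa [S] using this
  let γ : ℝ → Amb n := fun s =>
    (((2⁻¹ * Real.log (‖y + s • w‖ ^ 2) : ℝ) : ℂ) + ((z.im + s * ζ.im : ℝ) : ℂ) * Complex.I, y + s • w)
  have hcone : ∀ s ∈ S, ysq (γ s) = 0 := by
    intro s hs
    have hpos : 0 < ‖y + s • w‖ := norm_pos_iff.2 hs
    have hre : (γ s).1.re = Real.log ‖y + s • w‖ := by
      simp [γ, Real.log_pow]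
    rw [ysq_eq, hre, Real.exp_log hpos]
    simp [γ]
  have hcov : ∀ s ∈ S, γ s ∈ cov n := fun s hs => (mem_cov_iff _).2 (hcone s hs).ge
  have hγ0 : γ 0 = (z, y) := by
    refine Prod.ext ?_ (by simp [γ])
    simp only [γ, zero_smul, add_zero, zero_mul, hy, Real.log_pow, Real.log_exp]
    push_cast
    rw [show (2 : ℂ)⁻¹ * (2 * (z.re : ℂ)) = z.re by ring]
    exact Complex.re_add_im z
  have hline : HasDerivAt (fun s : ℝ => y + s • w) w 0 := by
    simpa using ((hasDerivAt_id (0 : ℝ)).smul_const w).const_add y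
  have hγ : HasDerivAt γ (ζ, w) 0 := by
    have h1 : HasDerivAt (fun s : ℝ => ‖y + s • w‖ ^ 2) (2 * inner ℝ y w) 0 := by
      simpa using hline.norm_sq
    have h2 : HasDerivAt (fun s : ℝ => 2⁻¹ * Real.log (‖y + s • w‖ ^ 2)) ζ.re 0 := by
      have := (h1.log (by simp [hy2, hexp.ne'])).const_mul (2⁻¹ : ℝ)
      have hval : (2⁻¹ : ℝ) * (2 * inner ℝ y w / ‖y + (0 : ℝ) • w‖ ^ 2) = ζ.re := by
        rw [← hW, zero_smul, add_zero, hy2]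
        field_simp
      rwa [hval] at this
    have h3 : HasDerivAt (fun s : ℝ => z.im + s * ζ.im) ζ.im 0 := by
      simpa using ((hasDerivAt_id (0 : ℝ)).mul_const ζ.im).const_add z.im
    have h4 := h2.ofReal_comp.add (h3.ofReal_comp.mul_const Complex.I)
    rw [Complex.re_add_im] at h4
    exact h4.prodMk hline
  have hd := f.differentiableWithinAt ⟨(z, y), hpc⟩
  have hd' : HasFDerivWithinAt (ext f) (fderivWithin ℝ (ext f) (cov n) (z, y)) (cov n) (γ 0) := by
    rw [hγ0]; exact hd.hasFDerivWithinAt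
  have hcomp := hd'.comp_hasDerivWithinAt (0 : ℝ) (hγ.hasDerivWithinAt (s := S)) hcov
  have hzero : HasDerivWithinAt (ext f ∘ γ) 0 S 0 :=
    (hasDerivWithinAt_const (0 : ℝ) S (0 : ℂ)).congr (fun s hs => by
      change ext f (γ s) = 0
      rw [ext_apply f.1 ⟨γ s, hcov s hs⟩]
      exact hf _ (hcone s hs)) (by
      change ext f (γ 0) = 0
      rw [ext_apply f.1 ⟨γ 0, hcov 0 hS0⟩]
      exact hf _ (hcone 0 hS0))
  exact (hSo.uniqueDiffWithinAt hS0).eq_deriv _ hcomp hzero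

theorem cone_pair {n : ℕ} {f : Smooth n} (hf : ∀ p : cov n, ysq p.1 = 0 → f p = 0)
    (p : cov n) (hp : ysq p.1 = 0) (a b : Idx n) :
    ((eta b * coord b p.1 : ℝ) : ℂ) * pd a f p = ((eta a * coord a p.1 : ℝ) : ℂ) * pd b f p := by
  have key : ∀ c : Idx n, Real.exp p.1.1.re ^ 2 * (frame c p.1).1.re -
      inner ℝ p.1.2 (frame c p.1).2 = eta c * coord c p.1 := by
    intro c
    have e1 : ∀ t : ℝ, Real.exp p.1.1.re ^ 2 * (Real.exp (-p.1.1.re) * t) = Real.exp p.1.1.re * t := by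
      intro t
      rw [Real.exp_neg]
      field_simp
    match c with
    | Sum.inl 0 => simp [frame, eta, coord, Complex.exp_re, e1]
    | Sum.inl 1 =>
      have := e1 (Real.sin p.1.1.im)
      simp [frame, eta, coord, Complex.exp_im, this]
    | Sum.inr j => simp [frame, eta, coord, EuclideanSpace.inner_single_right]
  have h := tangent_deriv_eq_zero hf p hp
    ((eta b * coord b p.1) • frame a p.1 - (eta a * coord a p.1) • frame b p.1) (by
      have ha := key a
      have hb := key b
      simp only [Prod.fst_sub, Prod.smul_fst, Prod.snd_sub, Prod.smul_snd, Complex.sub_re,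
        Complex.real_smul, Complex.re_ofReal_mul, inner_sub_right, inner_smul_right]
      rw [← ha, ← hb]
      ring)
  rw [map_sub, map_smul, map_smul, sub_eq_zero] at h
  simpa only [pd_apply, Complex.real_smul] using h

/-- The functions that vanish on the cone `y² = 0`. -/
def coneIdeal (n : ℕ) : LieSubmodule ℂ (𝔤 n) (Smooth n) where
  carrier := {f | ∀ p : cov n, ysq p.1 = 0 → f p = 0}
  add_mem' {f g} hf hg p hp := by rw [Smooth.add_apply, hf p hp, hg p hp, add_zero]
  zero_mem' _ _ := rfl
  smul_mem' c f hf p hp := by rw [Smooth.smul_apply, hf p hp, mul_zero]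
  lie_mem {A f} hf p hp := by
    have hA := (mem_so' A.1).1 A.2
    have he : ∀ a : Idx n, (eta a : ℂ) * eta a = 1 := by
      rintro (i | j) <;> simp [eta]
    have hpair := cone_pair hf p hp
    have hS : ⁅A, f⁆ p = -∑ a, ∑ b, A.1 a b * ((coord b p.1 : ℂ) * pd a f p) := by
      have hsum : ∀ (s : Finset (Idx n)) (g : Idx n → Smooth n), (∑ a ∈ s, g a) p = ∑ a ∈ s, g a p :=
        fun s g => map_sum (⟨⟨fun h : Smooth n => h p, rfl⟩, fun _ _ => rfl⟩ : Smooth n →+ ℂ) g s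
      rw [lie_def, Smooth.neg_apply, hsum]
      congr 1
      refine Finset.sum_congr rfl fun a _ => ?_
      rw [hsum]
      exact Finset.sum_congr rfl fun b _ => by rw [Smooth.smul_apply, mulCoord_apply]
    have hanti : ∑ a, ∑ b, A.1 a b * ((coord b p.1 : ℂ) * pd a f p) =
        -∑ a, ∑ b, A.1 a b * ((coord b p.1 : ℂ) * pd a f p) := by
      conv_rhs => rw [Finset.sum_comm]
      rw [← Finset.sum_neg_distrib]
      refine Finset.sum_congr rfl fun a _ => ?_
      rw [← Finset.sum_neg_distrib]
      refine Finset.sum_congr rfl fun b _ => ?_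
      have h1 := hpair a b
      have h2 := hA a b
      push_cast at h1
      linear_combination (eta b * A.1 a b) * h1 - (A.1 a b * coord b p.1 * pd a f p) * he b +
        (eta b * coord a p.1 * pd b f p) * h2 - (A.1 b a * coord a p.1 * pd b f p) * he b
    rw [hS, neg_eq_zero]
    exact self_eq_neg.1 hanti

instance {n : ℕ} {V : Type*} [AddCommGroup V] [Module ℂ V] [TopologicalSpace V]
    [LieRingModule (𝔤 n) V] (N : LieSubmodule ℂ (𝔤 n) V) : TopologicalSpace (V ⧸ N) :=
  inferInstanceAs (TopologicalSpace (V ⧸ N.toSubmodule))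

/-- A branch of `log x₁` on the covering, where `x₁ = (i/√2)(y^{-1} + i y^0)`. -/
def logX {n : ℕ} (p : Amb n) : ℂ := p.1 + Complex.log (Complex.I / (√2 : ℝ))

/-- `x₁ ^ s` on the covering. -/
def xPow {n : ℕ} (s : ℂ) (p : Amb n) : ℂ := Complex.exp (s * logX p)

/-- `x₋₁ = (i/√2)(y^{-1} - i y^0)`. -/
def xNeg {n : ℕ} (p : Amb n) : ℂ :=
  Complex.I / (√2 : ℝ) * (coord (Sum.inl 0) p - Complex.I * coord (Sum.inl 1) p)

theorem xPow_one {n : ℕ} (p : Amb n) : xPow 1 p =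
    Complex.I / (√2 : ℝ) * (coord (Sum.inl 0) p + Complex.I * coord (Sum.inl 1) p) := by
  have h0 : Complex.I / ((√2 : ℝ) : ℂ) ≠ 0 := by simp
  have h1 : (coord (Sum.inl 0) p : ℂ) + Complex.I * coord (Sum.inl 1) p = Complex.exp p.1 := by
    rw [mul_comm]; exact Complex.re_add_im _
  rw [xPow, one_mul, logX, Complex.exp_add, Complex.exp_log h0, h1, mul_comm]

theorem xPow_contDiff {n : ℕ} (s : ℂ) : ContDiff ℝ ∞ (xPow (n := n) s) :=
  (Complex.contDiff_exp (𝕜 := ℝ)).comp (contDiff_const.mul (contDiff_fst.add contDiff_const))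

theorem coordC_contDiff {n : ℕ} (a : Idx n) : ContDiff ℝ ∞ fun p : Amb n => (coord a p : ℂ) :=
  Complex.ofRealCLM.contDiff.comp (coord_contDiff a)

theorem xNeg_contDiff {n : ℕ} : ContDiff ℝ ∞ (xNeg (n := n)) :=
  contDiff_const.mul ((coordC_contDiff _).sub (contDiff_const.mul (coordC_contDiff _)))

theorem ysq_contDiff {n : ℕ} : ContDiff ℝ ∞ fun p : Amb n => (ysq p : ℂ) := by
  have h : ContDiff ℝ ∞ (ysq (n := n)) := by
    unfold ysq
    exact ContDiff.sum fun a _ => contDiff_const.mul ((coord_contDiff a).pow 2)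
  exact Complex.ofRealCLM.contDiff.comp h

/-- `φ₁ = x₋₁ x₁^{-n/2}`. -/
def φ₁ (n : ℕ) : Smooth n := Smooth.of (fun p => xNeg p * xPow (-(n / 2)) p)
  (xNeg_contDiff.mul (xPow_contDiff _)).contDiffOn

/-- `φ₂ = x₁^{-(n-2)/2}`. -/
def φ₂ (n : ℕ) : Smooth n := Smooth.of (fun p => xPow (-((n - 2) / 2)) p)
  (xPow_contDiff _).contDiffOn

/-- `φ₃ = y² x₁^{-(n+2)/2}`. -/
def φ₃ (n : ℕ) : Smooth n := Smooth.of (fun p => ysq p * xPow (-((n + 2) / 2)) p)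
  (ysq_contDiff.mul (xPow_contDiff _)).contDiffOn

/-- `H₁ = cl(U(𝔤) φ₁)`. -/
def H₁ (n : ℕ) : LieSubmodule ℂ (𝔤 n) (Smooth n) := closedSpan (φ₁ n)

/-- `H₂ = cl(U(𝔤) φ₂)`. -/
def H₂ (n : ℕ) : LieSubmodule ℂ (𝔤 n) (Smooth n) := closedSpan (φ₂ n)

/-- `H₃ = cl(U(𝔤) φ₃)`. -/
def H₃ (n : ℕ) : LieSubmodule ℂ (𝔤 n) (Smooth n) := closedSpan (φ₃ n)

/-- The subquotient `N₁ / (N₁ ∩ N₂)`, which is `N₁ / N₂` when `N₂ ⊆ N₁`. -/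
abbrev SubQuot {n : ℕ} (N₁ N₂ : LieSubmodule ℂ (𝔤 n) (Smooth n)) : Type :=
  N₁ ⧸ N₂.comap N₁.incl

/-- The smooth functions on the (covering of the) cone `Q = {y² = 0}` without its vertex: the
smooth functions on the covering, modulo those that vanish on the cone. -/
abbrev ConeFn (n : ℕ) : Type := Smooth n ⧸ coneIdeal n

/-- The restrictions to the cone of the functions in `N`. -/
abbrev onCone {n : ℕ} (N : LieSubmodule ℂ (𝔤 n) (Smooth n)) : LieSubmodule ℂ (𝔤 n) (ConeFn n) :=
  N.map (LieSubmodule.Quotient.mk' (coneIdeal n))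

section Modules

variable {n : ℕ} {V : Type*} [AddCommGroup V] [Module ℂ V] [LieRingModule (𝔤 n) V]

/-- The action of the Casimir element `C₂ = -½ M_{ab} M^{ab}`. -/
def casimir (n : ℕ) {V : Type*} [AddCommGroup V] [Module ℂ V] [LieRingModule (𝔤 n) V] (v : V) : V :=
  (-(1 / 2) : ℂ) • ∑ a : Idx n, ∑ b : Idx n, ((eta a * eta b : ℝ) : ℂ) • ⁅M a b, ⁅M a b, v⁆⁆

/-- The operator `C₂ + (n-2)(n+2)/4`. -/
def shiftedCasimir (n : ℕ) {V : Type*} [AddCommGroup V] [Module ℂ V] [LieRingModule (𝔤 n) V]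
    (v : V) : V :=
  casimir n v + (((n - 2) * (n + 2) / 4 : ℝ) : ℂ) • v

/-- `X` lies in the complexification of the maximal compact subalgebra `so(2) ⊕ so(n)`, the algebra
of block diagonal matrices. -/
def IsCompactElt (X : 𝔤 n) : Prop :=
  ∀ (i : Fin 2) (j : Fin n), X.1 (Sum.inl i) (Sum.inr j) = 0 ∧ X.1 (Sum.inr j) (Sum.inl i) = 0

/-- `v` lies in a finite dimensional subspace that is stable under `so(2) ⊕ so(n)`. -/
def IsKFinite (n : ℕ) {V : Type*} [AddCommGroup V] [Module ℂ V] [LieRingModule (𝔤 n) V] (v : V) :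
    Prop :=
  ∃ W : Submodule ℂ V, FiniteDimensional ℂ W ∧ v ∈ W ∧
    ∀ X : 𝔤 n, IsCompactElt X → ∀ w ∈ W, ⁅X, w⁆ ∈ W

/-- `v` is a highest weight vector of weight `(-E, 0, …, 0)`.  The `so(2) ⊕ so(n)`-module with this
highest weight is one dimensional: `so(n)` acts by zero and the element `H₁ = -i M_{-1,0}` of the
Cartan algebra acts by `-E`.  The noncompact positive root vectors, which span `𝔭⁺`, are the
combinations of the elements `M_{-1,k} + i M_{0,k}`; they annihilate `v`. -/
structure IsHighestWeightVector (n : ℕ) {V : Type*} [AddCommGroup V] [Module ℂ V]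
    [LieRingModule (𝔤 n) V] (E : ℝ) (v : V) : Prop where
  ne_zero : v ≠ 0
  energy : -Complex.I • ⁅(M (Sum.inl 0) (Sum.inl 1) : 𝔤 n), v⁆ = -(E : ℂ) • v
  rotation : ∀ j k : Fin n, ⁅(M (Sum.inr j) (Sum.inr k) : 𝔤 n), v⁆ = 0
  raising : ∀ k : Fin n,
    ⁅(M (Sum.inl 0) (Sum.inr k) : 𝔤 n), v⁆ + Complex.I • ⁅(M (Sum.inl 1) (Sum.inr k) : 𝔤 n), v⁆ = 0

/-- The topological module `V` carries `D(E, 0, …, 0)`, the irreducible representation with highest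
weight `(-E, 0, …, 0)`: the `so(2) ⊕ so(n)`-finite vectors are dense in `V`, and they form an
irreducible module that contains a highest weight vector of weight `(-E, 0, …, 0)`. -/
structure Carries (n : ℕ) (V : Type*) [AddCommGroup V] [Module ℂ V] [TopologicalSpace V]
    [LieRingModule (𝔤 n) V] (E : ℝ) : Prop where
  dense : Dense {v : V | IsKFinite n v}
  irreducible : ∀ W : LieSubmodule ℂ (𝔤 n) V, (∀ w ∈ W, IsKFinite n w) →
    W = ⊥ ∨ ∀ v : V, IsKFinite n v → v ∈ W
  highest : ∃ v : V, IsKFinite n v ∧ IsHighestWeightVector n E v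

end Modules

end GuptaBleuler

end

/-!
With `u_k = y^k / (y^{-1} + i y^0)`, `t = y² / (y^{-1} + i y^0)²` and `w = -(n-2)/2`, the functions
`x₁^w F(u, t)` with `F` a polynomial form a `𝔤`-module that contains `φ₁, φ₂, φ₃`, up to scalars as
`F = t + u², 1, t`. On `F`, half of the noncompact generators act as the derivations `∂/∂u_k`, the
other half as conformal vector fields, and `so(2)` measures the degree, where `t` has degree `2`.
The wave operator commutes with the action: the module generated by `1` is its kernel, the one
generated by `t` consists of the elements of this kernel that vanish at `t = 0`, and the wave
operator maps `t + u²` to a nonzero multiple of `t`. Differentiating a harmonic polynomial down to a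
constant gives irreducibility of the subquotients.

The polynomial statements pass to the closures by Fourier expansion under the rotations of the
plane of `y^{-1}, y^0`. Each energy level consists of polynomials and is finite-dimensional, so the
energy components of an element of `𝓗ᵢ` already lie in `𝒰(𝔤) φᵢ`. Conversely, by Hahn–Banach and the
uniqueness of Fourier coefficients, a function lies in a closed subspace as soon as its components
do.
-/

noncomputable section

namespace GuptaBleuler

open MvPolynomial

/-! ### The Laplacian and the conformal vector fields on polynomials -/

section PolynomialDerivatives

variable {σ R : Type*} [CommRing R]

theorem pderiv_comm (j k : σ) (q : MvPolynomial σ R) :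
    pderiv j (pderiv k q) = pderiv k (pderiv j q) := by
  classical
  have hzero : ⁅(pderiv j : Derivation R (MvPolynomial σ R) (MvPolynomial σ R)), pderiv k⁆ = 0 :=
    derivation_ext fun i => by
      rw [Derivation.commutator_apply, pderiv_X, pderiv_X, Pi.single_apply, Pi.single_apply]
      split_ifs <;> simp
  exact sub_eq_zero.1 (by rw [← Derivation.commutator_apply, hzero, Derivation.zero_apply])

theorem eq_C_of_pderiv_eq_zero [IsDomain R] [CharZero R] {q : MvPolynomial σ R}
    (h : ∀ k, pderiv k q = 0) : q = C (coeff 0 q) := by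
  classical
  ext α
  rw [coeff_C]
  split_ifs with h0
  · rw [h0]
  · obtain ⟨k, hk⟩ := Finsupp.ne_iff.1 (Ne.symm h0)
    have hα : α - Finsupp.single k 1 + Finsupp.single k 1 = α :=
      tsub_add_cancel_of_le (Finsupp.single_le_iff.2 (Nat.one_le_iff_ne_zero.2 hk))
    have hcoeff := coeff_pderiv (i := k) q (α - Finsupp.single k 1)
    rw [h k, coeff_zero, hα] at hcoeff
    exact (mul_eq_zero.1 hcoeff.symm).resolve_right (Nat.cast_add_one_ne_zero _)

theorem exists_C_mem_of_pderiv_mem [IsDomain R] [CharZero R] {S : Set (MvPolynomial σ R)}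
    (hS : ∀ k, ∀ p ∈ S, pderiv k p ∈ S) {p : MvPolynomial σ R} (hp : p ∈ S) (h0 : p ≠ 0) :
    ∃ c ≠ 0, C c ∈ S := by
  have hdegree (N : ℕ) : ∀ p ∈ S, p ≠ 0 → (∀ α : σ →₀ ℕ, N ≤ α.degree → coeff α p = 0) →
      ∃ c ≠ 0, C c ∈ S := by
    induction N with
    | zero => exact fun p _ h0 hN =>
        absurd (MvPolynomial.ext _ _ fun α => by simpa using hN α (Nat.zero_le _)) h0
    | succ N ih =>
      intro p hp h0 hN
      by_cases hk : ∃ k, pderiv k p ≠ 0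
      · obtain ⟨k, hk⟩ := hk
        exact ih _ (hS k p hp) hk fun α hα => by
          rw [coeff_pderiv, hN _ (by simpa using hα), zero_mul]
      · push Not at hk
        have hpC := eq_C_of_pderiv_eq_zero hk
        exact ⟨coeff 0 p, fun h => h0 (by rw [hpC, h, C_0]), hpC ▸ hp⟩
  exact hdegree (p.totalDegree + 1) p hp h0 fun α hα => coeff_eq_zero_of_totalDegree_lt hα

theorem mem_of_isHomogeneous_zero {V : Submodule R (MvPolynomial σ R)} (h1 : 1 ∈ V)
    {q : MvPolynomial σ R} (hq : q.IsHomogeneous 0) : q ∈ V := by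
  rw [← totalDegree_zero_iff_isHomogeneous, totalDegree_eq_zero_iff_eq_C] at hq
  rw [hq, ← mul_one (C _), ← smul_eq_C_mul]
  exact V.smul_mem _ h1

theorem pderiv_two_mul_X [DecidableEq σ] (j k : σ) :
    pderiv j (2 * X k : MvPolynomial σ R) = if j = k then 2 else 0 := by
  rw [two_mul, map_add, pderiv_X, Pi.single_apply]
  rcases eq_or_ne j k with rfl | h
  · norm_num
  · simp [h, h.symm]

end PolynomialDerivatives

section ConformalFields

variable {σ R : Type*} [Fintype σ] [CommRing R]

/-- The Laplacian `∑ ∂²/∂u_k²`. -/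
def laplacian : MvPolynomial σ R →ₗ[R] MvPolynomial σ R :=
  ∑ k, (pderiv k).toLinearMap ∘ₗ (pderiv k).toLinearMap

/-- The Euler field `∑ u_k ∂/∂u_k`. -/
def euler : MvPolynomial σ R →ₗ[R] MvPolynomial σ R :=
  ∑ k, LinearMap.mulLeft R (X k) ∘ₗ (pderiv k).toLinearMap

/-- The quadratic form `u² = ∑ u_k²`. -/
def sumSq : MvPolynomial σ R := ∑ k, X k ^ 2

/-- The infinitesimal special conformal transformation `u² ∂_k + 2 u_k (c - ∑ u_j ∂_j)` of
conformal weight `c`. -/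
def conformal (c : R) (k : σ) : MvPolynomial σ R →ₗ[R] MvPolynomial σ R :=
  LinearMap.mulLeft R sumSq ∘ₗ (pderiv k).toLinearMap +
    LinearMap.mulLeft R (2 * X k) ∘ₗ (c • LinearMap.id - euler)

theorem laplacian_apply (q : MvPolynomial σ R) : laplacian q = ∑ k, pderiv k (pderiv k q) := by
  simp [laplacian, LinearMap.sum_apply]

theorem euler_apply (q : MvPolynomial σ R) : euler q = ∑ k, X k * pderiv k q := by
  simp [euler, LinearMap.sum_apply]

theorem conformal_apply (c : R) (k : σ) (q : MvPolynomial σ R) :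
    conformal c k q = sumSq * pderiv k q + 2 * X k * (c • q - euler q) := by
  simp [conformal, mul_assoc]

theorem euler_of_isHomogeneous {r : ℕ} {q : MvPolynomial σ R} (h : q.IsHomogeneous r) :
    euler q = (r : R) • q := by
  rw [euler_apply, h.sum_X_mul_pderiv, Nat.cast_smul_eq_nsmul]

theorem euler_X (k : σ) : euler (X k : MvPolynomial σ R) = X k := by
  simpa using euler_of_isHomogeneous (isHomogeneous_X R k)

theorem laplacian_C (a : R) : laplacian (C a : MvPolynomial σ R) = 0 := by
  simp [laplacian_apply]

theorem laplacian_one : laplacian (1 : MvPolynomial σ R) = 0 := by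
  rw [← C_1, laplacian_C]

theorem pderiv_euler (k : σ) (q : MvPolynomial σ R) :
    pderiv k (euler q) = euler (pderiv k q) + pderiv k q := by
  classical
  simp only [euler_apply, map_sum, pderiv_mul, pderiv_X, Pi.single_apply, ite_mul, one_mul,
    zero_mul, Finset.sum_add_distrib, pderiv_comm k, Finset.sum_ite_eq', Finset.mem_univ, if_true]
  exact add_comm _ _

theorem pderiv_sumSq (k : σ) : pderiv k (sumSq : MvPolynomial σ R) = 2 * X k := by
  classical
  simp [sumSq, pderiv_X, Pi.single_apply]

theorem pderiv_laplacian (k : σ) (q : MvPolynomial σ R) :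
    pderiv k (laplacian q) = laplacian (pderiv k q) := by
  simp only [laplacian_apply, map_sum]
  exact Finset.sum_congr rfl fun j _ => by rw [pderiv_comm k j, pderiv_comm k j]

theorem laplacian_euler (q : MvPolynomial σ R) :
    laplacian (euler q) = euler (laplacian q) + 2 * laplacian q := by
  simp only [laplacian_apply, pderiv_euler, map_add, map_sum, Finset.sum_add_distrib,
    Finset.mul_sum, two_mul]
  exact add_assoc _ _ _

theorem laplacian_X_mul (k : σ) (q : MvPolynomial σ R) :
    laplacian (X k * q) = X k * laplacian q + 2 * pderiv k q := by
  classical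
  have hterm (j : σ) : pderiv j (pderiv j (X k * q)) =
      X k * pderiv j (pderiv j q) + if j = k then 2 * pderiv k q else 0 := by
    simp only [pderiv_mul, pderiv_X, Pi.single_apply, map_add]
    rcases eq_or_ne j k with rfl | h
    · simp; ring
    · simp [h, h.symm]
  simp only [laplacian_apply, hterm, Finset.sum_add_distrib, Finset.mul_sum, Finset.sum_ite_eq',
    Finset.mem_univ, if_true]

theorem laplacian_sumSq_mul (q : MvPolynomial σ R) :
    laplacian (sumSq * q) =
      sumSq * laplacian q + 4 * euler q + 2 * (Fintype.card σ : MvPolynomial σ R) * q := by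
  classical
  have hterm (j : σ) : pderiv j (pderiv j (sumSq * q)) =
      sumSq * pderiv j (pderiv j q) + 4 * (X j * pderiv j q) + 2 * q := by
    simp only [pderiv_mul, pderiv_sumSq, map_add, ↓pderiv_two_mul_X, if_true]
    ring
  simp only [laplacian_apply, hterm, Finset.sum_add_distrib, ← Finset.mul_sum, euler_apply,
    Finset.sum_const, Finset.card_univ, nsmul_eq_mul]
  ring

theorem laplacian_sumSq :
    laplacian (sumSq : MvPolynomial σ R) = C (2 * (Fintype.card σ : R)) := by
  have hmul := laplacian_sumSq_mul (1 : MvPolynomial σ R)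
  rw [mul_one, laplacian_one, euler_of_isHomogeneous (isHomogeneous_one σ R)] at hmul
  rw [hmul, map_mul, map_ofNat, map_natCast]
  simp

theorem conformal_one (c : R) (k : σ) : conformal c k 1 = (2 * c) • X k := by
  rw [conformal_apply, pderiv_one, euler_of_isHomogeneous (isHomogeneous_one σ R)]
  simp only [smul_eq_C_mul, map_mul, map_ofNat, Nat.cast_zero, map_zero]
  ring

theorem conformal_X (c : R) (k : σ) :
    conformal c k (X k) = sumSq + (2 * (c - 1)) • X k ^ 2 := by
  rw [conformal_apply, pderiv_X_self, euler_X]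
  simp only [smul_eq_C_mul, map_mul, map_sub, map_ofNat, map_one]
  ring

theorem pderiv_conformal [DecidableEq σ] (c : R) (j k : σ) (q : MvPolynomial σ R) :
    pderiv j (conformal c k q) = conformal c k (pderiv j q) +
      2 * (X j * pderiv k q - X k * pderiv j q) + if j = k then 2 * (c • q - euler q) else 0 := by
  simp only [conformal_apply, map_add, pderiv_mul, pderiv_sumSq, map_sub, Derivation.map_smul,
    ↓pderiv_two_mul_X, pderiv_euler, pderiv_comm j k]
  split_ifs <;> ring

theorem laplacian_conformal (c : R) (k : σ) (q : MvPolynomial σ R) :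
    laplacian (conformal c k q) =
      conformal (c - 2) k (laplacian q) + (2 * Fintype.card σ + 4 * c - 4) • pderiv k q := by
  simp only [conformal_apply, map_add, mul_assoc, laplacian_sumSq_mul]
  rw [two_mul (X k * _), map_add, laplacian_X_mul, map_sub, map_smul, laplacian_euler, map_sub,
    Derivation.map_smul, pderiv_euler, pderiv_laplacian]
  simp only [smul_eq_C_mul, map_add, map_sub, map_mul, map_natCast, map_ofNat]
  ring

theorem sum_conformal_pderiv {r : ℕ} (c : R) {q : MvPolynomial σ R} (h : q.IsHomogeneous (r + 1)) :
    ∑ k, conformal c k (pderiv k q) = sumSq * laplacian q + (2 * (c - r) * (r + 1)) • q := by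
  have hterm (k : σ) : conformal c k (pderiv k q) =
      sumSq * pderiv k (pderiv k q) + (2 * (c - r)) • (X k * pderiv k q) := by
    rw [conformal_apply, euler_of_isHomogeneous (h.pderiv (i := k))]
    simp only [Nat.add_sub_cancel, smul_eq_C_mul, map_mul, map_sub, map_ofNat]
    ring
  simp only [hterm, Finset.sum_add_distrib, ← Finset.mul_sum, ← Finset.smul_sum]
  rw [← euler_apply, euler_of_isHomogeneous h, ← laplacian_apply, smul_smul]
  push_cast
  rfl

theorem isHomogeneous_sumSq : (sumSq : MvPolynomial σ R).IsHomogeneous 2 :=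
  IsHomogeneous.sum _ _ _ fun k _ => (isHomogeneous_X R k).pow 2

theorem isHomogeneous_laplacian {r : ℕ} {q : MvPolynomial σ R} (h : q.IsHomogeneous r) :
    (laplacian q).IsHomogeneous (r - 2) := by
  rw [laplacian_apply]
  exact IsHomogeneous.sum _ _ _ fun k _ => Nat.sub_sub r 1 1 ▸ (h.pderiv (i := k)).pderiv (i := k)

theorem laplacian_eq_zero_of_isHomogeneous {r : ℕ} {q : MvPolynomial σ R} (h : q.IsHomogeneous r)
    (hr : r < 2) : laplacian q = 0 := by
  refine (laplacian_apply q).trans (Finset.sum_eq_zero fun k _ => ?_)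
  have hk : (pderiv k q).IsHomogeneous 0 := by
    simpa [show r - 1 = 0 by omega] using h.pderiv (i := k)
  rw [← totalDegree_zero_iff_isHomogeneous, totalDegree_eq_zero_iff_eq_C] at hk
  rw [hk, pderiv_C]

theorem homogeneousComponent_laplacian (r : ℕ) (q : MvPolynomial σ R) :
    homogeneousComponent r (laplacian q) = laplacian (homogeneousComponent (r + 2) q) := by
  have hhom {e : ℕ} {p : MvPolynomial σ R} (hp : p.IsHomogeneous e) :
      homogeneousComponent r (laplacian p) = laplacian (homogeneousComponent (r + 2) p) := by
    rw [homogeneousComponent_of_mem hp]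
    by_cases he : e < 2
    · simp [laplacian_eq_zero_of_isHomogeneous hp he, show r + 2 ≠ e by omega]
    · rw [homogeneousComponent_of_mem (isHomogeneous_laplacian hp)]
      simp only [show r = e - 2 ↔ r + 2 = e by omega, apply_ite laplacian, map_zero]
  rw [← sum_homogeneousComponent q]
  simp only [map_sum]
  exact Finset.sum_congr rfl fun e _ => hhom (homogeneousComponent_isHomogeneous e q)

theorem laplacian_homogeneousComponent_eq_zero {q : MvPolynomial σ R} (h : laplacian q = 0)
    (r : ℕ) : laplacian (homogeneousComponent r q) = 0 := by
  obtain hr | ⟨s, rfl⟩ : r < 2 ∨ ∃ s, r = s + 2 := by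
    rcases lt_or_ge r 2 with hr | hr
    · exact Or.inl hr
    · exact Or.inr (Nat.exists_eq_add_of_le' hr)
  · exact laplacian_eq_zero_of_isHomogeneous (homogeneousComponent_isHomogeneous r q) hr
  · rw [← homogeneousComponent_laplacian, h, map_zero]

end ConformalFields

section ConformalSubmodules

variable {σ K : Type*} [Fintype σ] [Field K] [CharZero K]

theorem eq_zero_of_sumSq_mul_laplacian_eq {r l : ℕ} (hl : 0 < l)
    (hr : r * (2 * r + Fintype.card σ) ≤ l) {q : MvPolynomial σ K} (hq : q.IsHomogeneous r)
    (h : sumSq * laplacian q = (l : K) • q) : q = 0 := by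
  induction r using Nat.strong_induction_on generalizing l q with
  | _ r ih =>
    have hlK : (l : K) ≠ 0 := Nat.cast_ne_zero.2 hl.ne'
    by_cases h2 : r < 2
    · rw [laplacian_eq_zero_of_isHomogeneous hq h2, mul_zero] at h
      exact (smul_eq_zero.1 h.symm).resolve_left hlK
    obtain ⟨s, rfl⟩ := Nat.exists_eq_add_of_le' (not_lt.1 h2)
    obtain ⟨p, hp⟩ : ∃ p, laplacian q = (l : K) • p := ⟨(l : K)⁻¹ • laplacian q, by simp [hlK]⟩
    have hqp : q = sumSq * p := by
      rw [hp, mul_smul_comm] at h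
      exact (smul_right_injective _ hlK h).symm
    have hps : p.IsHomogeneous s := by
      rw [← inv_smul_smul₀ hlK p, ← hp, smul_eq_C_mul]
      simpa using (isHomogeneous_C σ (l : K)⁻¹).mul (isHomogeneous_laplacian hq)
    obtain ⟨l', rfl⟩ : ∃ l', l = l' + (4 * s + 2 * Fintype.card σ) :=
      Nat.exists_eq_add_of_le' (by nlinarith)
    have hp' : sumSq * laplacian p = (l' : K) • p := by
      have hmul := laplacian_sumSq_mul p
      rw [← hqp, hp, euler_of_isHomogeneous hps] at hmul
      simp only [smul_eq_C_mul, map_natCast, Nat.cast_add, Nat.cast_mul, Nat.cast_ofNat,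
        map_add, map_mul, map_ofNat] at hmul ⊢
      linear_combination -hmul
    rw [hqp, ih s (by omega) (by nlinarith) (by nlinarith) hps hp', mul_zero]

theorem exists_sumSq_mul_laplacian_sub_eq {r l : ℕ} (hl : 0 < l)
    (hr : r * (2 * r + Fintype.card σ) ≤ l) {q : MvPolynomial σ K} (hq : q.IsHomogeneous r) :
    ∃ p : MvPolynomial σ K, p.IsHomogeneous r ∧ sumSq * laplacian p - (l : K) • p = q := by
  let V := homogeneousSubmodule σ K r
  have : FiniteDimensional K V := Module.Finite.iff_fg.2 (homogeneousSubmodule_fg σ K r)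
  let T : MvPolynomial σ K →ₗ[K] MvPolynomial σ K :=
    LinearMap.mulLeft K sumSq ∘ₗ laplacian - (l : K) • LinearMap.id
  have hT : ∀ p ∈ V, T p ∈ V := by
    refine fun p (hp : p.IsHomogeneous r) => V.sub_mem ?_ (V.smul_mem _ hp)
    by_cases h2 : r < 2
    · simp [laplacian_eq_zero_of_isHomogeneous hp h2]
    · have hmul := isHomogeneous_sumSq.mul (isHomogeneous_laplacian hp)
      rwa [show 2 + (r - 2) = r by omega] at hmul
  have hinj : Function.Injective (T.restrict hT) := by
    rw [← LinearMap.ker_eq_bot, LinearMap.ker_eq_bot']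
    rintro ⟨p, hp⟩ h
    exact Subtype.ext <| eq_zero_of_sumSq_mul_laplacian_eq hl hr hp <|
      sub_eq_zero.1 (congrArg Subtype.val h)
  obtain ⟨⟨p, hp⟩, h⟩ := LinearMap.injective_iff_surjective.1 hinj ⟨q, hq⟩
  exact ⟨p, hp, congrArg Subtype.val h⟩

theorem eq_top_of_conformal_mem {c : K} {m : ℕ} (hc : 2 * c = -m)
    (hm : Fintype.card σ + 2 ≤ m) {V : Submodule K (MvPolynomial σ K)} (h1 : 1 ∈ V)
    (hV : ∀ k, ∀ q ∈ V, conformal c k q ∈ V) : V = ⊤ := by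
  have hhom (r : ℕ) : ∀ q : MvPolynomial σ K, q.IsHomogeneous r → q ∈ V := by
    induction r with
    | zero => exact fun q hq => mem_of_isHomogeneous_zero h1 hq
    | succ r ih =>
      intro q hq
      obtain ⟨p, hp, rfl⟩ := exists_sumSq_mul_laplacian_sub_eq (l := (r + 1) * (m + 2 * r))
        (by nlinarith) (Nat.mul_le_mul_left _ (by omega)) hq
      have hsum : sumSq * laplacian p - (((r + 1) * (m + 2 * r) : ℕ) : K) • p =
          ∑ k, conformal c k (pderiv k p) := by
        rw [sum_conformal_pderiv c hp, sub_eq_add_neg, ← neg_smul, mul_sub, hc]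
        push_cast
        ring_nf
      rw [hsum]
      exact V.sum_mem fun k _ => hV k _ (ih _ (by simpa using hp.pderiv (i := k)))
  refine Submodule.eq_top_iff'.2 fun q => ?_
  rw [← sum_homogeneousComponent q]
  exact V.sum_mem fun r _ => hhom r _ (homogeneousComponent_isHomogeneous r q)

theorem ker_laplacian_le_of_conformal_mem {c : K} (hc : ∀ r : ℕ, c ≠ r)
    {V : Submodule K (MvPolynomial σ K)} (h1 : 1 ∈ V)
    (hV : ∀ k, ∀ q ∈ V, conformal c k q ∈ V) : LinearMap.ker laplacian ≤ V := by
  have hhom (r : ℕ) : ∀ q : MvPolynomial σ K, q.IsHomogeneous r → laplacian q = 0 → q ∈ V := by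
    induction r with
    | zero => exact fun q hq _ => mem_of_isHomogeneous_zero h1 hq
    | succ r ih =>
      intro q hq hlap
      have hsum := sum_conformal_pderiv c hq
      rw [hlap, mul_zero, zero_add] at hsum
      have hne : 2 * (c - r) * (r + 1) ≠ 0 := mul_ne_zero
        (mul_ne_zero two_ne_zero (sub_ne_zero.2 (hc r))) (Nat.cast_add_one_ne_zero r)
      rw [← V.smul_mem_iff hne, ← hsum]
      exact V.sum_mem fun k _ => hV k _ <| ih _ (by simpa using hq.pderiv (i := k))
        (by rw [← pderiv_laplacian, hlap, map_zero])
  intro q hq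
  rw [← sum_homogeneousComponent q]
  exact V.sum_mem fun r _ => hhom r _ (homogeneousComponent_isHomogeneous r q)
    (laplacian_homogeneousComponent_eq_zero hq r)

end ConformalSubmodules

/-! ### The module of polynomials in `u` and `t` -/

/-- Polynomials in the variables `u_k = y^k / (y^{-1} + i y^0)`. -/
abbrev UPoly (n : ℕ) : Type := MvPolynomial (Fin n) ℂ

/-- Polynomials in `u` and in `t = y² / (y^{-1} + i y^0)²`: the coefficient of `t^m` is the value
at `m`. -/
abbrev UTPoly (n : ℕ) : Type := ℕ →₀ UPoly n

/-- The degree of homogeneity `-(n-2)/2` of `φ₁`, `φ₂` and `φ₃`. -/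
def weight (n : ℕ) : ℂ := -((n - 2) / 2)

section Operators

variable {n : ℕ}

/-- The action `∂/∂u_k` of `𝔭⁺` on `F`, in the function `x₁^weight F(u, t)`. -/
def raise (k : Fin n) : UTPoly n →ₗ[ℂ] UTPoly n :=
  Finsupp.lsum ℂ fun m => Finsupp.lsingle m ∘ₗ (pderiv k).toLinearMap

/-- The action `(t + u²) ∂/∂u_k + 2 u_k (weight - ∑ u_j ∂/∂u_j - 2 t ∂/∂t)` of `𝔭⁻` on `F`, in the
function `x₁^weight F(u, t)`. -/
def lower (k : Fin n) : UTPoly n →ₗ[ℂ] UTPoly n :=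
  Finsupp.lsum ℂ fun m => Finsupp.lsingle (m + 1) ∘ₗ (pderiv k).toLinearMap +
    Finsupp.lsingle m ∘ₗ conformal (weight n - 2 * m) k

/-- The operator `t (Δ + 4 t ∂²/∂t²)`, which is minus `y²` times the wave operator of `ℝ^{2,n}`. -/
def wave : UTPoly n →ₗ[ℂ] UTPoly n :=
  Finsupp.lsum ℂ fun m => Finsupp.lsingle (m + 1) ∘ₗ laplacian +
    (4 * m * (m - 1) : ℂ) • Finsupp.lsingle m

theorem raise_single (k : Fin n) (m : ℕ) (q : UPoly n) :
    raise k (Finsupp.single m q) = Finsupp.single m (pderiv k q) := by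
  simp [raise]

theorem lower_single (k : Fin n) (m : ℕ) (q : UPoly n) :
    lower k (Finsupp.single m q) = Finsupp.single (m + 1) (pderiv k q) +
      Finsupp.single m (conformal (weight n - 2 * m) k q) := by
  simp [lower]

theorem wave_single (m : ℕ) (q : UPoly n) :
    wave (Finsupp.single m q) = Finsupp.single (m + 1) (laplacian q) +
      (4 * m * (m - 1) : ℂ) • Finsupp.single m q := by
  simp [wave]

theorem linearMap_congr_of_single {V : Type*} [AddCommGroup V] [Module ℂ V]
    {f g : UTPoly n →ₗ[ℂ] V} (h : ∀ m q, f (Finsupp.single m q) = g (Finsupp.single m q))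
    (F : UTPoly n) : f F = g F :=
  LinearMap.congr_fun (Finsupp.lhom_ext h) F

theorem raise_apply (k : Fin n) (F : UTPoly n) (m : ℕ) : raise k F m = pderiv k (F m) := by
  refine linearMap_congr_of_single (f := Finsupp.lapply m ∘ₗ raise k)
    (g := (pderiv k).toLinearMap ∘ₗ Finsupp.lapply m) (fun j q => ?_) F
  simp only [LinearMap.comp_apply, raise_single, Finsupp.lapply_apply, Finsupp.single_apply]
  split_ifs <;> simp

theorem lower_apply_zero (k : Fin n) (F : UTPoly n) :
    lower k F 0 = conformal (weight n) k (F 0) := by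
  refine linearMap_congr_of_single (f := Finsupp.lapply 0 ∘ₗ lower k)
    (g := conformal (weight n) k ∘ₗ Finsupp.lapply 0) (fun j q => ?_) F
  rcases j with _ | j <;> simp [lower_single]

theorem lower_apply_succ (k : Fin n) (F : UTPoly n) (m : ℕ) :
    lower k F (m + 1) =
      pderiv k (F m) + conformal (weight n - 2 * (m + 1)) k (F (m + 1)) := by
  refine linearMap_congr_of_single (f := Finsupp.lapply (m + 1) ∘ₗ lower k)
    (g := (pderiv k).toLinearMap ∘ₗ Finsupp.lapply m +
      conformal (weight n - 2 * (m + 1)) k ∘ₗ Finsupp.lapply (m + 1)) (fun j q => ?_) F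
  simp only [LinearMap.comp_apply, LinearMap.add_apply, lower_single, map_add,
    Finsupp.lapply_apply, Finsupp.single_apply]
  rcases eq_or_ne j m with rfl | h
  · simp
  · rcases eq_or_ne j (m + 1) with rfl | h'
    · simp
    · simp [h, h']

theorem wave_apply_succ (F : UTPoly n) (m : ℕ) :
    wave F (m + 1) = laplacian (F m) + (4 * (m + 1) * m : ℂ) • F (m + 1) := by
  refine linearMap_congr_of_single (f := Finsupp.lapply (m + 1) ∘ₗ wave)
    (g := laplacian ∘ₗ Finsupp.lapply m + (4 * (m + 1) * m : ℂ) • Finsupp.lapply (m + 1))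
    (fun j q => ?_) F
  simp only [LinearMap.comp_apply, LinearMap.add_apply, LinearMap.smul_apply, wave_single, map_add,
    map_smul, Finsupp.lapply_apply, Finsupp.single_apply]
  rcases eq_or_ne j m with rfl | h
  · simp
  · rcases eq_or_ne j (m + 1) with rfl | h'
    · simp
    · simp [h, h']

theorem wave_raise (k : Fin n) (F : UTPoly n) : wave (raise k F) = raise k (wave F) := by
  refine linearMap_congr_of_single (f := wave ∘ₗ raise k) (g := raise k ∘ₗ wave) (fun m q => ?_) F
  simp [raise_single, wave_single, pderiv_laplacian]

theorem wave_lower (k : Fin n) (F : UTPoly n) : wave (lower k F) = lower k (wave F) := by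
  refine linearMap_congr_of_single (f := wave ∘ₗ lower k) (g := lower k ∘ₗ wave) (fun m q => ?_) F
  have hcoeff : (2 * Fintype.card (Fin n) + 4 * (weight n - 2 * m) - 4 : ℂ) = -8 * m := by
    rw [weight, Fintype.card_fin]; ring
  have hweight : weight n - 2 * ((m + 1 : ℕ) : ℂ) = weight n - 2 * m - 2 := by push_cast; ring
  simp only [LinearMap.comp_apply, lower_single, wave_single, map_add, map_smul,
    pderiv_laplacian, laplacian_conformal, hcoeff, hweight, Finsupp.single_add,
    Finsupp.smul_single, Derivation.map_smul]
  have hderiv : Finsupp.single (m + 1)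
        ((4 * ((m + 1 : ℕ) : ℂ) * (((m + 1 : ℕ) : ℂ) - 1)) • pderiv k q) +
      Finsupp.single (m + 1) ((-8 * m : ℂ) • pderiv k q) =
      Finsupp.single (m + 1) ((4 * m * (m - 1) : ℂ) • pderiv k q) := by
    rw [← Finsupp.single_add, ← add_smul]
    congr 2; push_cast; ring
  rw [← hderiv]
  abel

theorem raise_lower_sub (j k : Fin n) (m : ℕ) (q : UPoly n) :
    raise j (lower k (Finsupp.single m q)) - lower k (raise j (Finsupp.single m q)) =
      Finsupp.single m (2 * (X j * pderiv k q - X k * pderiv j q) +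
        if j = k then 2 * ((weight n - 2 * m) • q - euler q) else 0) := by
  simp only [raise_single, lower_single, map_add, pderiv_conformal, pderiv_comm j k]
  rw [add_sub_add_left_eq_sub, ← Finsupp.single_sub]
  congr 1
  ring

end Operators

section StableSubspaces

variable {n : ℕ}

/-- Stability of a space of polynomials under the actions of `𝔭⁺` and `𝔭⁻`. -/
def IsStable (N : Submodule ℂ (UTPoly n)) : Prop :=
  ∀ k, ∀ F ∈ N, raise k F ∈ N ∧ lower k F ∈ N

/-- The stable subspace generated by `F`, the polynomial counterpart of `𝒰(𝔤) φ`. -/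
def gen (F : UTPoly n) : Submodule ℂ (UTPoly n) := sInf {N | IsStable N ∧ F ∈ N}

/-- The solutions of the wave equation that vanish on the cone `t = 0`, the polynomial counterpart
of `H₃`. -/
def gauge (n : ℕ) : Submodule ℂ (UTPoly n) :=
  LinearMap.ker wave ⊓ LinearMap.ker (Finsupp.lapply (R := ℂ) 0)

theorem mem_gauge {F : UTPoly n} : F ∈ gauge n ↔ wave F = 0 ∧ F 0 = 0 := Iff.rfl

theorem mem_gen_self (F : UTPoly n) : F ∈ gen F :=
  Submodule.mem_sInf.2 fun _ hN => hN.2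

theorem isStable_gen (F : UTPoly n) : IsStable (gen F) := fun k G hG =>
  ⟨Submodule.mem_sInf.2 fun N hN => (hN.1 k G (Submodule.mem_sInf.1 hG N hN)).1,
    Submodule.mem_sInf.2 fun N hN => (hN.1 k G (Submodule.mem_sInf.1 hG N hN)).2⟩

theorem gen_le {F : UTPoly n} {N : Submodule ℂ (UTPoly n)} (hN : IsStable N) (hF : F ∈ N) :
    gen F ≤ N := sInf_le ⟨hN, hF⟩

theorem isStable_ker_wave : IsStable (LinearMap.ker (wave (n := n))) := fun k F hF => by
  rw [LinearMap.mem_ker] at hF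
  simp [wave_raise, wave_lower, hF]

theorem isStable_map_wave {N : Submodule ℂ (UTPoly n)} (hN : IsStable N) :
    IsStable (N.map wave) := by
  rintro k _ ⟨F, hF, rfl⟩
  exact ⟨⟨_, (hN k F hF).1, wave_raise k F⟩, ⟨_, (hN k F hF).2, wave_lower k F⟩⟩

theorem isStable_comap_wave {N : Submodule ℂ (UTPoly n)} (hN : IsStable N) :
    IsStable (N.comap wave) := fun k F hF => by
  simp only [Submodule.mem_comap, wave_raise, wave_lower] at hF ⊢
  exact hN k _ hF

theorem isStable_gauge : IsStable (gauge n) := fun k F hF => by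
  obtain ⟨hwave, hcone⟩ := mem_gauge.1 hF
  exact ⟨mem_gauge.2 ⟨(isStable_ker_wave k F hwave).1, by rw [raise_apply, hcone, map_zero]⟩,
    mem_gauge.2 ⟨(isStable_ker_wave k F hwave).2, by rw [lower_apply_zero, hcone, map_zero]⟩⟩

theorem laplacian_apply_zero_of_wave_eq_zero {F : UTPoly n} (hF : wave F = 0) :
    laplacian (F 0) = 0 := by
  simpa [hF] using (wave_apply_succ F 0).symm

theorem eq_zero_of_mem_gauge {F : UTPoly n} (hF : F ∈ gauge n) (h1 : F 1 = 0) : F = 0 := by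
  obtain ⟨hwave, hcone⟩ := mem_gauge.1 hF
  have hsucc (m : ℕ) : F (m + 1) = 0 := by
    induction m with
    | zero => exact h1
    | succ m ih =>
      have hrec := wave_apply_succ F (m + 1)
      rw [hwave, ih, map_zero, zero_add, Finsupp.zero_apply] at hrec
      refine (smul_eq_zero.1 hrec.symm).resolve_left ?_
      exact_mod_cast show 4 * (m + 1 + 1) * (m + 1) ≠ 0 by positivity
  ext1 m
  rcases m with _ | m
  · exact hcone
  · exact hsucc m

theorem exists_mem_gen_apply_eq_one {F : UTPoly n} {m : ℕ} (hm : F m ≠ 0) :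
    ∃ G ∈ gen F, G m = 1 := by
  obtain ⟨c, hc, G, hG, hGc⟩ := exists_C_mem_of_pderiv_mem
    (S := {q | ∃ G ∈ gen F, G m = q})
    (by
      rintro k _ ⟨G, hG, rfl⟩
      exact ⟨raise k G, (isStable_gen F k G hG).1, raise_apply k G m⟩)
    ⟨F, mem_gen_self F, rfl⟩ hm
  refine ⟨c⁻¹ • G, Submodule.smul_mem _ _ hG, ?_⟩
  rw [Finsupp.smul_apply, hGc, smul_eq_C_mul, ← map_mul, inv_mul_cancel₀ hc, map_one]

end StableSubspaces

section Generators

variable {n : ℕ}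

/-- The polynomial `1`, which represents `φ₂`. -/
def onePoly (n : ℕ) : UTPoly n := Finsupp.single 0 1

/-- The polynomial `t`, which represents `φ₃` up to the factor `-2`. -/
def tPoly (n : ℕ) : UTPoly n := Finsupp.single 1 1

/-- The polynomial `t + u²`, which represents `φ₁`. -/
def vPoly (n : ℕ) : UTPoly n := Finsupp.single 1 1 + Finsupp.single 0 sumSq

theorem wave_onePoly : wave (onePoly n) = 0 := by
  simp [onePoly, wave_single, laplacian_one]

theorem wave_tPoly : wave (tPoly n) = 0 := by
  simp [tPoly, wave_single, laplacian_one]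

theorem wave_vPoly : wave (vPoly n) = (2 * n : ℂ) • tPoly n := by
  rw [vPoly, map_add, wave_single, wave_single, laplacian_sumSq, laplacian_one]
  simp [tPoly, smul_eq_C_mul]

theorem tPoly_mem_gauge : tPoly n ∈ gauge n :=
  mem_gauge.2 ⟨wave_tPoly, by simp [tPoly]⟩

theorem gen_tPoly : gen (tPoly n) = gauge n := by
  have hle : gen (tPoly n) ≤ gauge n := gen_le isStable_gauge tPoly_mem_gauge
  have htop : (gen (tPoly n)).map (Finsupp.lapply (R := ℂ) 1) = ⊤ := by
    refine eq_top_of_conformal_mem (c := weight n - 2) (m := n + 2)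
      (by rw [weight]; push_cast; ring) (by simp)
      ⟨tPoly n, mem_gen_self _, by simp [tPoly]⟩ ?_
    rintro k _ ⟨G, hG, rfl⟩
    refine ⟨lower k G, (isStable_gen _ k G hG).2, ?_⟩
    simpa [(mem_gauge.1 (hle hG)).2] using lower_apply_succ k G 0
  refine le_antisymm hle fun F hF => ?_
  obtain ⟨G, hG, hGF⟩ : F 1 ∈ (gen (tPoly n)).map (Finsupp.lapply (R := ℂ) 1) :=
    htop ▸ Submodule.mem_top
  have hsub : F - G = 0 := eq_zero_of_mem_gauge (Submodule.sub_mem _ hF (hle hG))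
    (sub_eq_zero.2 hGF.symm)
  rwa [sub_eq_zero.1 hsub]

theorem weight_ne_zero (hn : 3 ≤ n) : weight n ≠ 0 := by
  have hne : (n : ℂ) - 2 ≠ 0 := sub_ne_zero.2 (by exact_mod_cast (by omega : n ≠ 2))
  simp [weight, hne]

theorem weight_ne_natCast (hn : 3 ≤ n) (r : ℕ) : weight n ≠ r := fun h => by
  have hcast : (2 : ℂ) = n + 2 * r := by
    rw [weight] at h
    linear_combination 2 * h
  have : 2 = n + 2 * r := by exact_mod_cast hcast
  omega

theorem sum_lower_lower_onePoly :
    ∑ k, lower k (lower k (onePoly n)) = (2 * weight n * n) • tPoly n := by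
  have hterm (k : Fin n) : lower k (lower k (onePoly n)) = (2 * weight n) •
      (tPoly n + Finsupp.single 0 (sumSq + (2 * (weight n - 1)) • X k ^ 2)) := by
    rw [onePoly, lower_single, pderiv_one, Finsupp.single_zero, zero_add, Nat.cast_zero, mul_zero,
      sub_zero, conformal_one, ← Finsupp.smul_single, map_smul, lower_single, pderiv_X_self,
      Nat.cast_zero, mul_zero, sub_zero, conformal_X, tPoly]
  have hcancel : ((n : ℂ) • sumSq + (2 * (weight n - 1)) • sumSq : UPoly n) = 0 := by
    rw [← add_smul, weight]; ring_nf; simp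
  simp only [hterm, ← Finset.smul_sum, Finset.sum_add_distrib, ← Finsupp.single_finsetSum,
    Finset.sum_const, Finset.card_univ, Fintype.card_fin, ← Nat.cast_smul_eq_nsmul ℂ]
  rw [← sumSq, hcancel, Finsupp.single_zero, add_zero, smul_smul]

theorem tPoly_mem_gen_onePoly (hn : 3 ≤ n) : tPoly n ∈ gen (onePoly n) := by
  have hne : 2 * weight n * n ≠ 0 :=
    mul_ne_zero (mul_ne_zero two_ne_zero (weight_ne_zero hn)) (Nat.cast_ne_zero.2 (by omega))
  rw [← Submodule.smul_mem_iff _ hne, ← sum_lower_lower_onePoly]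
  exact Submodule.sum_mem _ fun k _ =>
    (isStable_gen _ k _ (isStable_gen _ k _ (mem_gen_self _)).2).2

theorem gen_onePoly (hn : 3 ≤ n) : gen (onePoly n) = LinearMap.ker wave := by
  have hle : gen (onePoly n) ≤ LinearMap.ker wave := gen_le isStable_ker_wave wave_onePoly
  have hharmonic : LinearMap.ker laplacian ≤ (gen (onePoly n)).map (Finsupp.lapply (R := ℂ) 0) := by
    refine ker_laplacian_le_of_conformal_mem (weight_ne_natCast hn)
      ⟨onePoly n, mem_gen_self _, by simp [onePoly]⟩ ?_
    rintro k _ ⟨G, hG, rfl⟩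
    exact ⟨lower k G, (isStable_gen _ k G hG).2, lower_apply_zero k G⟩
  refine le_antisymm hle fun F hF => ?_
  obtain ⟨G, hG, hGF⟩ := hharmonic (laplacian_apply_zero_of_wave_eq_zero hF)
  have hsub : F - G ∈ gen (tPoly n) := by
    rw [gen_tPoly]
    exact ⟨Submodule.sub_mem _ hF (hle hG), sub_eq_zero.2 hGF.symm⟩
  simpa using Submodule.add_mem _ (gen_le (isStable_gen _) (tPoly_mem_gen_onePoly hn) hsub) hG

theorem onePoly_mem_gen_vPoly (hn : 3 ≤ n) : onePoly n ∈ gen (vPoly n) := by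
  let k : Fin n := ⟨0, by omega⟩
  have hraise : raise k (raise k (vPoly n)) = (2 : ℂ) • onePoly n := by
    rw [vPoly, map_add, raise_single, raise_single, pderiv_one, pderiv_sumSq, Finsupp.single_zero,
      zero_add, raise_single, pderiv_two_mul_X, if_pos rfl, onePoly, Finsupp.smul_single,
      smul_eq_C_mul, mul_one, map_ofNat]
  rw [← Submodule.smul_mem_iff _ (two_ne_zero (α := ℂ)), ← hraise]
  exact (isStable_gen _ k _ (isStable_gen _ k _ (mem_gen_self (vPoly n))).1).1

theorem tPoly_mem_gen {F : UTPoly n} (hF : F ∈ gen (tPoly n)) (h0 : F ≠ 0) :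
    tPoly n ∈ gen F := by
  rw [gen_tPoly] at hF
  obtain ⟨G, hG, hG1⟩ := exists_mem_gen_apply_eq_one fun h1 => h0 (eq_zero_of_mem_gauge hF h1)
  have hsub : G - tPoly n = 0 := eq_zero_of_mem_gauge
    (Submodule.sub_mem _ (gen_le isStable_gauge hF hG) tPoly_mem_gauge) (by simp [hG1, tPoly])
  rwa [← sub_eq_zero.1 hsub]

theorem exists_mem_gen_sub_onePoly (hn : 3 ≤ n) {F : UTPoly n} (hF : F ∈ gen (onePoly n))
    (h0 : F ∉ gen (tPoly n)) : ∃ G ∈ gen F, G - onePoly n ∈ gen (tPoly n) := by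
  rw [gen_onePoly hn] at hF
  rw [gen_tPoly] at h0 ⊢
  obtain ⟨G, hG, hG0⟩ := exists_mem_gen_apply_eq_one fun h => h0 (mem_gauge.2 ⟨hF, h⟩)
  exact ⟨G, hG, Submodule.sub_mem _ (gen_le isStable_ker_wave hF hG) wave_onePoly,
    by simp [hG0, onePoly]⟩

theorem exists_mem_gen_sub_vPoly (hn : 3 ≤ n) {F : UTPoly n} (hF : F ∈ gen (vPoly n))
    (h0 : F ∉ gen (onePoly n)) : ∃ G ∈ gen F, G - vPoly n ∈ gen (onePoly n) := by
  rw [gen_onePoly hn] at h0 ⊢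
  have hwave : wave F ∈ gen (tPoly n) :=
    gen_le (isStable_comap_wave (isStable_gen (tPoly n))) (F := vPoly n) (by
      rw [Submodule.mem_comap, wave_vPoly]
      exact Submodule.smul_mem _ _ (mem_gen_self _)) hF
  obtain ⟨G, hG, hGt⟩ := gen_le (isStable_map_wave (isStable_gen F)) ⟨F, mem_gen_self F, rfl⟩
    (tPoly_mem_gen hwave h0)
  refine ⟨(2 * n : ℂ) • G, Submodule.smul_mem _ _ hG, ?_⟩
  rw [LinearMap.mem_ker, map_sub, map_smul, hGt, wave_vPoly, sub_self]

end Generators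

theorem hasFDerivAt_aeval {𝕜 E A R σ : Type*} [NontriviallyNormedField 𝕜] [NormedAddCommGroup E]
    [NormedSpace 𝕜 E] [NormedCommRing A] [NormedAlgebra 𝕜 A] [CommSemiring R] [Algebra R A]
    [Fintype σ] {f : σ → E → A} {f' : σ → E →L[𝕜] A} {x : E}
    (hf : ∀ k, HasFDerivAt (f k) (f' k) x) (q : MvPolynomial σ R) :
    HasFDerivAt (fun y => aeval (fun k => f k y) q)
      (∑ k, aeval (fun k => f k x) (pderiv k q) • f' k) x := by
  classical
  induction q using MvPolynomial.induction_on with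
  | C a =>
    simp only [aeval_C]
    exact (hasFDerivAt_const _ x).congr_fderiv (by ext v; simp)
  | add q r hq hr =>
    simp only [map_add]
    exact (hq.add hr).congr_fderiv (by ext v; simp [add_mul, Finset.sum_add_distrib])
  | mul_X q j hq =>
    simp only [map_mul, aeval_X]
    refine (hq.mul (hf j)).congr_fderiv ?_
    ext v
    simp only [add_apply, sum_apply, smul_apply, smul_eq_mul, pderiv_mul, map_add, map_mul,
      aeval_X, pderiv_X, add_mul, Finset.sum_add_distrib, Finset.mul_sum]
    rw [add_comm]
    congr 1
    · exact Finset.sum_congr rfl fun k _ => by ring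
    · rw [Finset.sum_eq_single j] <;> simp +contextual [eq_comm]

theorem aeval_mul_of_isHomogeneous {A R σ : Type*} [CommSemiring R] [CommSemiring A] [Algebra R A]
    {r : ℕ} {q : MvPolynomial σ R} (hq : q.IsHomogeneous r) (c : A) (x : σ → A) :
    aeval (fun k => c * x k) q = c ^ r * aeval x q := by
  simp only [aeval_def, eval₂_eq, Finset.mul_sum]
  refine Finset.sum_congr rfl fun α hα => ?_
  rw [hq.degree_eq_sum_deg_support hα, ← Finset.prod_pow_eq_pow_sum]
  simp only [mul_pow, Finset.prod_mul_distrib]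
  ring

theorem polynomial_eq_zero_of_eval_exp_mul_I {P : Polynomial ℂ}
    (hP : ∀ θ : ℝ, P.eval (Complex.exp (θ * Complex.I)) = 0) : P = 0 := by
  refine P.eq_zero_of_infinite_isRoot (Set.Infinite.mono
    (s := (fun θ : ℝ => Complex.exp (θ * Complex.I)) '' Set.Ioc (-Real.pi) Real.pi) ?_ ?_)
  · rintro _ ⟨θ, -, rfl⟩
    exact hP θ
  · refine Set.Infinite.image (fun θ hθ τ hτ h => ?_) (Set.Ioc_infinite (by linarith [Real.pi_pos]))
    have harg := congrArg Complex.arg h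
    rwa [Complex.arg_exp_mul_I, Complex.arg_exp_mul_I,
      (toIocMod_eq_self _).2 (by rwa [two_mul, neg_add_cancel_left]),
      (toIocMod_eq_self _).2 (by rwa [two_mul, neg_add_cancel_left])] at harg

section Functions

variable {n : ℕ}

/-- The function `u_k = y^k / (y^{-1} + i y^0)`. -/
def uFun (k : Fin n) (p : Amb n) : ℂ := p.2 k * Complex.exp (-p.1)

/-- The function `t = y² / (y^{-1} + i y^0)²`. -/
def tFun (p : Amb n) : ℂ := ysq p * Complex.exp (-p.1) ^ 2

/-- The function `x₁^weight t^m q(u)`. -/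
def monoFun (m : ℕ) (q : UPoly n) (p : Amb n) : ℂ :=
  xPow (weight n) p * tFun p ^ m * aeval (fun k => uFun k p) q

theorem contDiff_exp_neg_fst : ContDiff ℝ ∞ fun p : Amb n => Complex.exp (-p.1) :=
  (Complex.contDiff_exp (𝕜 := ℝ)).comp contDiff_fst.neg

theorem contDiff_uFun (k : Fin n) : ContDiff ℝ ∞ (uFun k) :=
  (coordC_contDiff (Sum.inr k)).mul contDiff_exp_neg_fst

theorem contDiff_tFun : ContDiff ℝ ∞ (tFun (n := n)) :=
  ysq_contDiff.mul (contDiff_exp_neg_fst.pow 2)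

theorem contDiff_aeval_uFun (q : UPoly n) :
    ContDiff ℝ ∞ fun p : Amb n => (aeval fun k => uFun k p) q := by
  induction q using MvPolynomial.induction_on with
  | C a => simpa using contDiff_const
  | add p q hp hq => simpa using hp.add hq
  | mul_X p k hp => simpa using hp.mul (contDiff_uFun k)

theorem contDiff_monoFun (m : ℕ) (q : UPoly n) : ContDiff ℝ ∞ (monoFun m q) :=
  ((xPow_contDiff _).mul (contDiff_tFun.pow m)).mul (contDiff_aeval_uFun q)

/-- The function `x₁^weight t^m q(u)` as an element of `C^∞`, linearly in `q`. -/
def mono (m : ℕ) : UPoly n →ₗ[ℂ] Smooth n where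
  toFun q := Smooth.of (monoFun m q) (contDiff_monoFun m q).contDiffOn
  map_add' p q := Smooth.hext fun x => by
    change monoFun m (p + q) x.1 = monoFun m p x.1 + monoFun m q x.1
    simp only [monoFun, map_add, mul_add]
  map_smul' c q := Smooth.hext fun x => by
    change monoFun m (c • q) x.1 = c * monoFun m q x.1
    simp only [monoFun, map_smul, smul_eq_mul]
    ring

/-- The function `x₁^weight F(u, t)` attached to the polynomial `F`. -/
def realize : UTPoly n →ₗ[ℂ] Smooth n := Finsupp.lsum ℂ mono

theorem realize_single (m : ℕ) (q : UPoly n) : realize (Finsupp.single m q) = mono m q := by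
  simp [realize]

theorem mono_apply (m : ℕ) (q : UPoly n) (p : cov n) : mono m q p = monoFun m q p.1 := rfl

theorem mono_X_mul (m : ℕ) (k : Fin n) (q : UPoly n) (p : cov n) :
    mono m (X k * q) p = uFun k p.1 * mono m q p := by
  simp only [mono_apply, monoFun, map_mul, aeval_X]
  ring

theorem coord_add_I_mul_coord (p : Amb n) :
    (coord (Sum.inl 0) p : ℂ) + Complex.I * coord (Sum.inl 1) p = Complex.exp p.1 := by
  rw [mul_comm]
  exact Complex.re_add_im _

theorem coord_add_I_mul_coord_mul_exp_neg (p : Amb n) :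
    ((coord (Sum.inl 0) p : ℂ) + Complex.I * coord (Sum.inl 1) p) * Complex.exp (-p.1) = 1 := by
  rw [coord_add_I_mul_coord, ← Complex.exp_add, add_neg_cancel, Complex.exp_zero]

theorem tFun_add_aeval_sumSq (p : Amb n) :
    tFun p + aeval (fun k => uFun k p) (sumSq : UPoly n) =
      ((coord (Sum.inl 0) p : ℂ) - Complex.I * coord (Sum.inl 1) p) * Complex.exp (-p.1) := by
  have hysq : (ysq p : ℂ) = (coord (Sum.inl 0) p : ℂ) ^ 2 + (coord (Sum.inl 1) p : ℂ) ^ 2 -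
      ∑ k, (p.2 k : ℂ) ^ 2 := by
    simp [ysq, eta, coord, Fintype.sum_sum_type, sub_eq_add_neg]
  have hsumSq : aeval (fun k => uFun k p) (sumSq : UPoly n) =
      (∑ k, (p.2 k : ℂ) ^ 2) * Complex.exp (-p.1) ^ 2 := by
    simp only [sumSq, map_sum, map_pow, aeval_X, uFun, mul_pow, Finset.sum_mul]
  rw [hsumSq, tFun, hysq]
  linear_combination (((coord (Sum.inl 0) p : ℂ) - Complex.I * coord (Sum.inl 1) p) *
    Complex.exp (-p.1)) * coord_add_I_mul_coord_mul_exp_neg p -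
      ((coord (Sum.inl 1) p : ℂ) ^ 2 * Complex.exp (-p.1) ^ 2) * (-Complex.I_sq)

theorem mono_succ_add (m : ℕ) (q : UPoly n) (p : cov n) :
    mono (m + 1) q p + mono m (sumSq * q) p = ((coord (Sum.inl 0) p.1 : ℂ) -
      Complex.I * coord (Sum.inl 1) p.1) * Complex.exp (-p.1.1) * mono m q p := by
  rw [← tFun_add_aeval_sumSq]
  simp only [mono_apply, monoFun, map_mul]
  ring

theorem Smooth.sum_apply {ι : Type*} (s : Finset ι) (g : ι → Smooth n) (p : cov n) :
    (∑ a ∈ s, g a) p = ∑ a ∈ s, g a p :=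
  map_sum (⟨⟨fun h : Smooth n => h p, rfl⟩, fun _ _ => rfl⟩ : Smooth n →+ ℂ) g s

theorem realize_apply_axis (F : UTPoly n) (p : cov n) (hp : p.1.2 = 0) :
    realize F p = xPow (weight n) p.1 *
      (∑ m ∈ F.support, Polynomial.monomial m (constantCoeff (F m))).eval (tFun p.1) := by
  have hu (q : UPoly n) : aeval (fun k => uFun k p.1) q = constantCoeff q := by
    simp [uFun, hp, aeval_zero']
  have hsum : realize F = ∑ m ∈ F.support, mono m (F m) := by simp [realize, Finsupp.sum]
  rw [hsum, Smooth.sum_apply, Polynomial.eval_finsetSum, Finset.mul_sum]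
  refine Finset.sum_congr rfl fun m _ => ?_
  rw [mono_apply, monoFun, hu, Polynomial.eval_monomial]
  ring

end Functions

section Derivatives

variable {n : ℕ}

/-- The vector field `y_a ∂_b - y_b ∂_a`. -/
def rotField (a b : Idx n) (p : Amb n) : Amb n :=
  (eta a * coord a p) • frame b p - (eta b * coord b p) • frame a p

theorem lie_M_of (a b : Idx n) {F : Amb n → ℂ} (hF : ContDiff ℝ ∞ F) (p : cov n) :
    ⁅M a b, Smooth.of F hF.contDiffOn⁆ p = fderiv ℝ F p.1 (rotField a b p.1) := by
  have hfderiv : fderivWithin ℝ F (cov n) p = fderiv ℝ F p.1 :=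
    (hF.differentiable (by simp) p.1).fderivWithin (cov_uniqueDiffOn n p p.2)
  rw [lie_M, sub_eq_add_neg, Smooth.add_apply, Smooth.neg_apply, Smooth.smul_apply,
    Smooth.smul_apply, mulCoord_apply, mulCoord_apply, pd_of, pd_of, hfderiv, rotField, map_sub,
    map_smul, map_smul, Complex.real_smul, Complex.real_smul]
  push_cast
  ring

theorem contDiff_ysq : ContDiff ℝ ∞ (ysq (n := n)) := by
  unfold ysq
  exact ContDiff.sum fun a _ => contDiff_const.mul ((coord_contDiff a).pow 2)

theorem fderiv_ysq_frame (a : Idx n) (p : Amb n) :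
    fderiv ℝ ysq p (frame a p) = 2 * (eta a * coord a p) := by
  have h : HasFDerivAt ysq (∑ b, (eta b : ℝ) • ((2 * coord b p) • fderiv ℝ (coord b) p)) p := by
    unfold ysq
    refine HasFDerivAt.fun_sum fun b _ => ?_
    simpa using
      (((coord_contDiff b).differentiable (by simp) p).hasFDerivAt.pow 2).const_mul (eta b)
  rw [h.fderiv]
  simp only [sum_apply, smul_apply, fderiv_coord,
    smul_eq_mul, mul_ite, mul_one, mul_zero, Finset.sum_ite_eq, Finset.mem_univ, if_true]
  ring

theorem fderiv_ysq_rotField (a b : Idx n) (p : Amb n) :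
    fderiv ℝ ysq p (rotField a b p) = 0 := by
  rw [rotField, map_sub, map_smul, map_smul, fderiv_ysq_frame, fderiv_ysq_frame, smul_eq_mul,
    smul_eq_mul]
  ring

theorem hasFDerivAt_exp_neg_fst (p : Amb n) :
    HasFDerivAt (fun p : Amb n => Complex.exp (-p.1))
      ((Complex.exp (-p.1) • (1 : ℂ →L[ℝ] ℂ)).comp (-ContinuousLinearMap.fst ℝ _ _)) p :=
  (Complex.hasStrictFDerivAt_exp_real (-p.1)).hasFDerivAt.comp p hasFDerivAt_fst.neg

theorem fderiv_uFun (k : Fin n) (p v : Amb n) :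
    fderiv ℝ (uFun k) p v = v.2 k * Complex.exp (-p.1) - v.1 * uFun k p := by
  have hcoord : HasFDerivAt (fun p : Amb n => (p.2 k : ℂ)) (Complex.ofRealCLM.comp
      ((EuclideanSpace.proj (𝕜 := ℝ) k).comp
        (ContinuousLinearMap.snd ℝ ℂ (EuclideanSpace ℝ (Fin n))))) p :=
    Complex.ofRealCLM.hasFDerivAt.comp p
      ((EuclideanSpace.proj (𝕜 := ℝ) k).hasFDerivAt.comp p hasFDerivAt_snd)
  have h : fderiv ℝ (uFun k) p = _ := (hcoord.mul (hasFDerivAt_exp_neg_fst p)).fderiv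
  simp [h, uFun]
  ring

theorem fderiv_tFun_of_fderiv_ysq_eq_zero {p v : Amb n} (hv : fderiv ℝ ysq p v = 0) :
    fderiv ℝ tFun p v = -2 * v.1 * tFun p := by
  have hysq : HasFDerivAt (fun p : Amb n => (ysq p : ℂ))
      (Complex.ofRealCLM.comp (fderiv ℝ ysq p)) p :=
    Complex.ofRealCLM.hasFDerivAt.comp p (contDiff_ysq.differentiable (by simp) p).hasFDerivAt
  have h : fderiv ℝ tFun p = _ := (hysq.mul ((hasFDerivAt_exp_neg_fst p).pow 2)).fderiv
  simp [h, tFun, hv]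
  ring

theorem fderiv_xPow (s : ℂ) (p v : Amb n) : fderiv ℝ (xPow s) p v = s * v.1 * xPow s p := by
  have h : HasFDerivAt (xPow (n := n) s) ((Complex.exp (s * logX p) • (1 : ℂ →L[ℝ] ℂ)).comp
      (s • ContinuousLinearMap.fst ℝ _ _)) p :=
    (Complex.hasStrictFDerivAt_exp_real (s * logX p)).hasFDerivAt.comp p
      ((hasFDerivAt_fst.add_const _).const_mul s)
  rw [h.fderiv]
  simp [xPow]
  ring

theorem fderiv_xPow_mul_tFun_pow {p v : Amb n} (hv : fderiv ℝ ysq p v = 0) (s : ℂ) (m : ℕ) :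
    fderiv ℝ (fun p => xPow s p * tFun p ^ m) p v =
      (s - 2 * m) * v.1 * (xPow s p * tFun p ^ m) := by
  have hx := ((xPow_contDiff (n := n) s).differentiable (by simp) p).hasFDerivAt
  have ht := ((contDiff_tFun (n := n)).differentiable (by simp) p).hasFDerivAt
  have h : fderiv ℝ (fun p => xPow s p * tFun p ^ m) p = _ := (hx.mul (ht.pow m)).fderiv
  rw [h]
  rcases m with _ | m
  · simp [fderiv_xPow]
  · simp [fderiv_xPow, fderiv_tFun_of_fderiv_ysq_eq_zero hv, pow_succ]
    ring

theorem fderiv_aeval_uFun (q : UPoly n) (p v : Amb n) :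
    fderiv ℝ (fun p => aeval (fun k => uFun k p) q) p v =
      ∑ k, v.2 k * Complex.exp (-p.1) * aeval (fun k => uFun k p) (pderiv k q) -
        v.1 * aeval (fun k => uFun k p) (euler q) := by
  rw [(hasFDerivAt_aeval
    (fun k => ((contDiff_uFun k).differentiable (by simp) p).hasFDerivAt) q).fderiv]
  simp only [sum_apply, smul_apply, smul_eq_mul, fderiv_uFun, euler_apply,
    map_sum (aeval (R := ℂ) _), map_mul, aeval_X, Finset.mul_sum, ← Finset.sum_sub_distrib]
  exact Finset.sum_congr rfl fun k _ => by ring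

theorem lie_M_mono (a b : Idx n) (m : ℕ) (q : UPoly n) (p : cov n) :
    ⁅M a b, mono m q⁆ p = (rotField a b p.1).1 * mono m ((weight n - 2 * m) • q - euler q) p +
      ∑ k, ((rotField a b p.1).2 k * Complex.exp (-p.1.1)) * mono m (pderiv k q) p := by
  have hxt := (((xPow_contDiff (weight n)).mul (contDiff_tFun.pow m)).differentiable
    (by simp) p.1).hasFDerivAt
  have hq := ((contDiff_aeval_uFun q).differentiable (by simp) p.1).hasFDerivAt
  have hfderiv : fderiv ℝ (monoFun m q) p.1 = _ := (hxt.mul hq).fderiv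
  have hlie : ⁅M a b, mono m q⁆ p = _ := lie_M_of a b (contDiff_monoFun m q) p
  rw [hlie, hfderiv]
  simp only [add_apply, smul_apply, smul_eq_mul, fderiv_aeval_uFun,
    fderiv_xPow_mul_tFun_pow (fderiv_ysq_rotField a b p.1), mono_apply, monoFun,
    map_sub (aeval (R := ℂ) _), map_smul (aeval (R := ℂ) _),
    mul_left_comm _ (xPow (weight n) p.1 * tFun p.1 ^ m), ← Finset.mul_sum]
  ring

end Derivatives

/-! ### The action of the Lie algebra on polynomials -/

section LieAction

variable {n : ℕ}

theorem lie_boost_zero_mono (k : Fin n) (m : ℕ) (q : UPoly n) (p : cov n) :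
    ⁅(M (Sum.inl 0) (Sum.inr k) : 𝔤 n), mono m q⁆ p =
      uFun k p.1 * mono m ((weight n - 2 * m) • q - euler q) p +
      (coord (Sum.inl 0) p.1 * Complex.exp (-p.1.1)) * mono m (pderiv k q) p := by
  rw [lie_M_mono]
  congr 1
  · simp [rotField, frame, eta, coord, uFun]
  · rw [Finset.sum_eq_single k]
    · simp [rotField, frame, eta]
    · intro j _ hj
      simp [rotField, frame, hj]
    · simp

theorem lie_boost_one_mono (k : Fin n) (m : ℕ) (q : UPoly n) (p : cov n) :
    ⁅(M (Sum.inl 1) (Sum.inr k) : 𝔤 n), mono m q⁆ p =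
      Complex.I * uFun k p.1 * mono m ((weight n - 2 * m) • q - euler q) p +
      (coord (Sum.inl 1) p.1 * Complex.exp (-p.1.1)) * mono m (pderiv k q) p := by
  have hfst : (rotField (Sum.inl 1) (Sum.inr k) p.1).1 = Complex.I * uFun k p.1 := by
    simp [rotField, frame, eta, coord, uFun]
    ring
  rw [lie_M_mono, hfst]
  congr 1
  rw [Finset.sum_eq_single k]
  · simp [rotField, frame, eta]
  · intro j _ hj
    simp [rotField, frame, hj]
  · simp

theorem lie_raise (k : Fin n) (F : UTPoly n) :
    ⁅(M (Sum.inl 0) (Sum.inr k) : 𝔤 n), realize F⁆ +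
      Complex.I • ⁅(M (Sum.inl 1) (Sum.inr k) : 𝔤 n), realize F⁆ = realize (raise k F) := by
  refine linearMap_congr_of_single
    (f := (LieModule.toEnd ℂ (𝔤 n) (Smooth n) (M (Sum.inl 0) (Sum.inr k)) +
      Complex.I • LieModule.toEnd ℂ (𝔤 n) (Smooth n) (M (Sum.inl 1) (Sum.inr k))) ∘ₗ realize)
    (g := realize ∘ₗ raise k) (fun m q => Smooth.hext fun p => ?_) F
  change (⁅(M (Sum.inl 0) (Sum.inr k) : 𝔤 n), realize (Finsupp.single m q)⁆ +
    Complex.I • ⁅(M (Sum.inl 1) (Sum.inr k) : 𝔤 n), realize (Finsupp.single m q)⁆) p =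
      realize (raise k (Finsupp.single m q)) p
  rw [raise_single, realize_single, realize_single, Smooth.add_apply, Smooth.smul_apply,
    lie_boost_zero_mono, lie_boost_one_mono]
  linear_combination mono m (pderiv k q) p * coord_add_I_mul_coord_mul_exp_neg p.1 +
    (uFun k p.1 * mono m ((weight n - 2 * m) • q - euler q) p) * Complex.I_sq

theorem lie_lower (k : Fin n) (F : UTPoly n) :
    ⁅(M (Sum.inl 0) (Sum.inr k) : 𝔤 n), realize F⁆ -
      Complex.I • ⁅(M (Sum.inl 1) (Sum.inr k) : 𝔤 n), realize F⁆ = realize (lower k F) := by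
  refine linearMap_congr_of_single
    (f := (LieModule.toEnd ℂ (𝔤 n) (Smooth n) (M (Sum.inl 0) (Sum.inr k)) -
      Complex.I • LieModule.toEnd ℂ (𝔤 n) (Smooth n) (M (Sum.inl 1) (Sum.inr k))) ∘ₗ realize)
    (g := realize ∘ₗ lower k) (fun m q => Smooth.hext fun p => ?_) F
  change (⁅(M (Sum.inl 0) (Sum.inr k) : 𝔤 n), realize (Finsupp.single m q)⁆ -
    Complex.I • ⁅(M (Sum.inl 1) (Sum.inr k) : 𝔤 n), realize (Finsupp.single m q)⁆) p =
      realize (lower k (Finsupp.single m q)) p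
  have hconformal : conformal (weight n - 2 * m) k q =
      sumSq * pderiv k q + (2 : ℂ) • (X k * ((weight n - 2 * m) • q - euler q)) := by
    rw [conformal_apply, smul_eq_C_mul (X k * _), map_ofNat, mul_assoc]
  rw [lower_single, map_add, realize_single, realize_single, realize_single, sub_eq_add_neg,
    hconformal, map_add, map_smul, Smooth.add_apply, Smooth.add_apply, Smooth.add_apply,
    Smooth.neg_apply, Smooth.smul_apply, Smooth.smul_apply, lie_boost_zero_mono,
    lie_boost_one_mono, ← add_assoc, mono_succ_add, mono_X_mul]
  linear_combination
    -(uFun k p.1 * mono m ((weight n - 2 * m) • q - euler q) p) * Complex.I_sq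

theorem lie_boost_zero (k : Fin n) (F : UTPoly n) :
    ⁅(M (Sum.inl 0) (Sum.inr k) : 𝔤 n), realize F⁆ =
      realize ((1 / 2 : ℂ) • (raise k F + lower k F)) := by
  rw [map_smul, map_add, ← lie_raise, ← lie_lower]
  module

theorem lie_boost_one (k : Fin n) (F : UTPoly n) :
    ⁅(M (Sum.inl 1) (Sum.inr k) : 𝔤 n), realize F⁆ =
      realize ((-(Complex.I / 2) : ℂ) • (raise k F - lower k F)) := by
  rw [map_smul, map_sub, ← lie_raise, ← lie_lower, add_sub_sub_cancel, ← two_smul ℂ, smul_smul,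
    smul_smul, show -(Complex.I / 2) * 2 * Complex.I = 1 by linear_combination -Complex.I_sq,
    one_smul]

/-- The operator `weight - ∑ u_j ∂/∂u_j - 2 t ∂/∂t`, the action of `-i M_{-1,0}` on `F` in the
function `x₁^weight F(u, t)`. -/
def energy : UTPoly n →ₗ[ℂ] UTPoly n :=
  Finsupp.lsum ℂ fun m => Finsupp.lsingle m ∘ₗ ((weight n - 2 * m) • LinearMap.id - euler)

/-- The operator `u_j ∂/∂u_k - u_k ∂/∂u_j`, the action of `-M_{jk}`. -/
def angular (j k : Fin n) : UTPoly n →ₗ[ℂ] UTPoly n :=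
  Finsupp.lsum ℂ fun m => Finsupp.lsingle m ∘ₗ
    (LinearMap.mulLeft ℂ (X j) ∘ₗ (pderiv k).toLinearMap -
      LinearMap.mulLeft ℂ (X k) ∘ₗ (pderiv j).toLinearMap)

theorem energy_single (m : ℕ) (q : UPoly n) :
    energy (Finsupp.single m q) = Finsupp.single m ((weight n - 2 * m) • q - euler q) := by
  simp [energy]

theorem angular_single (j k : Fin n) (m : ℕ) (q : UPoly n) :
    angular j k (Finsupp.single m q) = Finsupp.single m (X j * pderiv k q - X k * pderiv j q) := by
  simp [angular]

theorem two_smul_energy (k : Fin n) (F : UTPoly n) :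
    (2 : ℂ) • energy F = raise k (lower k F) - lower k (raise k F) := by
  refine linearMap_congr_of_single (f := (2 : ℂ) • energy)
    (g := raise k ∘ₗ lower k - lower k ∘ₗ raise k) (fun m q => ?_) F
  simp only [LinearMap.smul_apply, LinearMap.sub_apply, LinearMap.comp_apply]
  rw [raise_lower_sub, energy_single, Finsupp.smul_single, smul_eq_C_mul, if_pos rfl, sub_self,
    mul_zero, zero_add, map_ofNat]

theorem two_smul_angular {j k : Fin n} (h : j ≠ k) (F : UTPoly n) :
    (2 : ℂ) • angular j k F = raise j (lower k F) - lower k (raise j F) := by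
  refine linearMap_congr_of_single (f := (2 : ℂ) • angular j k)
    (g := raise j ∘ₗ lower k - lower k ∘ₗ raise j) (fun m q => ?_) F
  simp only [LinearMap.smul_apply, LinearMap.sub_apply, LinearMap.comp_apply]
  rw [raise_lower_sub, angular_single, Finsupp.smul_single, smul_eq_C_mul, if_neg h, add_zero,
    map_ofNat]

theorem lie_energy (F : UTPoly n) :
    ⁅(M (Sum.inl 0) (Sum.inl 1) : 𝔤 n), realize F⁆ = Complex.I • realize (energy F) := by
  refine linearMap_congr_of_single
    (f := LieModule.toEnd ℂ (𝔤 n) (Smooth n) (M (Sum.inl 0) (Sum.inl 1)) ∘ₗ realize)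
    (g := Complex.I • (realize ∘ₗ energy)) (fun m q => Smooth.hext fun p => ?_) F
  change ⁅(M (Sum.inl 0) (Sum.inl 1) : 𝔤 n), realize (Finsupp.single m q)⁆ p =
    (Complex.I • realize (energy (Finsupp.single m q))) p
  have hfst : (rotField (Sum.inl 0) (Sum.inl 1) p.1).1 = Complex.I := by
    simp only [rotField, frame, eta, Sum.elim_inl, one_mul, Prod.fst_sub, Prod.smul_fst,
      Complex.real_smul]
    linear_combination Complex.I * coord_add_I_mul_coord_mul_exp_neg p.1 -
      (coord (Sum.inl 1) p.1 * Complex.exp (-p.1.1)) * Complex.I_sq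
  rw [energy_single, realize_single, realize_single, Smooth.smul_apply, lie_M_mono, hfst]
  simp [rotField, frame]

theorem lie_angular (j k : Fin n) (F : UTPoly n) :
    ⁅(M (Sum.inr j) (Sum.inr k) : 𝔤 n), realize F⁆ = -realize (angular j k F) := by
  refine linearMap_congr_of_single
    (f := LieModule.toEnd ℂ (𝔤 n) (Smooth n) (M (Sum.inr j) (Sum.inr k)) ∘ₗ realize)
    (g := -(realize ∘ₗ angular j k)) (fun m q => Smooth.hext fun p => ?_) F
  change ⁅(M (Sum.inr j) (Sum.inr k) : 𝔤 n), realize (Finsupp.single m q)⁆ p =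
    (-realize (angular j k (Finsupp.single m q))) p
  rw [angular_single, realize_single, realize_single, Smooth.neg_apply, lie_M_mono,
    map_sub (mono m) (X j * _), sub_eq_add_neg (mono m (X j * _)), Smooth.add_apply,
    Smooth.neg_apply, mono_X_mul, mono_X_mul]
  have hfst : (rotField (Sum.inr j) (Sum.inr k) p.1).1 = 0 := by simp [rotField, frame]
  have hsnd (i : Fin n) : ((rotField (Sum.inr j) (Sum.inr k) p.1).2 i : ℂ) =
      (if i = j then (p.1.2 k : ℂ) else 0) - if i = k then (p.1.2 j : ℂ) else 0 := by
    simp only [rotField, frame, eta, coord, PiLp.single_apply, Sum.elim_inr, Prod.snd_sub,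
      Prod.smul_snd, PiLp.sub_apply, PiLp.smul_apply, smul_eq_mul]
    split_ifs <;> push_cast <;> ring
  simp only [hfst, hsnd, sub_mul, ite_mul, zero_mul, Finset.sum_sub_distrib, Finset.sum_ite_eq',
    Finset.mem_univ, if_true, uFun]
  ring

end LieAction

section LieGenerators

variable {n : ℕ}

theorem eq_sum_M (A : 𝔤 n) : A = ∑ a, ∑ b, ((1 / 2 : ℂ) * (A.1 a b * eta b)) • M a b := by
  have hskew := (mem_so' A.1).1 A.2
  have heta (a : Idx n) : (eta a : ℂ) * eta a = 1 := by
    rcases a with i | j <;> simp [eta]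
  refine Subtype.ext (Matrix.ext fun c d => ?_)
  have hcoe : ((∑ a, ∑ b, ((1 / 2 : ℂ) * (A.1 a b * eta b)) • M a b : 𝔤 n) :
      Matrix (Idx n) (Idx n) ℂ) = ∑ a, ∑ b, ((1 / 2 : ℂ) * (A.1 a b * eta b)) •
        (Matrix.single a b (eta b : ℂ) - Matrix.single b a (eta a : ℂ)) := by
    push_cast
    rfl
  rw [hcoe]
  simp only [Matrix.sum_apply, Matrix.smul_apply, Matrix.sub_apply, Matrix.single_apply,
    smul_eq_mul, mul_sub, Finset.sum_sub_distrib, mul_ite, mul_zero]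
  have hfirst : ∑ x, ∑ y, (if x = c ∧ y = d then (1 / 2 : ℂ) * (A.1 x y * eta y) * eta y else 0) =
      (1 / 2 : ℂ) * (A.1 c d * eta d) * eta d := by
    rw [Finset.sum_eq_single c, Finset.sum_eq_single d] <;> simp +contextual
  have hsecond : ∑ x, ∑ y,
      (if y = c ∧ x = d then (1 / 2 : ℂ) * (A.1 x y * eta y) * eta x else 0) =
      (1 / 2 : ℂ) * (A.1 d c * eta c) * eta d := by
    rw [Finset.sum_eq_single d, Finset.sum_eq_single c] <;> simp +contextual
  rw [hfirst, hsecond]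
  linear_combination (1 / 2 : ℂ) * eta c * hskew c d - (1 / 2 : ℂ) * A.1 c d * heta c -
    (1 / 2 : ℂ) * A.1 c d * heta d

theorem M_self (a : Idx n) : (M a a : 𝔤 n) = 0 := Subtype.ext (sub_self _)

theorem M_swap (a b : Idx n) : (M b a : 𝔤 n) = -M a b := Subtype.ext (neg_sub _ _).symm

variable {V : Type*} [AddCommGroup V] [Module ℂ V] [LieRingModule (𝔤 n) V]
  {N : Submodule ℂ V} {v : V}

theorem lie_M_inl_inl_mem (henergy : ⁅(M (Sum.inl 0) (Sum.inl 1) : 𝔤 n), v⁆ ∈ N) (i j : Fin 2) :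
    ⁅(M (Sum.inl i) (Sum.inl j) : 𝔤 n), v⁆ ∈ N := by
  fin_cases i <;> fin_cases j
  · simp [M_self]
  · exact henergy
  · change ⁅(M (Sum.inl 1) (Sum.inl 0) : 𝔤 n), v⁆ ∈ N
    rw [M_swap, neg_lie]
    exact N.neg_mem henergy
  · simp [M_self]

variable [LieModule ℂ (𝔤 n) V]

theorem lie_mem_of_isCompactElt
    (henergy : ⁅(M (Sum.inl 0) (Sum.inl 1) : 𝔤 n), v⁆ ∈ N)
    (hrot : ∀ j k, ⁅(M (Sum.inr j) (Sum.inr k) : 𝔤 n), v⁆ ∈ N)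
    {A : 𝔤 n} (hA : IsCompactElt A) : ⁅A, v⁆ ∈ N := by
  rw [eq_sum_M A, sum_lie]
  refine N.sum_mem fun a _ => ?_
  rw [sum_lie]
  refine N.sum_mem fun b _ => ?_
  rw [smul_lie]
  rcases a with i | j <;> rcases b with i' | j'
  · exact N.smul_mem _ (lie_M_inl_inl_mem henergy i i')
  · simp [(hA i j').1]
  · simp [(hA i' j).2]
  · exact N.smul_mem _ (hrot j j')

theorem lie_mem_of_lie_M_mem
    (henergy : ⁅(M (Sum.inl 0) (Sum.inl 1) : 𝔤 n), v⁆ ∈ N)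
    (hrot : ∀ j k, ⁅(M (Sum.inr j) (Sum.inr k) : 𝔤 n), v⁆ ∈ N)
    (hboost : ∀ i k, ⁅(M (Sum.inl i) (Sum.inr k) : 𝔤 n), v⁆ ∈ N) (A : 𝔤 n) : ⁅A, v⁆ ∈ N := by
  rw [eq_sum_M A, sum_lie]
  refine N.sum_mem fun a _ => ?_
  rw [sum_lie]
  refine N.sum_mem fun b _ => ?_
  rw [smul_lie]
  refine N.smul_mem _ ?_
  rcases a with i | j <;> rcases b with i' | j'
  · exact lie_M_inl_inl_mem henergy i i'
  · exact hboost i j'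
  · rw [M_swap, neg_lie]
    exact N.neg_mem (hboost i' j)
  · exact hrot j j'

end LieGenerators

section StableSubmodules

variable {n : ℕ} {N : Submodule ℂ (UTPoly n)}

theorem energy_mem (k : Fin n) (hN : IsStable N) {F : UTPoly n} (hF : F ∈ N) : energy F ∈ N := by
  refine (Submodule.smul_mem_iff N (two_ne_zero (α := ℂ))).1 ?_
  rw [two_smul_energy k]
  exact N.sub_mem (hN k _ (hN k F hF).2).1 (hN k _ (hN k F hF).1).2

theorem angular_mem (hN : IsStable N) (j k : Fin n) {F : UTPoly n} (hF : F ∈ N) :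
    angular j k F ∈ N := by
  by_cases h : j = k
  · subst h
    have hzero : angular j j F = 0 := linearMap_congr_of_single (f := angular j j) (g := 0)
      (fun m q => by simp only [angular_single, sub_self, Finsupp.single_zero,
        LinearMap.zero_apply]) F
    exact hzero ▸ N.zero_mem
  · refine (Submodule.smul_mem_iff N (two_ne_zero (α := ℂ))).1 ?_
    rw [two_smul_angular h]
    exact N.sub_mem (hN j _ (hN k F hF).2).1 (hN k _ (hN j F hF).1).2

/-- The `𝔤`-submodule of the functions attached to the polynomials in a stable subspace. -/
def realizeSub (hn : 0 < n) (hN : IsStable N) : LieSubmodule ℂ (𝔤 n) (Smooth n) where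
  __ := N.map realize
  lie_mem {A f} hf := by
    obtain ⟨F, hF, rfl⟩ := hf
    refine lie_mem_of_lie_M_mem (N := N.map realize) ?_ (fun j k => ?_) (fun i k => ?_) A
    · rw [lie_energy, ← map_smul]
      exact ⟨_, N.smul_mem _ (energy_mem ⟨0, hn⟩ hN hF), rfl⟩
    · rw [lie_angular, ← map_neg]
      exact ⟨_, N.neg_mem (angular_mem hN j k hF), rfl⟩
    · fin_cases i
      · exact lie_boost_zero k F ▸
          ⟨_, N.smul_mem _ (N.add_mem (hN k F hF).1 (hN k F hF).2), rfl⟩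
      · exact lie_boost_one k F ▸
          ⟨_, N.smul_mem _ (N.sub_mem (hN k F hF).1 (hN k F hF).2), rfl⟩

theorem isStable_comap_realize (W : LieSubmodule ℂ (𝔤 n) (Smooth n)) :
    IsStable (W.toSubmodule.comap realize) := fun k F hF => by
  have hF' : realize F ∈ W := hF
  constructor
  · change realize (raise k F) ∈ W
    rw [← lie_raise]
    exact W.add_mem (W.lie_mem hF') (W.smul_mem _ (W.lie_mem hF'))
  · change realize (lower k F) ∈ W
    rw [← lie_lower]
    exact W.sub_mem (W.lie_mem hF') (W.smul_mem _ (W.lie_mem hF'))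

theorem lieSpan_realize (hn : 0 < n) (F : UTPoly n) :
    LieSubmodule.lieSpan ℂ (𝔤 n) {realize F} = realizeSub hn (isStable_gen F) := by
  refine le_antisymm (LieSubmodule.lieSpan_le.2 ?_) ?_
  · rintro _ rfl
    exact ⟨F, mem_gen_self F, rfl⟩
  · rintro _ ⟨G, hG, rfl⟩
    exact gen_le (isStable_comap_realize (LieSubmodule.lieSpan ℂ (𝔤 n) {realize F}))
      (LieSubmodule.subset_lieSpan (Set.mem_singleton _)) hG

theorem mem_lieSpan_realize (hn : 0 < n) {F : UTPoly n} {f : Smooth n} :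
    f ∈ LieSubmodule.lieSpan ℂ (𝔤 n) {realize F} ↔ ∃ G ∈ gen F, realize G = f := by
  rw [lieSpan_realize hn]
  rfl

theorem constantCoeff_apply_eq_zero_of_realize_eq_zero {F : UTPoly n} (hF : realize F = 0)
    (m : ℕ) : constantCoeff (F m) = 0 := by
  have hP : ∑ m ∈ F.support, Polynomial.monomial m (constantCoeff (F m)) = 0 := by
    refine polynomial_eq_zero_of_eval_exp_mul_I fun θ => ?_
    let p : Amb n := (((-(θ / 2) : ℝ) : ℂ) * Complex.I, 0)
    have hp : p ∈ cov n := by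
      change ‖(0 : EuclideanSpace ℝ (Fin n))‖ ≤ _
      rw [norm_zero]
      exact (Real.exp_pos _).le
    have ht : tFun p = Complex.exp (θ * Complex.I) := by
      rw [tFun, ysq_eq, ← Complex.exp_nat_mul]
      simp [p]
      ring_nf
    have haxis := realize_apply_axis F ⟨p, hp⟩ rfl
    rw [hF, ht] at haxis
    exact (mul_eq_zero.1 haxis.symm).resolve_left (Complex.exp_ne_zero _)
  by_cases hm : F m = 0
  · rw [hm, map_zero]
  · simpa [Polynomial.coeff_monomial, Polynomial.finsetSum_coeff, hm] using
      congrArg (Polynomial.coeff · m) hP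

theorem realize_injective : Function.Injective (realize (n := n)) := by
  rw [← LinearMap.ker_eq_bot, LinearMap.ker_eq_bot']
  intro F hF
  by_contra hF0
  obtain ⟨m, hm⟩ := Finsupp.ne_iff.1 hF0
  obtain ⟨G, hG, hGm⟩ := exists_mem_gen_apply_eq_one hm
  have hG0 : realize G = 0 := gen_le (isStable_comap_realize ⊥) hF hG
  simpa [hGm] using constantCoeff_apply_eq_zero_of_realize_eq_zero hG0 m

end StableSubmodules

section Levels

variable {n k : ℕ}

/-- The polynomials of degree `k`, where `u_j` has degree `1` and `t` has degree `2`. -/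
def level (n k : ℕ) : Submodule ℂ (UTPoly n) :=
  ⨆ m : Fin (k / 2 + 1), (homogeneousSubmodule (Fin n) ℂ (k - 2 * m)).map (Finsupp.lsingle m)

instance (n k : ℕ) : FiniteDimensional ℂ (level n k) := by
  have (r : ℕ) : FiniteDimensional ℂ (homogeneousSubmodule (Fin n) ℂ r) :=
    Module.Finite.iff_fg.2 (homogeneousSubmodule_fg (Fin n) ℂ r)
  unfold level
  infer_instance

theorem single_mem_level {m r : ℕ} (h : r + 2 * m = k) {q : UPoly n} (hq : q.IsHomogeneous r) :
    Finsupp.single m q ∈ level n k := by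
  refine Submodule.mem_iSup_of_mem (⟨m, by omega⟩ : Fin (k / 2 + 1)) ⟨q, ?_, rfl⟩
  change q.IsHomogeneous (k - 2 * m)
  rwa [show k - 2 * m = r by omega]

theorem level_le {N : Submodule ℂ (UTPoly n)}
    (h : ∀ m r, ∀ q : UPoly n, r + 2 * m = k → q.IsHomogeneous r → Finsupp.single m q ∈ N) :
    level n k ≤ N := by
  refine iSup_le fun m => ?_
  rintro _ ⟨q, hq, rfl⟩
  exact h m _ q (by have := m.2; omega) hq

theorem iSup_level (n : ℕ) : ⨆ k, level n k = ⊤ := by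
  refine eq_top_iff.2 fun F _ => ?_
  rw [← F.sum_single]
  refine Submodule.sum_mem _ fun m _ => ?_
  rw [← sum_homogeneousComponent (F m), ← Finsupp.lsingle_apply (R := ℂ), map_sum]
  exact Submodule.sum_mem _ fun r _ => Submodule.mem_iSup_of_mem (r + 2 * m)
    (single_mem_level rfl (homogeneousComponent_isHomogeneous r (F m)))

theorem energy_of_mem_level {F : UTPoly n} (hF : F ∈ level n k) :
    energy F = (weight n - k) • F := by
  have hle : level n k ≤ LinearMap.eqLocus energy ((weight n - k) • LinearMap.id) := by
    refine level_le fun m r q h hq => ?_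
    rw [LinearMap.mem_eqLocus, energy_single, euler_of_isHomogeneous hq, LinearMap.smul_apply,
      LinearMap.id_apply, Finsupp.smul_single, ← sub_smul, ← h]
    congr 2
    push_cast
    ring
  exact hle hF

theorem isHomogeneous_X_mul_pderiv {R σ : Type*} [CommSemiring R] {r : ℕ} {q : MvPolynomial σ R}
    (hq : q.IsHomogeneous r) (a b : σ) : (X a * pderiv b q).IsHomogeneous r := by
  rcases r with _ | r
  · rw [← totalDegree_zero_iff_isHomogeneous, totalDegree_eq_zero_iff_eq_C] at hq
    rw [hq, pderiv_C, mul_zero]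
    exact isHomogeneous_zero _ _ _
  · have h := (isHomogeneous_X R a).mul (hq.pderiv (i := b))
    rwa [Nat.add_sub_cancel, add_comm] at h

theorem angular_mem_level (i j : Fin n) {F : UTPoly n} (hF : F ∈ level n k) :
    angular i j F ∈ level n k := by
  have hle : level n k ≤ (level n k).comap (angular i j) := by
    refine level_le fun m r q h hq => ?_
    rw [Submodule.mem_comap, angular_single]
    exact single_mem_level h ((homogeneousSubmodule (Fin n) ℂ r).sub_mem
      (isHomogeneous_X_mul_pderiv hq i j) (isHomogeneous_X_mul_pderiv hq j i))
  exact hle hF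

end Levels

/-! ### Rotations of the time plane -/

section Rotation

variable {n : ℕ}

/-- The rotation by `θ` in the plane of `y^{-1}, y^0`, on the universal covering. -/
def rotPt (θ : ℝ) (p : Amb n) : Amb n := (p.1 + θ * Complex.I, p.2)

theorem rotPt_mem (θ : ℝ) {p : Amb n} (hp : p ∈ cov n) : rotPt θ p ∈ cov n := by
  have hp' : ‖p.2‖ ≤ Real.exp p.1.re := hp
  change ‖p.2‖ ≤ Real.exp (p.1 + θ * Complex.I).re
  simpa using hp'

/-- The rotation by `θ`, as a self-map of `cov n`. -/
def rotCov (θ : ℝ) (p : cov n) : cov n := ⟨rotPt θ p.1, rotPt_mem θ p.2⟩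

theorem continuous_rotCov : Continuous fun x : ℝ × cov n => rotCov x.1 x.2 := by
  refine Continuous.subtype_mk ?_ _
  unfold rotPt
  fun_prop

theorem hasFDerivAt_rotPt (θ : ℝ) (p : Amb n) :
    HasFDerivAt (rotPt θ) (ContinuousLinearMap.id ℝ (Amb n)) p :=
  (hasFDerivAt_id p).add_const ((θ * Complex.I, 0) : Amb n) |>.congr_of_eventuallyEq
    (Filter.Eventually.of_forall fun q => Prod.ext rfl (add_zero q.2).symm)

theorem contDiff_rotPt (θ : ℝ) : ContDiff ℝ ∞ (rotPt (n := n) θ) :=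
  (contDiff_fst.add contDiff_const).prodMk contDiff_snd

/-- Composition of smooth functions with the rotation by `θ`. -/
def rot (θ : ℝ) : Smooth n →ₗ[ℂ] Smooth n where
  toFun f := Smooth.of (fun p => ext f (rotPt θ p))
    (f.ext_contDiffOn.comp (contDiff_rotPt θ).contDiffOn fun _ hp => rotPt_mem θ hp)
  map_add' f g := Smooth.hext fun p => by
    have h (f : Smooth n) := ext_apply f.1 (rotCov θ p)
    exact (h (f + g)).trans (congrArg₂ (· + ·) (h f).symm (h g).symm)
  map_smul' c f := Smooth.hext fun p => by
    have h (f : Smooth n) := ext_apply f.1 (rotCov θ p)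
    exact (h (c • f)).trans (congrArg (c * ·) (h f).symm)

theorem rot_apply (θ : ℝ) (f : Smooth n) (p : cov n) : rot θ f p = f (rotCov θ p) :=
  ext_apply f.1 (rotCov θ p)

theorem pd_rot_apply (θ : ℝ) (a : Idx n) (f : Smooth n) (p : cov n) :
    pd a (rot θ f) p = fderivWithin ℝ (ext f) (cov n) (rotPt θ p.1) (frame a p.1) := by
  have hderiv : HasFDerivWithinAt (fun p => ext f (rotPt θ p))
      ((fderivWithin ℝ (ext f) (cov n) (rotPt θ p.1)).comp (ContinuousLinearMap.id ℝ (Amb n)))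
      (cov n) p.1 :=
    (f.differentiableWithinAt (rotCov θ p)).hasFDerivWithinAt.comp p.1
      (hasFDerivAt_rotPt θ p.1).hasFDerivWithinAt fun _ hp => rotPt_mem θ hp
  refine (pd_of a _ p).trans ?_
  rw [hderiv.fderivWithin (cov_uniqueDiffOn n p p.2)]
  rfl

/-- The matrix of the rotation by `θ` in the plane of `y^{-1}, y^0`. -/
def rotMatrix (n : ℕ) (θ : ℝ) : Matrix (Idx n) (Idx n) ℝ :=
  Matrix.fromBlocks !![Real.cos θ, Real.sin θ; -Real.sin θ, Real.cos θ] 0 0 1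

theorem continuous_rotMatrix (n : ℕ) : Continuous (rotMatrix n) := by
  refine Continuous.matrix_fromBlocks ?_ continuous_const continuous_const continuous_const
  refine continuous_matrix fun i j => ?_
  fin_cases i <;> fin_cases j
  exacts [Real.continuous_cos, Real.continuous_sin, Real.continuous_sin.neg, Real.continuous_cos]

theorem exp_neg_fst_eq_rotPt (θ : ℝ) (p : Amb n) : Complex.exp (-p.1) =
    (Real.cos θ + Real.sin θ * Complex.I) * Complex.exp (-(rotPt θ p).1) := by
  rw [Complex.ofReal_cos, Complex.ofReal_sin, ← Complex.exp_mul_I, ← Complex.exp_add]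
  congr 1
  simp [rotPt]

theorem frame_eq_sum_rotMatrix (θ : ℝ) (a : Idx n) (p : Amb n) :
    frame a p = ∑ b, rotMatrix n θ a b • frame b (rotPt θ p) := by
  rcases a with i | j
  · refine Prod.ext ?_ ?_
    · fin_cases i
      · simp [rotMatrix, frame, exp_neg_fst_eq_rotPt θ p]
        ring
      · simp [rotMatrix, frame, exp_neg_fst_eq_rotPt θ p]
        linear_combination (Complex.sin θ * Complex.exp (-(rotPt θ p).1)) * Complex.I_sq
    · fin_cases i <;> simp [rotMatrix, frame]
  · simp [rotMatrix, frame, Matrix.one_apply]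

theorem pd_rot (θ : ℝ) (a : Idx n) (f : Smooth n) :
    pd a (rot θ f) = ∑ b, (rotMatrix n θ a b : ℂ) • rot θ (pd b f) := by
  refine Smooth.hext fun p => ?_
  rw [pd_rot_apply, frame_eq_sum_rotMatrix θ a, map_sum, Smooth.sum_apply]
  refine Finset.sum_congr rfl fun b _ => ?_
  rw [map_smul, Smooth.smul_apply, Complex.real_smul, rot_apply]
  rfl

theorem continuous_toC_derivs (l : List (Idx n)) : Continuous fun f => toC n (derivs l f) :=
  (continuous_apply l).comp (continuous_induced_dom (f := jets n))

theorem continuous_rot : Continuous fun x : ℝ × Smooth n => rot x.1 x.2 := by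
  refine continuous_induced_rng.2 (continuous_pi fun l => ?_)
  change Continuous fun x : ℝ × Smooth n => toC n (derivs l (rot x.1 x.2))
  induction l with
  | nil =>
    let R : C(ℝ, C(cov n, cov n)) := ContinuousMap.curry ⟨_, continuous_rotCov⟩
    have hcomp (x : ℝ × Smooth n) : toC n (rot x.1 x.2) = (toC n x.2).comp (R x.1) :=
      ContinuousMap.ext fun p => rot_apply x.1 x.2 p
    exact (((continuous_toC_derivs []).comp continuous_snd).compCM
      (R.continuous.comp continuous_fst)).congr fun x => (hcomp x).symm
  | cons a l ih =>
    have hcons (x : ℝ × Smooth n) : toC n (derivs (a :: l) (rot x.1 x.2)) =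
        ∑ b, (rotMatrix n x.1 a b : ℂ) • toC n (derivs l (rot x.1 (pd b x.2))) := by
      change toC n (derivs l (pd a (rot x.1 x.2))) = _
      simp only [pd_rot, map_sum, map_smul]
    simp only [hcons]
    refine continuous_finsetSum _ fun b _ => ?_
    have hcoeff : Continuous fun x : ℝ × Smooth n => (rotMatrix n x.1 a b : ℂ) :=
      Complex.continuous_ofReal.comp
        (((continuous_rotMatrix n).matrix_elem a b).comp continuous_fst)
    have hderivs : Continuous fun x : ℝ × Smooth n => toC n (derivs l (rot x.1 (pd b x.2))) :=
      ih.comp (continuous_fst.prodMk ((continuous_pd b).comp continuous_snd))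
    exact hcoeff.smul hderivs

theorem uFun_rotPt (θ : ℝ) (k : Fin n) (p : Amb n) :
    uFun k (rotPt θ p) = Complex.exp (-(θ * Complex.I)) * uFun k p := by
  simp only [uFun, rotPt, neg_add, Complex.exp_add]
  ring

theorem ysq_rotPt (θ : ℝ) (p : Amb n) : ysq (rotPt θ p) = ysq p := by
  rw [ysq_eq, ysq_eq]
  simp [rotPt]

theorem tFun_rotPt (θ : ℝ) (p : Amb n) :
    tFun (rotPt θ p) = Complex.exp (-(θ * Complex.I)) ^ 2 * tFun p := by
  rw [tFun, tFun, ysq_rotPt]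
  simp only [rotPt, neg_add, Complex.exp_add]
  ring

theorem xPow_rotPt (s : ℂ) (θ : ℝ) (p : Amb n) :
    xPow s (rotPt θ p) = Complex.exp (θ * Complex.I * s) * xPow s p := by
  rw [xPow, xPow, ← Complex.exp_add]
  congr 1
  simp only [logX, rotPt]
  ring

theorem monoFun_rotPt {r : ℕ} {q : UPoly n} (hq : q.IsHomogeneous r) (θ : ℝ) (m : ℕ) (p : Amb n) :
    monoFun m q (rotPt θ p) = Complex.exp (θ * Complex.I * weight n) *
      Complex.exp (-(θ * Complex.I)) ^ (r + 2 * m) * monoFun m q p := by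
  simp only [monoFun, xPow_rotPt, tFun_rotPt, uFun_rotPt, aeval_mul_of_isHomogeneous hq]
  ring

/-- The rotation by `θ` of the factor `F` in the function `x₁^weight F`: the normalization that
makes the rotations periodic in `θ`. -/
def twist (θ : ℝ) : Smooth n →L[ℂ] Smooth n where
  toLinearMap := Complex.exp (-(θ * Complex.I * weight n)) • rot θ
  cont := (continuous_rot.comp (Continuous.prodMk_right θ)).const_smul _

theorem twist_apply (θ : ℝ) (f : Smooth n) :
    twist θ f = Complex.exp (-(θ * Complex.I * weight n)) • rot θ f :=
  rfl

theorem twist_zero (f : Smooth n) : twist 0 f = f := by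
  refine Smooth.hext fun p => ?_
  have hp : rotCov 0 p = p := Subtype.ext (Prod.ext (by simp [rotCov, rotPt]) rfl)
  simp only [twist_apply, Smooth.smul_apply, rot_apply, hp]
  simp

theorem continuous_twist {α : Type*} [TopologicalSpace α] {t : α → ℝ} {g : α → Smooth n}
    (ht : Continuous t) (hg : Continuous g) : Continuous fun x => twist (t x) (g x) := by
  have hexp : Continuous fun x => Complex.exp (-(t x * Complex.I * weight n)) := by fun_prop
  have hrot : Continuous fun x => rot (t x) (g x) := continuous_rot.comp (ht.prodMk hg)
  exact hexp.smul hrot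

theorem twist_realize {k : ℕ} (θ : ℝ) {F : UTPoly n} (hF : F ∈ level n k) :
    twist θ (realize F) = Complex.exp (-(θ * Complex.I)) ^ k • realize F := by
  have hle : level n k ≤ LinearMap.eqLocus ((twist θ).toLinearMap ∘ₗ realize)
      (Complex.exp (-(θ * Complex.I)) ^ k • realize) := by
    refine level_le fun m r q h hq => Smooth.hext fun p => ?_
    change (Complex.exp (-(θ * Complex.I * weight n)) • rot θ (realize (Finsupp.single m q))) p =
      (Complex.exp (-(θ * Complex.I)) ^ k • realize (Finsupp.single m q)) p
    rw [realize_single, Smooth.smul_apply, Smooth.smul_apply, rot_apply]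
    refine (congrArg _ (monoFun_rotPt hq θ m p.1)).trans ?_
    rw [h, ← mul_assoc, ← mul_assoc, ← Complex.exp_add, neg_add_cancel, Complex.exp_zero, one_mul]
    rfl
  exact hle hF

end Rotation

/-! ### Fourier expansion -/

section Fourier

variable {n : ℕ}

instance (n : ℕ) : FirstCountableTopology (Smooth n) :=
  TopologicalSpace.firstCountableTopology_induced _ _ (jets n)

instance (n : ℕ) : LocallyConvexSpace ℝ (Smooth n) :=
  LocallyConvexSpace.induced ((jets n).restrictScalars ℝ)

theorem continuous_eval (p : cov n) : Continuous fun f : Smooth n => f p :=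
  (continuous_eval_const p).comp (continuous_toC_derivs [])

instance (n : ℕ) : SeparatingDual ℂ (Smooth n) where
  exists_ne_zero' f hf := by
    obtain ⟨p, hp⟩ := Function.ne_iff.1 fun h => hf (Smooth.hext (congrFun h))
    exact ⟨⟨(LinearMap.proj p).comp (smoothSubmodule n).subtype, continuous_eval p⟩, hp⟩

theorem integral_exp_neg_pow_mul (j : ℕ) (k : ℤ) :
    ∫ θ : ℝ in (0)..(2 * Real.pi),
      Complex.exp (k * (θ * Complex.I)) * Complex.exp (-(θ * Complex.I)) ^ j =
      if (j : ℤ) = k then (2 * Real.pi : ℂ) else 0 := by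
  have hexp (θ : ℝ) : Complex.exp (k * (θ * Complex.I)) * Complex.exp (-(θ * Complex.I)) ^ j =
      Complex.exp ((((k - j : ℤ) : ℂ) * Complex.I) * θ) := by
    rw [← Complex.exp_nat_mul, ← Complex.exp_add]
    congr 1
    push_cast
    ring
  simp only [hexp]
  split_ifs with hjk
  · subst hjk
    simp
  · have hne : ((k - j : ℤ) : ℂ) * Complex.I ≠ 0 :=
      mul_ne_zero (Int.cast_ne_zero.2 (by omega)) Complex.I_ne_zero
    have hperiod : ((k - j : ℤ) : ℂ) * Complex.I * ((2 * Real.pi : ℝ) : ℂ) =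
        ((k - j : ℤ) : ℂ) * (2 * Real.pi * Complex.I) := by
      push_cast
      ring
    rw [integral_exp_mul_complex hne, hperiod, Complex.exp_int_mul_two_pi_mul_I]
    simp

theorem eq_zero_of_forall_integral_exp_mul_eq_zero {g : ℝ → ℂ} (hg : Continuous g)
    (hperiod : g 0 = g (2 * Real.pi))
    (h : ∀ k : ℤ, ∫ θ : ℝ in (0)..(2 * Real.pi), Complex.exp (k * (θ * Complex.I)) * g θ = 0) :
    g 0 = 0 := by
  have : Fact (0 < 2 * Real.pi) := ⟨Real.two_pi_pos⟩
  let G : C(AddCircle (2 * Real.pi), ℂ) := ⟨AddCircle.liftIco (2 * Real.pi) 0 g,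
    AddCircle.liftIco_zero_continuous hperiod hg.continuousOn⟩
  have hcoeff : fourierCoeff G = 0 := by
    funext k
    have hexp (θ : ℝ) : fourier (-k) (θ : AddCircle (0 + 2 * Real.pi - 0)) • g θ =
        Complex.exp ((-k : ℤ) * (θ * Complex.I)) * g θ := by
      rw [fourier_coe_apply, smul_eq_mul]
      congr 2
      push_cast
      field_simp
      ring
    refine (fourierCoeff_liftIco_eq g k).trans ?_
    rw [fourierCoeffOn_eq_integral]
    simp only [hexp, zero_add, h, smul_zero, Pi.zero_apply]
  have hsum := has_pointwise_sum_fourier_series_of_summable (f := G)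
    (hcoeff ▸ summable_zero) ((0 : ℝ) : AddCircle (2 * Real.pi))
  simp only [hcoeff, Pi.zero_apply, zero_smul] at hsum
  have hG : G ((0 : ℝ) : AddCircle (2 * Real.pi)) = g 0 :=
    AddCircle.liftIco_zero_coe_apply ⟨le_rfl, Real.two_pi_pos⟩
  rw [← hG, hsum.unique hasSum_zero]

theorem continuous_exp_mul_twist (k : ℤ) (L : StrongDual ℂ (Smooth n)) :
    Continuous fun x : Smooth n × ℝ => Complex.exp (k * (x.2 * Complex.I)) * L (twist x.2 x.1) := by
  have hexp : Continuous fun x : Smooth n × ℝ => Complex.exp (k * (x.2 * Complex.I)) := by fun_prop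
  have htwist : Continuous fun x : Smooth n × ℝ => twist x.2 x.1 :=
    continuous_twist continuous_snd continuous_fst
  have hL : Continuous fun x : Smooth n × ℝ => L (twist x.2 x.1) := L.continuous.comp htwist
  exact hexp.mul hL

theorem intervalIntegrable_exp_mul_twist (k : ℤ) (L : StrongDual ℂ (Smooth n)) (f : Smooth n) :
    IntervalIntegrable (fun θ : ℝ => Complex.exp (k * (θ * Complex.I)) * L (twist θ f))
      MeasureTheory.volume 0 (2 * Real.pi) :=
  ((continuous_exp_mul_twist k L).comp (Continuous.prodMk_right f)).intervalIntegrable _ _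

/-- The `k`-th Fourier coefficient of `θ ↦ L (twist θ f)`, as a functional of `f`. -/
def fourierFunctional (k : ℤ) (L : StrongDual ℂ (Smooth n)) : StrongDual ℂ (Smooth n) where
  toFun f := (2 * Real.pi : ℂ)⁻¹ * ∫ θ : ℝ in (0)..(2 * Real.pi),
    Complex.exp (k * (θ * Complex.I)) * L (twist θ f)
  map_add' f g := by
    rw [← mul_add, ← intervalIntegral.integral_add (intervalIntegrable_exp_mul_twist k L f)
      (intervalIntegrable_exp_mul_twist k L g)]
    simp only [map_add, mul_add]
  map_smul' c f := by
    simp only [map_smul, smul_eq_mul, mul_left_comm _ c, intervalIntegral.integral_const_mul,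
      RingHom.id_apply]
  cont := continuous_const.mul
    (intervalIntegral.continuous_parametric_intervalIntegral_of_continuous'
      (continuous_exp_mul_twist k L) _ _)

theorem fourierFunctional_apply (k : ℤ) (L : StrongDual ℂ (Smooth n)) (f : Smooth n) :
    fourierFunctional k L f = (2 * Real.pi : ℂ)⁻¹ * ∫ θ : ℝ in (0)..(2 * Real.pi),
      Complex.exp (k * (θ * Complex.I)) * L (twist θ f) :=
  rfl

theorem two_pi_ne_zero : (2 * Real.pi : ℂ) ≠ 0 := mod_cast Real.two_pi_pos.ne'

theorem fourierFunctional_realize {j : ℕ} (k : ℤ) (L : StrongDual ℂ (Smooth n)) {F : UTPoly n}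
    (hF : F ∈ level n j) :
    fourierFunctional k L (realize F) = if (j : ℤ) = k then L (realize F) else 0 := by
  have hintegrand (θ : ℝ) : Complex.exp (k * (θ * Complex.I)) * L (twist θ (realize F)) =
      Complex.exp (k * (θ * Complex.I)) * Complex.exp (-(θ * Complex.I)) ^ j * L (realize F) := by
    rw [twist_realize _ hF, map_smul, smul_eq_mul, mul_assoc]
  simp only [fourierFunctional_apply, hintegrand]
  rw [intervalIntegral.integral_mul_const, integral_exp_neg_pow_mul]
  split_ifs
  · rw [inv_mul_cancel_left₀ two_pi_ne_zero]
  · simp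

theorem linearMap_congr_of_level {V : Type*} [AddCommGroup V] [Module ℂ V]
    {f g : UTPoly n →ₗ[ℂ] V} (h : ∀ k, ∀ F ∈ level n k, f F = g F) (F : UTPoly n) : f F = g F := by
  have hle : ⨆ k, level n k ≤ LinearMap.eqLocus f g := iSup_le h
  exact hle (iSup_level n ▸ Submodule.mem_top)

theorem exists_levelProj (n k : ℕ) : ∃ P : Smooth n →L[ℂ] Smooth n,
    (∀ f, P f ∈ (level n k).map realize) ∧
      ∀ j, ∀ F ∈ level n j, P (realize F) = if j = k then realize F else 0 := by
  let W : Submodule ℂ (Smooth n) := (level n k).map realize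
  let b := Module.finBasis ℂ W
  have hdual (i) : ∃ L : StrongDual ℂ (Smooth n), ∀ x : W, L x = b.coord i x := by
    obtain ⟨L, hL⟩ := SeparatingDual.dualMap_surjective_iff.2 W.injective_subtype (b.coord i)
    exact ⟨L, LinearMap.congr_fun hL⟩
  choose L hL using hdual
  refine ⟨∑ i, (fourierFunctional k (L i)).smulRight (b i : Smooth n), fun f => ?_,
    fun j F hF => ?_⟩
  · rw [sum_apply]
    exact Submodule.sum_mem _ fun i _ => Submodule.smul_mem _ _ (b i).2
  · rw [sum_apply]
    simp only [ContinuousLinearMap.smulRight_apply, fourierFunctional_realize _ _ hF, Nat.cast_inj]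
    split_ifs with hjk
    · subst hjk
      have hrepr := congrArg W.subtype (b.sum_repr ⟨realize F, F, hF, rfl⟩)
      rw [map_sum] at hrepr
      refine (Finset.sum_congr rfl fun i _ => ?_).trans hrepr
      rw [hL i ⟨realize F, F, hF, rfl⟩]
      rfl
    · simp

/-- A continuous projection of `C^∞(X)` onto the functions of degree `k`, which kills the
polynomial functions of any other degree. -/
def levelProj (n k : ℕ) : Smooth n →L[ℂ] Smooth n := (exists_levelProj n k).choose

theorem levelProj_mem (k : ℕ) (f : Smooth n) : levelProj n k f ∈ (level n k).map realize :=
  (exists_levelProj n k).choose_spec.1 f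

theorem levelProj_realize {j : ℕ} (k : ℕ) {F : UTPoly n} (hF : F ∈ level n j) :
    levelProj n k (realize F) = if j = k then realize F else 0 :=
  (exists_levelProj n k).choose_spec.2 j F hF

/-- The closure of the space of the functions `x₁^weight F(u, t)` with `F` a polynomial. -/
def hull (n : ℕ) : Submodule ℂ (Smooth n) := (LinearMap.range realize).topologicalClosure

theorem clm_eq_of_mem_hull {Y : Type*} [AddCommGroup Y] [Module ℂ Y] [TopologicalSpace Y]
    [T2Space Y] {S T : Smooth n →L[ℂ] Y}
    (h : ∀ k, ∀ F ∈ level n k, S (realize F) = T (realize F)) {f : Smooth n} (hf : f ∈ hull n) :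
    S f = T f := by
  refine Set.EqOn.closure (s := Set.range realize) ?_ S.continuous T.continuous hf
  rintro _ ⟨F, rfl⟩
  exact linearMap_congr_of_level (f := S.toLinearMap ∘ₗ realize) (g := T.toLinearMap ∘ₗ realize) h F

theorem fourierFunctional_natCast (k : ℕ) (L : StrongDual ℂ (Smooth n)) {f : Smooth n}
    (hf : f ∈ hull n) : fourierFunctional k L f = L (levelProj n k f) := by
  refine clm_eq_of_mem_hull (T := L.comp (levelProj n k)) (fun j F hF => ?_) hf
  rw [fourierFunctional_realize k L hF, ContinuousLinearMap.comp_apply, levelProj_realize k hF,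
    apply_ite L, map_zero]
  simp only [Nat.cast_inj]

theorem fourierFunctional_of_neg {k : ℤ} (hk : k < 0) (L : StrongDual ℂ (Smooth n)) {f : Smooth n}
    (hf : f ∈ hull n) : fourierFunctional k L f = 0 := by
  refine clm_eq_of_mem_hull (T := 0) (fun j F hF => ?_) hf
  rw [fourierFunctional_realize k L hF, if_neg (by omega)]
  rfl

theorem twist_two_pi {f : Smooth n} (hf : f ∈ hull n) : twist (2 * Real.pi) f = f := by
  have : T2Space (Smooth n) := SeparatingDual.t2Space (R := ℂ)
  refine clm_eq_of_mem_hull (T := ContinuousLinearMap.id ℂ _) (fun k F hF => ?_) hf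
  refine (twist_realize _ hF).trans ?_
  have hexp : Complex.exp (-((2 * Real.pi : ℝ) * Complex.I)) = 1 := by
    rw [Complex.exp_neg, Complex.ofReal_mul, Complex.ofReal_ofNat, Complex.exp_two_pi_mul_I,
      inv_one]
  rw [hexp, one_pow, one_smul]
  rfl

theorem exists_strongDual_eq_zero_and_ne_zero {E : Type*} [AddCommGroup E] [Module ℂ E]
    [TopologicalSpace E] [IsTopologicalAddGroup E] [ContinuousSMul ℂ E] [LocallyConvexSpace ℝ E]
    {N : Submodule ℂ E} (hN : IsClosed (N : Set E)) {x : E} (hx : x ∉ N) :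
    ∃ L : StrongDual ℂ E, (∀ y ∈ N, L y = 0) ∧ L x ≠ 0 := by
  obtain ⟨L, c, hLN, hLx⟩ := RCLike.geometric_hahn_banach_closed_point (𝕜 := ℂ)
    (N.restrictScalars ℝ).convex hN hx
  refine ⟨L, fun y hy => ?_, fun hL => ?_⟩
  · by_contra hLy
    have hlt := hLN ((c / L y : ℂ) • y) (N.smul_mem _ hy)
    rw [map_smul, smul_eq_mul, div_mul_cancel₀ _ hLy] at hlt
    exact lt_irrefl c hlt
  · have hc := hLN 0 N.zero_mem
    rw [map_zero] at hc
    rw [hL] at hLx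
    exact lt_asymm hc hLx

theorem mem_of_levelProj_mem {f : Smooth n} (hf : f ∈ hull n) {N : Submodule ℂ (Smooth n)}
    (hN : IsClosed (N : Set (Smooth n))) (h : ∀ k, levelProj n k f ∈ N) : f ∈ N := by
  by_contra hfN
  obtain ⟨L, hLN, hLf⟩ := exists_strongDual_eq_zero_and_ne_zero hN hfN
  have hfourier (k : ℤ) : fourierFunctional k L f = 0 := by
    rcases lt_or_ge k 0 with hk | hk
    · exact fourierFunctional_of_neg hk L hf
    · lift k to ℕ using hk
      rw [fourierFunctional_natCast k L hf]
      exact hLN _ (h k)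
  have htwist : Continuous fun θ : ℝ => twist θ f :=
    continuous_twist continuous_id continuous_const
  have hzero := eq_zero_of_forall_integral_exp_mul_eq_zero (g := fun θ => L (twist θ f))
    (L.continuous.comp htwist)
    (by rw [twist_zero, twist_two_pi hf])
    (fun k => (mul_eq_zero.1 (hfourier k)).resolve_left (inv_ne_zero two_pi_ne_zero))
  rw [twist_zero] at hzero
  exact hLf hzero

end Fourier

/-! ### Energy components of the elements of a submodule -/

section Eigenvectors

theorem map_aeval_apply {R U V : Type*} [CommSemiring R] [AddCommMonoid U] [Module R U]
    [AddCommMonoid V] [Module R V] {S : Module.End R U} {T : Module.End R V} (g : U →ₗ[R] V)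
    (h : ∀ x, g (S x) = T (g x)) (q : Polynomial R) (x : U) :
    g (Polynomial.aeval S q x) = Polynomial.aeval T q (g x) := by
  have hpow (i : ℕ) : g ((S ^ i) x) = (T ^ i) (g x) := by
    rw [Module.End.pow_apply, Module.End.pow_apply]
    exact (Function.Semiconj.iterate_right h i) x
  simp only [Polynomial.aeval_eq_sum_range, LinearMap.sum_apply, LinearMap.smul_apply, map_sum,
    map_smul, hpow]

theorem mem_of_sum_mem_of_apply_eq_smul {K V ι : Type*} [Field K] [AddCommGroup V] [Module K V]
    {T : Module.End K V} {N : Submodule K V} (hN : ∀ x ∈ N, T x ∈ N) {s : Finset ι} {μ : ι → K}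
    (hμ : Set.InjOn μ s) {v : ι → V} (hv : ∀ i ∈ s, T (v i) = μ i • v i) (hsum : ∑ i ∈ s, v i ∈ N)
    {i : ι} (hi : i ∈ s) : v i ∈ N := by
  classical
  have hproj : Polynomial.aeval T (Lagrange.basis s μ i) (∑ j ∈ s, v j) = v i := by
    rw [map_sum, Finset.sum_eq_single_of_mem i hi fun j hj hji => ?_]
    · rw [Module.End.aeval_apply_of_mem_apply_eq_smul (hv i hi), Lagrange.eval_basis_self hμ hi,
        one_smul]
    · rw [Module.End.aeval_apply_of_mem_apply_eq_smul (hv j hj),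
        Lagrange.eval_basis_of_ne hji.symm hj, zero_smul]
  rw [← hproj]
  have h := map_aeval_apply (S := T.restrict hN) (T := T) N.subtype (fun _ => rfl)
    (Lagrange.basis s μ i) ⟨_, hsum⟩
  exact h ▸ Subtype.property _

end Eigenvectors

section Hamiltonian

variable {n : ℕ}

/-- The action of `-i M_{-1,0}`, the generator of `so(2)` whose eigenvalues are the weights `-E`. -/
def hamiltonian (n : ℕ) (V : Type*) [AddCommGroup V] [Module ℂ V] [LieRingModule (𝔤 n) V]
    [LieModule ℂ (𝔤 n) V] : Module.End ℂ V :=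
  (-Complex.I) • LieModule.toEnd ℂ (𝔤 n) V (M (Sum.inl 0) (Sum.inl 1))

theorem hamiltonian_realize (F : UTPoly n) :
    hamiltonian n (Smooth n) (realize F) = realize (energy F) := by
  change (-Complex.I) • ⁅(M (Sum.inl 0) (Sum.inl 1) : 𝔤 n), realize F⁆ = _
  rw [lie_energy, smul_smul, neg_mul, Complex.I_mul_I, neg_neg, one_smul]

theorem map_hamiltonian {V V' : Type*} [AddCommGroup V] [Module ℂ V] [LieRingModule (𝔤 n) V]
    [LieModule ℂ (𝔤 n) V] [AddCommGroup V'] [Module ℂ V'] [LieRingModule (𝔤 n) V']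
    [LieModule ℂ (𝔤 n) V'] (π : V →ₗ⁅ℂ,𝔤 n⁆ V') (v : V) :
    π (hamiltonian n V v) = hamiltonian n V' (π v) :=
  (map_smul π _ _).trans (congrArg _ (LieModuleHom.map_lie π _ _))

theorem weight_sub_injective (n : ℕ) : Function.Injective fun k : ℕ => weight n - (k : ℂ) :=
  sub_right_injective.comp Nat.cast_injective

theorem levelProj_levelProj (j k : ℕ) (f : Smooth n) :
    levelProj n j (levelProj n k f) = if k = j then levelProj n k f else 0 := by
  obtain ⟨F, hF, h⟩ := levelProj_mem k f
  rw [← h, levelProj_realize j hF]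

theorem hamiltonian_levelProj (k : ℕ) (f : Smooth n) :
    hamiltonian n (Smooth n) (levelProj n k f) = (weight n - k) • levelProj n k f := by
  obtain ⟨F, hF, h⟩ := levelProj_mem k f
  rw [← h, hamiltonian_realize, energy_of_mem_level hF, map_smul]

theorem levelProj_hamiltonian (k : ℕ) {f : Smooth n} (hf : f ∈ hull n) :
    levelProj n k (hamiltonian n (Smooth n) f) = (weight n - k) • levelProj n k f := by
  have : T2Space (Smooth n) := SeparatingDual.t2Space (R := ℂ)
  let T : Smooth n →L[ℂ] Smooth n :=
    ⟨hamiltonian n (Smooth n), (continuous_lie (M (Sum.inl 0) (Sum.inl 1))).const_smul _⟩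
  refine clm_eq_of_mem_hull (S := (levelProj n k).comp T) (T := (weight n - k) • levelProj n k)
    (fun j F hF => ?_) hf
  change levelProj n k (hamiltonian n (Smooth n) (realize F)) =
    (weight n - k) • levelProj n k (realize F)
  rw [hamiltonian_realize, energy_of_mem_level hF, map_smul, map_smul, levelProj_realize k hF]
  split_ifs with h
  · rw [h]
  · rw [smul_zero, smul_zero]

theorem exists_sum_levelProj_eq (F : UTPoly n) :
    ∃ s : Finset ℕ, ∑ k ∈ s, levelProj n k (realize F) = realize F := by
  obtain ⟨G, hG, rfl⟩ := (Submodule.mem_iSup_iff_exists_finsupp _ _).1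
    (iSup_level n ▸ Submodule.mem_top : F ∈ ⨆ k, level n k)
  refine ⟨G.support, ?_⟩
  simp only [Finsupp.sum, map_sum]
  rw [Finset.sum_comm]
  refine Finset.sum_congr rfl fun j hj => ?_
  simp only [levelProj_realize _ (hG j), Finset.sum_ite_eq, hj, if_true]

theorem levelProj_mem_of_realize (W : LieSubmodule ℂ (𝔤 n) (Smooth n)) {F : UTPoly n}
    (hF : realize F ∈ W) (k : ℕ) : levelProj n k (realize F) ∈ W := by
  obtain ⟨s, hs⟩ := exists_sum_levelProj_eq F
  by_cases hk : k ∈ s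
  · have hW : ∀ f ∈ W.toSubmodule, hamiltonian n (Smooth n) f ∈ W.toSubmodule := fun f hf =>
      W.smul_mem _ (W.lie_mem hf)
    exact mem_of_sum_mem_of_apply_eq_smul (v := fun j => levelProj n j (realize F)) hW
      (weight_sub_injective n).injOn (fun j _ => hamiltonian_levelProj j _) (hs.symm ▸ hF) hk
  · rw [← hs, map_sum]
    simp only [levelProj_levelProj, Finset.sum_ite_eq', hk, if_false]
    exact W.zero_mem

end Hamiltonian

section ClosedSpan

variable {n : ℕ}

theorem mem_closedSpan_self (φ : Smooth n) : φ ∈ closedSpan φ :=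
  Submodule.le_topologicalClosure _ (LieSubmodule.subset_lieSpan (Set.mem_singleton φ))

theorem isClosed_closedSpan (φ : Smooth n) : IsClosed (closedSpan φ : Set (Smooth n)) :=
  Submodule.isClosed_topologicalClosure _

theorem lieSpan_le_closedSpan (φ : Smooth n) :
    LieSubmodule.lieSpan ℂ (𝔤 n) {φ} ≤ closedSpan φ := fun _ h =>
  Submodule.le_topologicalClosure _ h

theorem closedSpan_le {φ : Smooth n} {N : LieSubmodule ℂ (𝔤 n) (Smooth n)}
    (hN : IsClosed (N : Set (Smooth n))) (h : φ ∈ N) : closedSpan φ ≤ N := fun _ hf =>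
  closure_minimal (LieSubmodule.lieSpan_le.2 (Set.singleton_subset_iff.2 h)) hN hf

theorem closedSpan_le_hull (hn : 0 < n) (F : UTPoly n) :
    (closedSpan (realize F)).toSubmodule ≤ hull n := by
  refine Submodule.topologicalClosure_mono fun f hf => ?_
  obtain ⟨G, -, rfl⟩ := (mem_lieSpan_realize hn).1 hf
  exact ⟨G, rfl⟩

theorem levelProj_mem_lieSpan (hn : 0 < n) {F : UTPoly n} (k : ℕ) {f : Smooth n}
    (hf : f ∈ closedSpan (realize F)) :
    levelProj n k f ∈ LieSubmodule.lieSpan ℂ (𝔤 n) {realize F} := by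
  let A := LieSubmodule.lieSpan ℂ (𝔤 n) {realize F}
  let W : Submodule ℂ (Smooth n) := A.toSubmodule ⊓ (level n k).map realize
  have : T2Space (Smooth n) := SeparatingDual.t2Space (R := ℂ)
  have : FiniteDimensional ℂ W := Submodule.finiteDimensional_of_le inf_le_right
  have hclosure : levelProj n k f ∈ closure (W : Set (Smooth n)) := by
    refine map_mem_closure (levelProj n k).continuous hf fun g hg => ⟨?_, levelProj_mem k g⟩
    obtain ⟨G, -, rfl⟩ := (mem_lieSpan_realize hn).1 hg
    exact levelProj_mem_of_realize A hg k
  rw [W.closed_of_finiteDimensional.closure_eq] at hclosure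
  exact hclosure.1

theorem realize_mem_lieSpan_iff (hn : 0 < n) {F G : UTPoly n} :
    realize G ∈ LieSubmodule.lieSpan ℂ (𝔤 n) {realize F} ↔ G ∈ gen F := by
  rw [mem_lieSpan_realize hn]
  exact ⟨fun ⟨G', hG', h⟩ => realize_injective h ▸ hG', fun h => ⟨G, h, rfl⟩⟩

theorem realize_mem_closedSpan_iff (hn : 0 < n) {F G : UTPoly n} :
    realize G ∈ closedSpan (realize F) ↔ G ∈ gen F := by
  refine ⟨fun h => (realize_mem_lieSpan_iff hn).1 ?_, fun h =>
    lieSpan_le_closedSpan _ ((realize_mem_lieSpan_iff hn).2 h)⟩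
  obtain ⟨s, hs⟩ := exists_sum_levelProj_eq G
  rw [← hs]
  exact Submodule.sum_mem _ fun k _ => levelProj_mem_lieSpan hn k h

end ClosedSpan

/-! ### The generating functions and the Casimir operator -/

section GeneratingFunctions

variable {n : ℕ}

theorem xPow_add (s r : ℂ) (p : Amb n) : xPow (s + r) p = xPow s p * xPow r p := by
  rw [xPow, xPow, xPow, add_mul, Complex.exp_add]

theorem I_div_sqrt_two_ne_zero : Complex.I / ((√2 : ℝ) : ℂ) ≠ 0 := by simp

theorem xPow_neg_one (p : Amb n) :
    xPow (-1) p = (Complex.I / (√2 : ℝ))⁻¹ * Complex.exp (-p.1) := by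
  rw [xPow, logX, neg_one_mul, neg_add, Complex.exp_add, Complex.exp_neg (Complex.log _),
    Complex.exp_log I_div_sqrt_two_ne_zero, mul_comm]

theorem φ₁_eq (n : ℕ) : φ₁ n = realize (vPoly n) := by
  refine Smooth.hext fun p => ?_
  rw [vPoly, map_add, realize_single, realize_single, Smooth.add_apply, mono_apply, mono_apply,
    monoFun, monoFun, map_one, pow_one, mul_one, pow_zero, mul_one, ← mul_add,
    tFun_add_aeval_sumSq]
  change xNeg p.1 * xPow (-(n / 2)) p.1 = _
  rw [show (-(n / 2) : ℂ) = weight n + -1 by rw [weight]; ring, xPow_add, xPow_neg_one, xNeg]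
  field_simp [I_div_sqrt_two_ne_zero]

theorem φ₂_eq (n : ℕ) : φ₂ n = realize (onePoly n) := by
  refine Smooth.hext fun p => ?_
  rw [onePoly, realize_single, mono_apply, monoFun, map_one, pow_zero, mul_one, mul_one]
  rfl

theorem φ₃_eq (n : ℕ) : φ₃ n = (-2 : ℂ) • realize (tPoly n) := by
  refine Smooth.hext fun p => ?_
  rw [tPoly, realize_single, Smooth.smul_apply, mono_apply, monoFun, map_one, pow_one, mul_one]
  change (ysq p.1 : ℂ) * xPow (-((n + 2) / 2)) p.1 = _
  have hsq : ((Complex.I / ((√2 : ℝ) : ℂ))⁻¹) ^ 2 = -2 := by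
    rw [inv_pow, div_pow, Complex.I_sq, ← Complex.ofReal_pow, Real.sq_sqrt zero_le_two]
    norm_num
  rw [show (-((n + 2) / 2) : ℂ) = weight n + -1 + -1 by rw [weight]; ring, xPow_add, xPow_add,
    xPow_neg_one, tFun, ← hsq]
  ring

theorem φ₃_ne_zero (n : ℕ) : φ₃ n ≠ 0 := by
  rw [φ₃_eq]
  refine smul_ne_zero (by norm_num) fun h => ?_
  exact (Finsupp.single_ne_zero.2 one_ne_zero : tPoly n ≠ 0)
    (realize_injective (h.trans (map_zero realize).symm))

theorem lieSpan_smul {c : ℂ} (hc : c ≠ 0) (f : Smooth n) :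
    LieSubmodule.lieSpan ℂ (𝔤 n) {c • f} = LieSubmodule.lieSpan ℂ (𝔤 n) {f} := by
  have hmem : ∀ N : LieSubmodule ℂ (𝔤 n) (Smooth n), c • f ∈ N ↔ f ∈ N := fun N =>
    N.toSubmodule.smul_mem_iff hc
  refine le_antisymm (LieSubmodule.lieSpan_le.2 (Set.singleton_subset_iff.2 ?_))
    (LieSubmodule.lieSpan_le.2 (Set.singleton_subset_iff.2 ?_))
  · exact (hmem _).2 (LieSubmodule.subset_lieSpan rfl)
  · exact (hmem _).1 (LieSubmodule.subset_lieSpan rfl)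

theorem H₁_eq (n : ℕ) : H₁ n = closedSpan (realize (vPoly n)) := by rw [H₁, φ₁_eq]

theorem H₂_eq (n : ℕ) : H₂ n = closedSpan (realize (onePoly n)) := by rw [H₂, φ₂_eq]

theorem H₃_eq (n : ℕ) : H₃ n = closedSpan (realize (tPoly n)) := by
  rw [H₃, φ₃_eq, closedSpan, closedSpan, lieSpan_smul (by norm_num)]

theorem onePoly_mem_level (n : ℕ) : onePoly n ∈ level n 0 := by
  rw [onePoly]
  exact single_mem_level (r := 0) (by norm_num) (isHomogeneous_one _ _)

theorem tPoly_mem_level (n : ℕ) : tPoly n ∈ level n 2 := by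
  rw [tPoly]
  exact single_mem_level (r := 0) (by norm_num) (isHomogeneous_one _ _)

theorem vPoly_mem_level (n : ℕ) : vPoly n ∈ level n 2 := by
  rw [vPoly]
  exact Submodule.add_mem _ (tPoly_mem_level n)
    (single_mem_level (r := 2) (by norm_num) isHomogeneous_sumSq)

theorem raise_onePoly (k : Fin n) : raise k (onePoly n) = 0 := by
  rw [onePoly, raise_single, pderiv_one, Finsupp.single_zero]

theorem raise_tPoly (k : Fin n) : raise k (tPoly n) = 0 := by
  rw [tPoly, raise_single, pderiv_one, Finsupp.single_zero]

theorem raise_vPoly (k : Fin n) : raise k (vPoly n) = Finsupp.single 0 (2 * X k) := by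
  rw [vPoly, map_add, raise_single, raise_single, pderiv_one, Finsupp.single_zero, zero_add,
    pderiv_sumSq]

theorem angular_onePoly (j k : Fin n) : angular j k (onePoly n) = 0 := by
  simp [onePoly, angular_single]

theorem angular_tPoly (j k : Fin n) : angular j k (tPoly n) = 0 := by
  simp [tPoly, angular_single]

theorem angular_vPoly (j k : Fin n) : angular j k (vPoly n) = 0 := by
  rw [vPoly, map_add, angular_single, angular_single, pderiv_sumSq, pderiv_sumSq,
    show (X j * (2 * X k) - X k * (2 * X j) : UPoly n) = 0 by ring]
  simp

theorem lower_raise_vPoly (k : Fin n) : lower k (raise k (vPoly n)) =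
    Finsupp.single 1 2 + Finsupp.single 0 (2 * sumSq + C (4 * (weight n - 1)) * X k ^ 2) := by
  have hpderiv : pderiv k (2 * X k : UPoly n) = 2 := by
    rw [two_mul, map_add, pderiv_X_self, one_add_one_eq_two]
  have heuler : euler (2 * X k : UPoly n) = 2 * X k := by rw [two_mul, map_add, euler_X]
  rw [raise_vPoly, lower_single, conformal_apply, hpderiv, heuler, Nat.cast_zero, mul_zero,
    sub_zero]
  congr 2
  simp only [smul_eq_C_mul, map_mul, map_sub, map_one, map_ofNat]
  ring

theorem sum_lower_raise_vPoly : ∑ k, lower k (raise k (vPoly n)) = (2 * n : ℂ) • tPoly n := by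
  have hcancel : 2 * ((n : UPoly n) * sumSq) + C (4 * (weight n - 1)) * sumSq = 0 := by
    rw [show 4 * (weight n - 1) = -(2 * n : ℂ) by rw [weight]; ring]
    simp only [map_neg, map_mul, map_natCast, map_ofNat]
    ring
  simp only [lower_raise_vPoly, Finset.sum_add_distrib, ← Finsupp.single_finsetSum,
    ← Finset.mul_sum, Finset.sum_const, Finset.card_univ, Fintype.card_fin, nsmul_eq_mul]
  rw [← sumSq, hcancel, Finsupp.single_zero, add_zero, tPoly, Finsupp.smul_single,
    Finsupp.smul_single]
  congr 1
  simp only [smul_eq_C_mul, map_mul, map_natCast, map_ofNat, nsmul_eq_mul]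
  ring

end GeneratingFunctions

section Casimir

variable {n : ℕ}

theorem casimir_eq {V : Type*} [AddCommGroup V] [Module ℂ V] [LieRingModule (𝔤 n) V] (v : V) :
    casimir n v =
      -⁅(M (Sum.inl 0) (Sum.inl 1) : 𝔤 n), ⁅(M (Sum.inl 0) (Sum.inl 1) : 𝔤 n), v⁆⁆ +
      ∑ k, (⁅(M (Sum.inl 0) (Sum.inr k) : 𝔤 n), ⁅(M (Sum.inl 0) (Sum.inr k) : 𝔤 n), v⁆⁆ +
        ⁅(M (Sum.inl 1) (Sum.inr k) : 𝔤 n), ⁅(M (Sum.inl 1) (Sum.inr k) : 𝔤 n), v⁆⁆) -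
      (1 / 2 : ℂ) • ∑ j, ∑ k,
        ⁅(M (Sum.inr j) (Sum.inr k) : 𝔤 n), ⁅(M (Sum.inr j) (Sum.inr k) : 𝔤 n), v⁆⁆ := by
  have hswap (a b : Idx n) : ⁅(M b a : 𝔤 n), ⁅(M b a : 𝔤 n), v⁆⁆ =
      ⁅(M a b : 𝔤 n), ⁅(M a b : 𝔤 n), v⁆⁆ := by
    rw [M_swap a b, neg_lie, neg_lie, lie_neg, neg_neg]
  rw [casimir]
  simp only [Fintype.sum_sum_type, Fin.sum_univ_two, M_self, zero_lie, eta, Sum.elim_inl,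
    Sum.elim_inr, hswap (Sum.inl 0) (Sum.inl 1), hswap (Sum.inl _) (Sum.inr _), mul_one, mul_neg,
    Complex.ofReal_one, Complex.ofReal_neg, one_smul, neg_smul, Finset.sum_neg_distrib,
    Finset.sum_add_distrib]
  module

theorem lie_boost_lie_boost_add (k : Fin n) (F : UTPoly n) :
    ⁅(M (Sum.inl 0) (Sum.inr k) : 𝔤 n), ⁅(M (Sum.inl 0) (Sum.inr k) : 𝔤 n), realize F⁆⁆ +
      ⁅(M (Sum.inl 1) (Sum.inr k) : 𝔤 n), ⁅(M (Sum.inl 1) (Sum.inr k) : 𝔤 n), realize F⁆⁆ =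
    realize (energy F + lower k (raise k F)) := by
  have henergy : energy F = (1 / 2 : ℂ) • (raise k (lower k F) - lower k (raise k F)) := by
    rw [← two_smul_energy k F, smul_smul, one_div_mul_cancel two_ne_zero, one_smul]
  rw [lie_boost_zero, lie_boost_zero, lie_boost_one, lie_boost_one, ← map_add]
  congr 1
  rw [henergy]
  simp only [map_smul, map_add, map_sub]
  match_scalars <;> ring_nf <;> norm_num

theorem casimir_realize (F : UTPoly n) : casimir n (realize F) =
    realize (energy (energy F) + (n : ℂ) • energy F + ∑ k, lower k (raise k F) -
      (1 / 2 : ℂ) • ∑ j, ∑ k, angular j k (angular j k F)) := by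
  rw [casimir_eq]
  simp only [lie_boost_lie_boost_add, lie_energy, lie_angular, lie_smul, lie_neg, neg_neg,
    Finset.sum_add_distrib, map_add, map_sub, map_smul, map_sum, smul_smul, Complex.I_mul_I,
    map_nsmul, Finset.sum_const, Finset.card_univ, Fintype.card_fin, neg_one_smul,
    Nat.cast_smul_eq_nsmul]
  abel

theorem casimir_realize_of_mem_level {m : ℕ} {F : UTPoly n} (hF : F ∈ level n m)
    (hang : ∀ j k, angular j k F = 0) : casimir n (realize F) =
      ((weight n - m) * (weight n - m + n)) • realize F + realize (∑ k, lower k (raise k F)) := by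
  rw [casimir_realize, energy_of_mem_level hF, map_smul, energy_of_mem_level hF]
  simp only [hang, map_zero, Finset.sum_const_zero, smul_zero, sub_zero, map_add, map_smul]
  module

theorem shiftedCasimir_realize_of_mem_level {m : ℕ} (hm : m = 0 ∨ m = 2) {F : UTPoly n}
    (hF : F ∈ level n m) (hang : ∀ j k, angular j k F = 0) :
    shiftedCasimir n (realize F) = realize (∑ k, lower k (raise k F)) := by
  have hcoeff : (weight n - m) * (weight n - m + n) + (((n - 2) * (n + 2) / 4 : ℝ) : ℂ) = 0 := by
    rcases hm with rfl | rfl <;> rw [weight] <;> push_cast <;> ring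
  rw [shiftedCasimir, casimir_realize_of_mem_level hF hang, add_right_comm, ← add_smul, hcoeff,
    zero_smul, zero_add]

theorem shiftedCasimir_smul {V : Type*} [AddCommGroup V] [Module ℂ V] [LieRingModule (𝔤 n) V]
    [LieModule ℂ (𝔤 n) V] (c : ℂ) (v : V) :
    shiftedCasimir n (c • v) = c • shiftedCasimir n v := by
  simp only [shiftedCasimir, casimir, lie_smul, smul_comm _ c, ← Finset.smul_sum, smul_add]

theorem shiftedCasimir_φ₁ (n : ℕ) : shiftedCasimir n (φ₁ n) = -(n : ℂ) • φ₃ n := by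
  rw [φ₁_eq, shiftedCasimir_realize_of_mem_level (.inr rfl) (vPoly_mem_level n) angular_vPoly,
    sum_lower_raise_vPoly, φ₃_eq, map_smul, smul_smul]
  congr 1
  ring

theorem shiftedCasimir_φ₂ (n : ℕ) : shiftedCasimir n (φ₂ n) = 0 := by
  rw [φ₂_eq, shiftedCasimir_realize_of_mem_level (.inl rfl) (onePoly_mem_level n) angular_onePoly]
  simp only [raise_onePoly, map_zero, Finset.sum_const_zero]

theorem shiftedCasimir_φ₃ (n : ℕ) : shiftedCasimir n (φ₃ n) = 0 := by
  rw [φ₃_eq, shiftedCasimir_smul,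
    shiftedCasimir_realize_of_mem_level (.inr rfl) (tPoly_mem_level n) angular_tPoly]
  simp only [raise_tPoly, map_zero, Finset.sum_const_zero, smul_zero]

end Casimir

/-! ### Finiteness under the compact subalgebra -/

section KFinite

variable {n : ℕ}

theorem lie_mem_map_level {k : ℕ} {A : 𝔤 n} (hA : IsCompactElt A) {f : Smooth n}
    (hf : f ∈ (level n k).map realize) : ⁅A, f⁆ ∈ (level n k).map realize := by
  obtain ⟨F, hF, rfl⟩ := hf
  refine lie_mem_of_isCompactElt ?_ (fun i j => ?_) hA
  · rw [lie_energy, energy_of_mem_level hF, ← map_smul]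
    exact ⟨_, Submodule.smul_mem _ _ (Submodule.smul_mem _ _ hF), rfl⟩
  · rw [lie_angular, ← map_neg]
    exact ⟨_, Submodule.neg_mem _ (angular_mem_level i j hF), rfl⟩

theorem isKFinite_realize (F : UTPoly n) : IsKFinite n (realize F) := by
  obtain ⟨s, hs⟩ := exists_sum_levelProj_eq F
  let W : Submodule ℂ (Smooth n) := ⨆ k : s, (level n k).map realize
  refine ⟨W, inferInstance, ?_, fun A hA w hw => ?_⟩
  · rw [← hs]
    exact Submodule.sum_mem _ fun k hk =>
      Submodule.mem_iSup_of_mem (⟨k, hk⟩ : s) (levelProj_mem k _)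
  · have hstable : W ≤ W.comap (LieModule.toEnd ℂ (𝔤 n) (Smooth n) A) :=
      iSup_le fun k _ hw => Submodule.mem_iSup_of_mem k (lie_mem_map_level hA hw)
    exact hstable hw

variable {V V' : Type*} [AddCommGroup V] [Module ℂ V] [LieRingModule (𝔤 n) V] [AddCommGroup V']
  [Module ℂ V'] [LieRingModule (𝔤 n) V']

theorem IsKFinite.map {v : V} (h : IsKFinite n v) (π : V →ₗ⁅ℂ,𝔤 n⁆ V') : IsKFinite n (π v) := by
  obtain ⟨W, hW, hv, hstable⟩ := h
  refine ⟨W.map (π : V →ₗ[ℂ] V'), inferInstance, ⟨v, hv, rfl⟩, ?_⟩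
  rintro A hA _ ⟨w, hw, rfl⟩
  exact ⟨_, hstable A hA w hw, LieModuleHom.map_lie π A w⟩

theorem IsKFinite.restrict {H : LieSubmodule ℂ (𝔤 n) V} {v : H} (h : IsKFinite n (v : V)) :
    IsKFinite n v := by
  obtain ⟨W, hW, hv, hstable⟩ := h
  refine ⟨W.comap H.toSubmodule.subtype, ?_, hv, fun A hA w hw => hstable A hA _ hw⟩
  exact Module.Finite.of_injective (H.toSubmodule.subtype.submoduleComap W)
    fun x y hxy => Subtype.ext (Subtype.ext (congrArg W.subtype hxy))

theorem IsKFinite.exists_aeval_hamiltonian_eq_zero [LieModule ℂ (𝔤 n) V] {v : V}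
    (h : IsKFinite n v) :
    ∃ q : Polynomial ℂ, q ≠ 0 ∧ Polynomial.aeval (hamiltonian n V) q v = 0 := by
  obtain ⟨W, hW, hv, hstable⟩ := h
  have hcompact : IsCompactElt (M (Sum.inl 0) (Sum.inl 1) : 𝔤 n) := fun i j => by
    constructor <;> simp [M]
  let S : Module.End ℂ W := (hamiltonian n V).restrict fun w hw =>
    W.smul_mem (-Complex.I) (hstable _ hcompact w hw)
  refine ⟨S.charpoly, S.charpoly_monic.ne_zero, ?_⟩
  have h := map_aeval_apply (S := S) (T := hamiltonian n V) W.subtype (fun _ => rfl) S.charpoly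
    ⟨v, hv⟩
  rw [LinearMap.aeval_self_charpoly] at h
  exact h.symm

end KFinite

/-! ### Equivariant images of closed cyclic submodules -/

section Carries

variable {n : ℕ} {F₀ : UTPoly n} {N : LieSubmodule ℂ (𝔤 n) (Smooth n)}

/-- A closed submodule of `C^∞(X)` that contains the energy components of its elements, as far as
these lie in the closure of the polynomial functions, where the components are defined. -/
structure IsGraded (N : LieSubmodule ℂ (𝔤 n) (Smooth n)) : Prop where
  isClosed : IsClosed (N : Set (Smooth n))
  levelProj_mem : ∀ f ∈ N, f ∈ hull n → ∀ k, levelProj n k f ∈ N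

theorem isGraded_closedSpan_realize (hn : 0 < n) (F : UTPoly n) :
    IsGraded (closedSpan (realize F)) where
  isClosed := isClosed_closedSpan _
  levelProj_mem _ hf _ k := lieSpan_le_closedSpan _ (levelProj_mem_lieSpan hn k hf)

theorem sub_sum_levelProj_mem (hN : IsClosed (N : Set (Smooth n))) {f : Smooth n}
    (hf : f ∈ hull n) {s : Finset ℕ} (h : ∀ k ∉ s, levelProj n k f ∈ N) :
    f - ∑ k ∈ s, levelProj n k f ∈ N := by
  have hlevel (k : ℕ) : levelProj n k f ∈ hull n :=
    Submodule.le_topologicalClosure _ (LinearMap.map_le_range (levelProj_mem k f))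
  refine mem_of_levelProj_mem (N := N.toSubmodule)
    (Submodule.sub_mem _ hf (Submodule.sum_mem _ fun k _ => hlevel k)) hN fun k => ?_
  simp only [map_sub, map_sum, levelProj_levelProj, Finset.sum_ite_eq']
  split_ifs with hk
  · rw [sub_self]
    exact N.zero_mem
  · rw [sub_zero]
    exact h k hk

theorem levelProj_aeval_hamiltonian {H : LieSubmodule ℂ (𝔤 n) (Smooth n)}
    (hH : H.toSubmodule ≤ hull n) (k : ℕ) (q : Polynomial ℂ) (f : H) :
    levelProj n k (Polynomial.aeval (hamiltonian n H) q f : H) =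
      q.eval (weight n - k) • levelProj n k f := by
  have h := map_aeval_apply (S := hamiltonian n H)
    (T := algebraMap ℂ (Module.End ℂ (Smooth n)) (weight n - k))
    ((levelProj n k).toLinearMap ∘ₗ H.toSubmodule.subtype)
    (fun x => levelProj_hamiltonian k (hH x.2)) q f
  rw [Polynomial.aeval_algebraMap_apply_eq_algebraMap_eval] at h
  exact h

variable {V : Type*} [AddCommGroup V] [Module ℂ V] [LieRingModule (𝔤 n) V]

theorem mem_of_mem_lieSpan {H : LieSubmodule ℂ (𝔤 n) (Smooth n)} (π : H →ₗ⁅ℂ,𝔤 n⁆ V)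
    {W : LieSubmodule ℂ (𝔤 n) V} {f g : H} (hf : π f ∈ W)
    (hg : (g : Smooth n) ∈ LieSubmodule.lieSpan ℂ (𝔤 n) {(f : Smooth n)}) : π g ∈ W := by
  have hspan : LieSubmodule.lieSpan ℂ (𝔤 n) {(f : Smooth n)} ≤ (W.comap π).map H.incl :=
    LieSubmodule.lieSpan_le.2 (Set.singleton_subset_iff.2 ((LieSubmodule.mem_map _).2 ⟨f, hf, rfl⟩))
  obtain ⟨g', hg', h⟩ := (LieSubmodule.mem_map _).1 (hspan hg)
  rwa [← Subtype.ext (a1 := g') (a2 := g) h]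

variable {π : closedSpan (realize F₀) →ₗ⁅ℂ,𝔤 n⁆ V}

theorem isKFinite_map_realize {F : UTPoly n} (h : realize F ∈ closedSpan (realize F₀)) :
    IsKFinite n (π ⟨realize F, h⟩) :=
  (IsKFinite.restrict (v := ⟨realize F, h⟩) (isKFinite_realize F)).map π

theorem dense_isKFinite (hn : 0 < n) [TopologicalSpace V] (hc : Continuous π)
    (hs : Function.Surjective π) : Dense {v : V | IsKFinite n v} := by
  have hdense : Dense {f : closedSpan (realize F₀) |
      (f : Smooth n) ∈ LieSubmodule.lieSpan ℂ (𝔤 n) {realize F₀}} := fun f => by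
    rw [closure_subtype]
    have hf : (f : Smooth n) ∈
      closure (LieSubmodule.lieSpan ℂ (𝔤 n) {realize F₀} : Set (Smooth n)) := f.2
    refine closure_mono (fun g hg => ?_) hf
    exact ⟨⟨g, lieSpan_le_closedSpan _ hg⟩, hg, rfl⟩
  refine (hs.denseRange.dense_image hc hdense).mono ?_
  rintro _ ⟨⟨f, hf'⟩, hf, rfl⟩
  obtain ⟨F, -, rfl⟩ := (mem_lieSpan_realize hn).1 hf
  exact isKFinite_map_realize hf'

variable [LieModule ℂ (𝔤 n) V]

theorem IsKFinite.exists_mem_gen (hn : 0 < n) (hN : IsGraded N) (hs : Function.Surjective π)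
    (hk : ∀ f, π f = 0 ↔ (f : Smooth n) ∈ N) {v : V} (hv : IsKFinite n v) :
    ∃ F ∈ gen F₀, ∃ h : realize F ∈ closedSpan (realize F₀), π ⟨realize F, h⟩ = v := by
  obtain ⟨q, hq, hqv⟩ := hv.exists_aeval_hamiltonian_eq_zero
  obtain ⟨f, rfl⟩ := hs v
  have hhull := closedSpan_le_hull hn F₀
  have hmem : (Polynomial.aeval (hamiltonian n (closedSpan (realize F₀))) q f : Smooth n) ∈ N := by
    rw [← hk, ← hqv]
    exact map_aeval_apply (π : closedSpan (realize F₀) →ₗ[ℂ] V) (map_hamiltonian π) q f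
  have heval (k : ℕ) : q.eval (weight n - k) • levelProj n k f ∈ N := by
    rw [← levelProj_aeval_hamiltonian hhull]
    exact hN.levelProj_mem _ hmem (hhull (Subtype.property _)) k
  have hfin : {k : ℕ | q.eval (weight n - k) = 0}.Finite :=
    (q.finite_setOfPred_isRoot hq).preimage (weight_sub_injective n).injOn
  have hsum := Submodule.sum_mem (LieSubmodule.lieSpan ℂ (𝔤 n) {realize F₀}).toSubmodule
    fun k (_ : k ∈ hfin.toFinset) => levelProj_mem_lieSpan hn k f.2
  obtain ⟨F, hF, hFsum⟩ := (mem_lieSpan_realize hn).1 hsum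
  refine ⟨F, hF, (realize_mem_closedSpan_iff hn).2 hF, ?_⟩
  rw [eq_comm, ← sub_eq_zero, ← map_sub, hk]
  change (f : Smooth n) - realize F ∈ N
  rw [hFsum]
  refine sub_sum_levelProj_mem hN.isClosed (hhull f.2) fun k hk => ?_
  exact (Submodule.smul_mem_iff N.toSubmodule fun h => hk (hfin.mem_toFinset.2 h)).1 (heval k)

theorem eq_bot_or_forall_isKFinite_mem (hn : 0 < n) (hN : IsGraded N)
    (hirr : ∀ F ∈ gen F₀, realize F ∉ N → ∃ G ∈ gen F, realize (G - F₀) ∈ N)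
    (hs : Function.Surjective π) (hk : ∀ f, π f = 0 ↔ (f : Smooth n) ∈ N)
    {W : LieSubmodule ℂ (𝔤 n) V} (hW : ∀ w ∈ W, IsKFinite n w) :
    W = ⊥ ∨ ∀ v : V, IsKFinite n v → v ∈ W := by
  refine or_iff_not_imp_left.2 fun hbot v hv => ?_
  obtain ⟨w, hw, hw0⟩ := W.toSubmodule.exists_mem_ne_zero_of_ne_bot fun h =>
    hbot ((LieSubmodule.toSubmodule_eq_bot W).1 h)
  obtain ⟨F, hF, hFmem, rfl⟩ := (hW w hw).exists_mem_gen hn hN hs hk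
  obtain ⟨G, hG, hGF⟩ := hirr F hF fun h => hw0 ((hk _).2 h)
  have hGmem : realize G ∈ closedSpan (realize F₀) :=
    (realize_mem_closedSpan_iff hn).2 (gen_le (isStable_gen F₀) hF hG)
  have hGW : π ⟨realize G, hGmem⟩ ∈ W :=
    mem_of_mem_lieSpan π hw ((realize_mem_lieSpan_iff hn).2 hG)
  have hF₀ : π ⟨realize G, hGmem⟩ = π ⟨realize F₀, mem_closedSpan_self _⟩ := by
    rw [← sub_eq_zero, ← map_sub, hk]
    rw [map_sub] at hGF
    exact hGF
  rw [hF₀] at hGW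
  obtain ⟨F', hF', hmem', rfl⟩ := hv.exists_mem_gen hn hN hs hk
  exact mem_of_mem_lieSpan π hGW ((realize_mem_lieSpan_iff hn).2 hF')

theorem isHighestWeightVector_map_realize {m : ℕ} (hm : F₀ ∈ level n m)
    (hang : ∀ j k, angular j k F₀ = 0) (h0 : realize F₀ ∉ N)
    (hraise : ∀ k, realize (raise k F₀) ∈ N) (hk : ∀ f, π f = 0 ↔ (f : Smooth n) ∈ N) {E : ℝ}
    (hE : (E : ℂ) = m - weight n) :
    IsHighestWeightVector n E (π ⟨realize F₀, mem_closedSpan_self _⟩) := by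
  refine ⟨fun h => h0 ((hk _).1 h), ?_, fun j k => ?_, fun k => ?_⟩
  · change hamiltonian n V _ = _
    rw [← map_hamiltonian, ← map_smul]
    congr 1
    refine Subtype.ext ?_
    change hamiltonian n (Smooth n) (realize F₀) = -(E : ℂ) • realize F₀
    rw [hamiltonian_realize, energy_of_mem_level hm, map_smul, hE, neg_sub]
  · rw [← LieModuleHom.map_lie, hk]
    change ⁅(M (Sum.inr j) (Sum.inr k) : 𝔤 n), realize F₀⁆ ∈ N
    rw [lie_angular, hang, map_zero, neg_zero]
    exact N.zero_mem
  · rw [← LieModuleHom.map_lie, ← LieModuleHom.map_lie, ← map_smul, ← map_add, hk]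
    change ⁅(M (Sum.inl 0) (Sum.inr k) : 𝔤 n), realize F₀⁆ +
      Complex.I • ⁅(M (Sum.inl 1) (Sum.inr k) : 𝔤 n), realize F₀⁆ ∈ N
    rw [lie_raise]
    exact hraise k

theorem carries_of_isGraded (hn : 0 < n) {m : ℕ} (hm : F₀ ∈ level n m)
    (hang : ∀ j k, angular j k F₀ = 0) {H : LieSubmodule ℂ (𝔤 n) (Smooth n)}
    (hH : H = closedSpan (realize F₀)) (hN : IsGraded N) (h0 : realize F₀ ∉ N)
    (hraise : ∀ k, realize (raise k F₀) ∈ N)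
    (hirr : ∀ F ∈ gen F₀, realize F ∉ N → ∃ G ∈ gen F, realize (G - F₀) ∈ N)
    [TopologicalSpace V] {π : H →ₗ⁅ℂ,𝔤 n⁆ V} (hc : Continuous π) (hs : Function.Surjective π)
    (hk : ∀ f, π f = 0 ↔ (f : Smooth n) ∈ N) {E : ℝ} (hE : (E : ℂ) = m - weight n) :
    Carries n V E := by
  subst hH
  exact ⟨dense_isKFinite hn hc hs,
    fun _ hW => eq_bot_or_forall_isKFinite_mem hn hN hirr hs hk hW,
    _, isKFinite_map_realize _, isHighestWeightVector_map_realize hm hang h0 hraise hk hE⟩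

end Carries

/-! ### Functions vanishing on the cone -/

section Cone

variable {n : ℕ}

theorem isClosed_coneIdeal (n : ℕ) : IsClosed (coneIdeal n : Set (Smooth n)) := by
  have hinter : (coneIdeal n : Set (Smooth n)) =
      ⋂ p : cov n, ⋂ _ : ysq p.1 = 0, {f | f p = 0} := by
    ext f
    simp only [Set.mem_iInter]
    rfl
  rw [hinter]
  exact isClosed_iInter fun p => isClosed_iInter fun _ =>
    isClosed_eq (continuous_eval p) continuous_const

theorem levelProj_mem_coneIdeal {f : Smooth n} (hf : f ∈ coneIdeal n) (hhull : f ∈ hull n)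
    (k : ℕ) : levelProj n k f ∈ coneIdeal n := fun p hp => by
  let L : StrongDual ℂ (Smooth n) := ⟨⟨⟨fun g => g p, fun _ _ => rfl⟩, fun _ _ => rfl⟩,
    continuous_eval p⟩
  have hrot (θ : ℝ) : rot θ f p = 0 := (rot_apply θ f p).trans (hf _ ((ysq_rotPt θ p.1).trans hp))
  have htwist (θ : ℝ) : L (twist θ f) = 0 := by
    rw [twist_apply, map_smul]
    exact smul_eq_zero_of_right _ (hrot θ)
  have hfourier := fourierFunctional_natCast k L hhull
  simp only [fourierFunctional_apply, htwist, mul_zero, intervalIntegral.integral_zero] at hfourier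
  exact hfourier.symm

theorem isGraded_coneIdeal (n : ℕ) : IsGraded (coneIdeal n) :=
  ⟨isClosed_coneIdeal n, fun _ => levelProj_mem_coneIdeal⟩

theorem realize_tPoly_mem_coneIdeal (n : ℕ) : realize (tPoly n) ∈ coneIdeal n := fun p hp => by
  rw [tPoly, realize_single, mono_apply, monoFun, tFun, hp]
  simp

theorem H₃_le_coneIdeal (n : ℕ) : H₃ n ≤ coneIdeal n := by
  rw [H₃_eq]
  exact closedSpan_le (isClosed_coneIdeal n) (realize_tPoly_mem_coneIdeal n)

theorem φ₂_notMem_coneIdeal (hn : 0 < n) : φ₂ n ∉ coneIdeal n := fun h => by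
  let y : EuclideanSpace ℝ (Fin n) := EuclideanSpace.single ⟨0, hn⟩ 1
  have hy : ysq ((0, y) : Amb n) = 0 := by simp [ysq_eq, y]
  exact Complex.exp_ne_zero _ (h ⟨(0, y), (mem_cov_iff _).2 hy.ge⟩ hy)

theorem tendsto_zero_of_mem_coneIdeal {f : Smooth n} (hf : f ∈ coneIdeal n) {p : cov n}
    (hp : ysq p.1 = 0) (s : Set (cov n)) : Filter.Tendsto f (nhdsWithin p s) (nhds 0) := by
  have hcont : Continuous fun q : cov n => f q := (toC n f).continuous
  rw [← hf p hp]
  exact (hcont.tendsto p).mono_left nhdsWithin_le_nhds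

end Cone

/-! ### The chain of submodules -/

section Chain

variable {n : ℕ}

theorem H₂_lt_H₁ (hn : 3 ≤ n) : H₂ n < H₁ n := by
  rw [H₁_eq, H₂_eq]
  refine lt_of_le_not_ge (closedSpan_le (isClosed_closedSpan _) ?_) fun h => ?_
  · exact (realize_mem_closedSpan_iff (by omega)).2 (onePoly_mem_gen_vPoly hn)
  · have hv := h (mem_closedSpan_self _)
    rw [realize_mem_closedSpan_iff (by omega), gen_onePoly hn, LinearMap.mem_ker, wave_vPoly] at hv
    refine smul_ne_zero (mul_ne_zero two_ne_zero (Nat.cast_ne_zero.2 (by omega))) ?_ hv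
    exact Finsupp.single_ne_zero.2 one_ne_zero

theorem H₃_lt_H₂ (hn : 3 ≤ n) : H₃ n < H₂ n := by
  refine lt_of_le_not_ge ?_ fun h => φ₂_notMem_coneIdeal (by omega)
    (H₃_le_coneIdeal n (h (mem_closedSpan_self (φ₂ n))))
  rw [H₂_eq, H₃_eq]
  exact closedSpan_le (isClosed_closedSpan _)
    ((realize_mem_closedSpan_iff (by omega)).2 (tPoly_mem_gen_onePoly hn))

theorem realize_mem_H₂_iff (hn : 0 < n) {F : UTPoly n} :
    realize F ∈ H₂ n ↔ F ∈ gen (onePoly n) := by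
  rw [H₂_eq, realize_mem_closedSpan_iff hn]

theorem realize_mem_H₃_iff (hn : 0 < n) {F : UTPoly n} :
    realize F ∈ H₃ n ↔ F ∈ gen (tPoly n) := by
  rw [H₃_eq, realize_mem_closedSpan_iff hn]

theorem isGraded_H₂ (hn : 0 < n) : IsGraded (H₂ n) := H₂_eq n ▸ isGraded_closedSpan_realize hn _

theorem isGraded_H₃ (hn : 0 < n) : IsGraded (H₃ n) := H₃_eq n ▸ isGraded_closedSpan_realize hn _

theorem isGraded_bot (n : ℕ) : IsGraded (⊥ : LieSubmodule ℂ (𝔤 n) (Smooth n)) where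
  isClosed := by
    have : T2Space (Smooth n) := SeparatingDual.t2Space (R := ℂ)
    rw [LieSubmodule.bot_coe]
    exact isClosed_singleton
  levelProj_mem f hf _ k := by
    rw [(LieSubmodule.mem_bot f).1 hf, map_zero]
    exact LieSubmodule.zero_mem _

theorem exists_mem_gen_realize_sub_onePoly_mem_H₃ (hn : 3 ≤ n) {F : UTPoly n}
    (hF : F ∈ gen (onePoly n)) (h0 : realize F ∉ H₃ n) :
    ∃ G ∈ gen F, realize (G - onePoly n) ∈ H₃ n := by
  have hn0 : 0 < n := by omega
  simp only [realize_mem_H₃_iff hn0] at h0 ⊢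
  exact exists_mem_gen_sub_onePoly hn hF h0

theorem mem_coneIdeal_iff_mem_H₃ (hn : 3 ≤ n) {f : Smooth n} (hf : f ∈ H₂ n) :
    f ∈ coneIdeal n ↔ f ∈ H₃ n := by
  refine ⟨fun hcone => ?_, fun h => H₃_le_coneIdeal n h⟩
  have hn0 : 0 < n := by omega
  have hhull : f ∈ hull n := closedSpan_le_hull hn0 (onePoly n) (H₂_eq n ▸ hf)
  refine mem_of_levelProj_mem (N := (H₃ n).toSubmodule) hhull (isGraded_H₃ hn0).isClosed fun k => ?_
  have hH₂ := (isGraded_H₂ hn0).levelProj_mem f hf hhull k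
  have hkcone := levelProj_mem_coneIdeal hcone hhull k
  obtain ⟨F, -, hF⟩ := levelProj_mem k f
  rw [← hF] at hH₂ hkcone ⊢
  by_contra h0
  obtain ⟨G, hG, hG1⟩ := exists_mem_gen_realize_sub_onePoly_mem_H₃ hn
    ((realize_mem_H₂_iff hn0).1 hH₂) h0
  have hGcone : realize G ∈ coneIdeal n := gen_le (isStable_comap_realize (coneIdeal n)) hkcone hG
  refine φ₂_notMem_coneIdeal hn0 ?_
  have h := (coneIdeal n).sub_mem hGcone (H₃_le_coneIdeal n hG1)
  rwa [← map_sub, sub_sub_cancel, ← φ₂_eq] at h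

end Chain

/-! ### The representations carried by the subquotients -/

section Subquotients

variable {n : ℕ}

theorem continuous_quotient_mk {V : Type*} [AddCommGroup V] [Module ℂ V] [TopologicalSpace V]
    [LieRingModule (𝔤 n) V] [LieModule ℂ (𝔤 n) V] (N : LieSubmodule ℂ (𝔤 n) V) :
    Continuous (LieSubmodule.Quotient.mk' N) :=
  continuous_quot_mk

theorem carries_subQuot (hn : 0 < n) {F₀ : UTPoly n} {m : ℕ} (hm : F₀ ∈ level n m)
    (hang : ∀ j k, angular j k F₀ = 0) {H N : LieSubmodule ℂ (𝔤 n) (Smooth n)}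
    (hH : H = closedSpan (realize F₀)) (hN : IsGraded N) (h0 : realize F₀ ∉ N)
    (hraise : ∀ k, realize (raise k F₀) ∈ N)
    (hirr : ∀ F ∈ gen F₀, realize F ∉ N → ∃ G ∈ gen F, realize (G - F₀) ∈ N)
    {E : ℝ} (hE : (E : ℂ) = m - weight n) : Carries n (SubQuot H N) E :=
  carries_of_isGraded hn hm hang hH hN h0 hraise hirr (continuous_quotient_mk _)
    (LieSubmodule.Quotient.surjective_mk' (N.comap H.incl))
    (fun _ => LieSubmodule.Quotient.mk_eq_zero _) hE

theorem carries_H₁_quotient (hn : 3 ≤ n) : Carries n (SubQuot (H₁ n) (H₂ n)) ((n + 2) / 2) := by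
  have hn0 : 0 < n := by omega
  refine carries_subQuot hn0 (vPoly_mem_level n) angular_vPoly (H₁_eq n) (isGraded_H₂ hn0)
    (fun h => (H₂_lt_H₁ hn).not_ge ?_) (fun k => ?_) (fun F hF h => ?_) ?_
  · rw [H₁_eq]
    exact closedSpan_le (isGraded_H₂ hn0).isClosed h
  · rw [realize_mem_H₂_iff hn0, raise_vPoly, gen_onePoly hn, LinearMap.mem_ker, wave_single,
      two_mul (X k), map_add,
      laplacian_eq_zero_of_isHomogeneous (isHomogeneous_X ℂ k) one_lt_two]
    simp
  · simp only [realize_mem_H₂_iff hn0] at h ⊢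
    exact exists_mem_gen_sub_vPoly hn hF h
  · rw [weight]
    push_cast
    ring

theorem carries_H₂_quotient (hn : 3 ≤ n) : Carries n (SubQuot (H₂ n) (H₃ n)) ((n - 2) / 2) := by
  have hn0 : 0 < n := by omega
  refine carries_subQuot hn0 (onePoly_mem_level n) angular_onePoly (H₂_eq n) (isGraded_H₃ hn0)
    (fun h => φ₂_notMem_coneIdeal hn0 (φ₂_eq n ▸ H₃_le_coneIdeal n h)) (fun k => ?_)
    (fun F => exists_mem_gen_realize_sub_onePoly_mem_H₃ hn) ?_
  · rw [raise_onePoly, map_zero]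
    exact (H₃ n).zero_mem
  · rw [weight]
    push_cast
    ring

theorem carries_H₃ (hn : 3 ≤ n) : Carries n (H₃ n) ((n + 2) / 2) := by
  refine carries_of_isGraded (by omega) (tPoly_mem_level n) angular_tPoly (H₃_eq n)
    (isGraded_bot n) (fun h => φ₃_ne_zero n ?_) (fun k => ?_) (fun F hF h => ?_)
    (π := LieModuleHom.id) continuous_id Function.surjective_id (fun f => ?_) ?_
  · rw [φ₃_eq, (LieSubmodule.mem_bot _).1 h, smul_zero]
  · rw [raise_tPoly, map_zero]
    exact LieSubmodule.zero_mem _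
  · refine ⟨tPoly n, tPoly_mem_gen hF fun hF0 => h ?_, ?_⟩
    · rw [hF0, map_zero]
      exact LieSubmodule.zero_mem _
    · rw [sub_self, map_zero]
      exact LieSubmodule.zero_mem _
  · rw [LieSubmodule.mem_bot]
    exact Subtype.ext_iff
  · rw [weight]
    push_cast
    ring

/-- The restriction of functions in `H` to the cone, as a homomorphism onto `onCone H`. -/
def toCone (H : LieSubmodule ℂ (𝔤 n) (Smooth n)) : H →ₗ⁅ℂ,𝔤 n⁆ onCone H where
  toFun f := ⟨LieSubmodule.Quotient.mk' (coneIdeal n) f, LieSubmodule.mem_map_of_mem f.2⟩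
  map_add' _ _ := rfl
  map_smul' _ _ := rfl
  map_lie' := rfl

theorem continuous_toCone (H : LieSubmodule ℂ (𝔤 n) (Smooth n)) : Continuous (toCone H) :=
  ((continuous_quotient_mk (coneIdeal n)).comp continuous_subtype_val).subtype_mk _

theorem surjective_toCone (H : LieSubmodule ℂ (𝔤 n) (Smooth n)) :
    Function.Surjective (toCone H) := by
  rintro ⟨v, hv⟩
  obtain ⟨f, hf, rfl⟩ := (LieSubmodule.mem_map _).1 hv
  exact ⟨⟨f, hf⟩, rfl⟩

theorem toCone_eq_zero_iff {H : LieSubmodule ℂ (𝔤 n) (Smooth n)} (f : H) :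
    toCone H f = 0 ↔ (f : Smooth n) ∈ coneIdeal n := by
  rw [Subtype.ext_iff]
  exact LieSubmodule.Quotient.mk_eq_zero _

theorem carries_onCone (hn : 3 ≤ n) : Carries n (onCone (H₂ n)) ((n - 2) / 2) := by
  have hn0 : 0 < n := by omega
  refine carries_of_isGraded hn0 (onePoly_mem_level n) angular_onePoly (H₂_eq n)
    (isGraded_coneIdeal n) (φ₂_eq n ▸ φ₂_notMem_coneIdeal hn0) (fun k => ?_) (fun F hF h => ?_)
    (continuous_toCone (H₂ n)) (surjective_toCone _) toCone_eq_zero_iff ?_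
  · rw [raise_onePoly, map_zero]
    exact (coneIdeal n).zero_mem
  · obtain ⟨G, hG, hGF⟩ := exists_mem_gen_realize_sub_onePoly_mem_H₃ hn hF fun h' =>
      h (H₃_le_coneIdeal n h')
    exact ⟨G, hG, H₃_le_coneIdeal n hGF⟩
  · rw [weight]
    push_cast
    ring

end Subquotients

end GuptaBleuler

end

open GuptaBleuler in
theorem mainTheorem9 (n : ℕ) (hn : 3 ≤ n) :
    -- a chain of closed invariant subspaces
    (IsClosed (H₁ n : Set (Smooth n)) ∧ IsClosed (H₂ n : Set (Smooth n)) ∧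
      IsClosed (H₃ n : Set (Smooth n)) ∧ H₂ n < H₁ n ∧ H₃ n < H₂ n) ∧
    -- the representations carried by the quotients
    (Carries n (SubQuot (H₁ n) (H₂ n)) ((n + 2) / 2) ∧
      Carries n (SubQuot (H₂ n) (H₃ n)) ((n - 2) / 2) ∧
      Carries n (H₃ n) ((n + 2) / 2)) ∧
    -- the shifted Casimir operator
    (shiftedCasimir n (φ₂ n) = 0 ∧ shiftedCasimir n (φ₃ n) = 0 ∧
      shiftedCasimir n (φ₁ n) = -(n : ℂ) • φ₃ n ∧ φ₃ n ≠ 0 ∧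
      shiftedCasimir n (shiftedCasimir n (φ₁ n)) = 0) ∧
    -- gauge states vanish on the cone
    (∀ φ ∈ H₃ n, ∀ p : cov n, ysq p.1 = 0 →
      Filter.Tendsto φ (nhdsWithin p {q : cov n | 0 < ysq q.1}) (nhds 0)) ∧
    -- the massless representation is realized on the cone
    ((∀ φ ∈ H₂ n, (∀ p : cov n, ysq p.1 = 0 → φ p = 0) ↔ φ ∈ H₃ n) ∧
      Carries n (onCone (H₂ n)) ((n - 2) / 2)) := by
  refine ⟨⟨isClosed_closedSpan _, isClosed_closedSpan _, isClosed_closedSpan _, H₂_lt_H₁ hn,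
      H₃_lt_H₂ hn⟩,
    ⟨carries_H₁_quotient hn, carries_H₂_quotient hn, carries_H₃ hn⟩,
    ⟨shiftedCasimir_φ₂ n, shiftedCasimir_φ₃ n, shiftedCasimir_φ₁ n, φ₃_ne_zero n, ?_⟩,
    fun φ hφ p hp => tendsto_zero_of_mem_coneIdeal (H₃_le_coneIdeal n hφ) hp _,
    fun φ hφ => mem_coneIdeal_iff_mem_H₃ hn hφ, carries_onCone hn⟩
  rw [shiftedCasimir_φ₁, shiftedCasimir_smul, shiftedCasimir_φ₃, smul_zero]
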